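/- Let $d\in\{1,2,3\}$, let $\Omega\subset\mathbb R^d$ be a bounded open set with $\Omega=\operatorname{int}\overline\Omega$ (for instance a bounded Lipschitz domain), and let $\sigma\in\mathbb R$. Write $\langle\cdot,\cdot\rangle$ and $\|\cdot\|$ for the inner product and norm of $L^2(\Omega)$ (summed over components for vectors and matrices), $\nabla\cdot$ for the weak divergence and $\varepsilon(\mathbf u)=\frac12(\nabla\mathbf u+\nabla\mathbf u^{t})$. For a finite conforming decomposition $\mathcal K_h$ of $\overline\Omega$ into $d$-simplices put $$W_h=\{w\in L^2(\Omega): w|_K\in\mathbb P_0\ \forall K\},\qquad \mathbf V_h=\{\mathbf v\in H(\mathrm{div};\Omega): \mathbf v|_K(\mathbf x)=\mathbf a_K+c_K\mathbf x\ \forall K\},\qquad \mathbf Z_h=\{\mathbf z\in H^1_0(\Omega)^d: \mathbf z|_K\in\mathbb P_1^d\ \forall K\}.$$ The decomposition is called $\sigma$-regular if every simplex $K$ contains a ball of diameter $\rho_K>0$ with $\operatorname{diam}K\le\sigma\rho_K$. **Theorem.** There is a constant $C=C_{\Omega,d}>0$, depending only on $\Omega$, $d$ and the regularity parameter $\sigma$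 (in particular not on the mesh size), such that the following hold. (0) For every $\sigma$-regular decomposition and every $w_h\in W_h$ there is $\mathbf v_h\in\mathbf V_h$ with $\nabla\cdot\mathbf v_h=w_h$ and $\|\mathbf v_h\|\le C\|w_h\|$. Let $\mu,\nu_f,\tau>0$, $\alpha,\rho_f\in\mathbb R$, $\mathbf g\in\mathbb R^d$, and assume: (A1) $b\in C^1(\mathbb R)$ is strictly increasing with $0<b_m\le b'\le L_b$; (A2) $h\in C^1(\mathbb R)$ is strictly increasing with $0<h_m\le h'\le L_h$; (A3) $K$ is a measurable scalar function with $0<k_m\le K(\mathbf x)\le k_M$ for all $\mathbf x\in\Omega$. Let $L_1\ge L_b/2$ and $L_2\ge L_h$. Then there is $\theta\in[0,1)$, not depending on the decomposition, on $\mathbf f,S_f$ or on the previous time step, such that for every $\sigma$-regular decomposition, all $\mathbf f\in L^2(\Omega)^d$, $S_f\in L^2(\Omega)$ and every $(p_h^{n-1},\mathbf q_h^{n-1},\mathbf u_h^{n-1})\in W_h\times\mathbf V_h\times\mathbf Z_h$ the statements (1)–(4) below hold for the following two problems. *Problem $P_h^n$*: find $(p,\mathbf q,\mathbf u)\in W_h\times\mathbf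 V_h\times\mathbf Z_h$ such that for all $\mathbf z_h\in\mathbf Z_h$, $\mathbf v_h\in\mathbf V_h$, $w_h\in W_h$ $$2\mu\langle\varepsilon(\mathbf u):\varepsilon(\mathbf z_h)\rangle+\langle h(\nabla\cdot\mathbf u),\nabla\cdot\mathbf z_h\rangle-\alpha\langle p,\nabla\cdot\mathbf z_h\rangle=\langle\mathbf f,\mathbf z_h\rangle,$$ $$\nu_f\langle K^{-1}\mathbf q,\mathbf v_h\rangle-\langle p,\nabla\cdot\mathbf v_h\rangle=\langle\rho_f\mathbf g,\mathbf v_h\rangle,$$ $$\langle b(p),w_h\rangle+\alpha\langle\nabla\cdot\mathbf u,w_h\rangle+\tau\langle\nabla\cdot\mathbf q,w_h\rangle=\tau\langle S_f,w_h\rangle+\langle b(p_h^{n-1}),w_h\rangle+\alpha\langle\nabla\cdot\mathbf u_h^{n-1},w_h\rangle.$$ *Monolithic L-scheme*: given $(p^i,\mathbf q^i,\mathbf u^i)\in W_h\times\mathbf V_h\times\mathbf Z_h$, find $(p^{i+1},\mathbf q^{i+1},\mathbf u^{i+1})\in W_h\times\mathbf V_h\times\mathbf Z_h$ such that for all $\mathbf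 z_h,\mathbf v_h,w_h$ as above $$2\mu\langle\varepsilon(\mathbf u^{i+1}):\varepsilon(\mathbf z_h)\rangle+L_2\langle\nabla\cdot\mathbf u^{i+1}-\nabla\cdot\mathbf u^{i},\nabla\cdot\mathbf z_h\rangle+\langle h(\nabla\cdot\mathbf u^{i}),\nabla\cdot\mathbf z_h\rangle-\alpha\langle p^{i+1},\nabla\cdot\mathbf z_h\rangle=\langle\mathbf f,\mathbf z_h\rangle,$$ $$\nu_f\langle K^{-1}\mathbf q^{i+1},\mathbf v_h\rangle-\langle p^{i+1},\nabla\cdot\mathbf v_h\rangle=\langle\rho_f\mathbf g,\mathbf v_h\rangle,$$ $$\langle b(p^{i}),w_h\rangle+L_1\langle p^{i+1}-p^{i},w_h\rangle+\alpha\langle\nabla\cdot\mathbf u^{i+1},w_h\rangle+\tau\langle\nabla\cdot\mathbf q^{i+1},w_h\rangle=\tau\langle S_f,w_h\rangle+\langle b(p_h^{n-1}),w_h\rangle+\alpha\langle\nabla\cdot\mathbf u_h^{n-1},w_h\rangle.$$ For $e=(e_p,\mathbf e_{\mathbf q},\mathbf e_{\mathbf u})$ let $$E(e)=\Bigl(L_1+\frac{\tau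 k_m^2}{\nu_f k_M C^2}\Bigr)\|e_p\|^2+\frac{\tau\nu_f}{k_M}\|\mathbf e_{\mathbf q}\|^2+4\mu\langle\varepsilon(\mathbf e_{\mathbf u}):\varepsilon(\mathbf e_{\mathbf u})\rangle+L_2\|\nabla\cdot\mathbf e_{\mathbf u}\|^2 .$$ (1) Each step of the scheme has exactly one solution. (2) The iteration map is a contraction in the weighted energy norm $\sqrt E$: if $e$ is the difference of two elements of $W_h\times\mathbf V_h\times\mathbf Z_h$ and $e'$ the difference of their images under one step, then $$E(e')\le L_1\|e_p\|^2+(L_2-h_m)\|\nabla\cdot\mathbf e_{\mathbf u}\|^2\qquad\text{and}\qquad E(e')\le\theta\,E(e).$$ (3) In particular, for every starting guess in $W_h\times\mathbf V_h\times\mathbf Z_h$ (such as the solution at the previous time step), the differences $e^{i}$ between the iterates $i$ and $i-1$ satisfy, for all $i\ge1$, $$E(e^{i+1})\le L_1\|e_p^{i}\|^2+(L_2-h_m)\|\nabla\cdot\mathbf e_{\mathbf u}^{i}\|^2 .$$ (4) Problem $P_h^n$ has exactly one solution, and for every starting guess in $W_h\times\mathbf V_h\times\mathbf Z_h$ the iterates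 converge to it in $L^2(\Omega)\times H(\mathrm{div};\Omega)\times H^1(\Omega)^d$. -/

import Mathlib

open MeasureTheory Filter Topology
open scoped ContDiff

namespace NonlinearBiot

noncomputable section

/-- The Euclidean space `ℝ^d`. -/
abbrev Space (d : ℕ) := EuclideanSpace ℝ (Fin d)

/-- `L²(Ω)`. -/
abbrev L2 {d : ℕ} (Ω : Set (Space d)) := Lp ℝ 2 (volume.restrict Ω)

/-- `L²(Ω)^d` with the Hilbert norm `‖v‖² = ∑ i, ‖v i‖²`. -/
abbrev L2Vec {d : ℕ} (Ω : Set (Space d)) := PiLp 2 (fun _ : Fin d => L2 Ω)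

/-- The `L²(Ω)` pairing `⟨f, g⟩ = ∫_Ω f g`. -/
def pair {d : ℕ} (Ω : Set (Space d)) (f g : Space d → ℝ) : ℝ :=
  ∫ x in Ω, f x * g x

/-- Test functions: `C_c^∞(Ω)`. -/
def IsTest {d : ℕ} (Ω : Set (Space d)) (φ : Space d → ℝ) : Prop :=
  ContDiff ℝ ∞ φ ∧ HasCompactSupport φ ∧ tsupport φ ⊆ Ω

/-- The classical partial derivative `∂ φ / ∂ x_i`. -/
def partialDeriv {d : ℕ} (i : Fin d) (φ : Space d → ℝ) (x : Space d) : ℝ :=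
  fderiv ℝ φ x (EuclideanSpace.single i 1)

/-- `g` is the weak partial derivative `∂_i u` on `Ω`. -/
def HasWeakPartial {d : ℕ} (Ω : Set (Space d)) (i : Fin d) (u g : L2 Ω) : Prop :=
  ∀ φ : Space d → ℝ, IsTest Ω φ → pair Ω u (partialDeriv i φ) = - pair Ω g φ

/-- `g` is the weak divergence of the vector field `v` on `Ω`. -/
def HasWeakDiv {d : ℕ} (Ω : Set (Space d)) (v : L2Vec Ω) (g : L2 Ω) : Prop :=
  ∀ φ : Space d → ℝ, IsTest Ω φ → ∑ i, pair Ω (v i) (partialDeriv i φ) = - pair Ω g φ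

open Classical in
/-- The weak partial derivative `∂_i u ∈ L²(Ω)` (zero if there is none). -/
def weakPartial {d : ℕ} (Ω : Set (Space d)) (i : Fin d) (u : L2 Ω) : L2 Ω :=
  if H : ∃ g, HasWeakPartial Ω i u g then H.choose else 0

open Classical in
/-- The weak divergence `∇ · v ∈ L²(Ω)` (zero if there is none). -/
def weakDiv {d : ℕ} (Ω : Set (Space d)) (v : L2Vec Ω) : L2 Ω :=
  if H : ∃ g, HasWeakDiv Ω v g then H.choose else 0

/-- The Sobolev space `H¹(Ω)`. -/
def H1 {d : ℕ} (Ω : Set (Space d)) : Set (L2 Ω) :=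
  {u | ∀ i, ∃ g, HasWeakPartial Ω i u g}

/-- `H¹₀(Ω)`: the closure of `C_c^∞(Ω)` in `H¹(Ω)`. -/
def H10 {d : ℕ} (Ω : Set (Space d)) : Set (L2 Ω) :=
  {u | u ∈ H1 Ω ∧ ∃ φ : ℕ → Space d → ℝ, (∀ n, IsTest Ω (φ n)) ∧
    Tendsto (fun n => eLpNorm (fun x => u x - φ n x) 2 (volume.restrict Ω)) atTop (𝓝 0) ∧
    ∀ i, Tendsto (fun n => eLpNorm (fun x => weakPartial Ω i u x - partialDeriv i (φ n) x) 2
      (volume.restrict Ω)) atTop (𝓝 0)}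

/-- `H(div; Ω)`. -/
def Hdiv {d : ℕ} (Ω : Set (Space d)) : Set (L2Vec Ω) :=
  {v | ∃ g, HasWeakDiv Ω v g}

/-- The entry `ε_{ij}(u) = (∂_i u_j + ∂_j u_i) / 2` of the symmetric gradient. -/
def strain {d : ℕ} (Ω : Set (Space d)) (u : L2Vec Ω) (i j : Fin d) : L2 Ω :=
  (2⁻¹ : ℝ) • (weakPartial Ω i (u j) + weakPartial Ω j (u i))

/-- `⟨ε(u) : ε(z)⟩`. -/
def strainPair {d : ℕ} (Ω : Set (Space d)) (u z : L2Vec Ω) : ℝ :=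
  ∑ i, ∑ j, pair Ω (strain Ω u i j) (strain Ω z i j)

/-- A finite conforming decomposition of `Ω` into `d`-simplices: the `d`-dimensional simplices
of a finite simplicial complex, whose union is the closure of `Ω`. -/
structure Mesh {d : ℕ} (Ω : Set (Space d)) where
  complex : Geometry.SimplicialComplex ℝ (Space d)
  finite : complex.faces.Finite
  covers : ⋃ s ∈ {s ∈ complex.faces | s.card = d + 1},
    convexHull ℝ (s : Set (Space d)) = closure Ω

namespace Mesh

variable {d : ℕ} {Ω : Set (Space d)}

/-- The elements of the mesh, given by their vertex sets. -/
def cells (T : Mesh Ω) : Set (Finset (Space d)) :=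
  {s ∈ T.complex.faces | s.card = d + 1}

/-- Shape regularity: the diameter of each element is at most `σ` times the diameter `2 r` of a
ball contained in that element. -/
def ShapeRegular (T : Mesh Ω) (σ : ℝ) : Prop :=
  ∀ s ∈ T.cells, ∃ (x : Space d) (r : ℝ), 0 < r ∧
    Metric.closedBall x r ⊆ convexHull ℝ (s : Set (Space d)) ∧
    Metric.diam (convexHull ℝ (s : Set (Space d))) ≤ σ * (2 * r)

/-- Piecewise constant pressures `W_h`. -/
def W (T : Mesh Ω) : Set (L2 Ω) :=
  {w | ∀ s ∈ T.cells, ∃ c : ℝ, ∀ᵐ x ∂(volume.restrict Ω),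
    x ∈ convexHull ℝ (s : Set (Space d)) → w x = c}

/-- Lowest order Raviart-Thomas fluxes `V_h`. -/
def V (T : Mesh Ω) : Set (L2Vec Ω) :=
  {v | v ∈ Hdiv Ω ∧ ∀ s ∈ T.cells, ∃ (a : Space d) (c : ℝ), ∀ᵐ x ∂(volume.restrict Ω),
    x ∈ convexHull ℝ (s : Set (Space d)) → ∀ i, v i x = a i + c * x i}

/-- Conforming piecewise linear displacements `Z_h` with zero boundary values. -/
def Z (T : Mesh Ω) : Set (L2Vec Ω) :=
  {z | (∀ i, z i ∈ H10 Ω) ∧ ∀ s ∈ T.cells, ∀ i, ∃ a : Space d →ᵃ[ℝ] ℝ,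
    ∀ᵐ x ∂(volume.restrict Ω), x ∈ convexHull ℝ (s : Set (Space d)) → z i x = a x}

/-- For each `w ∈ W_h` there is `v ∈ V_h` with `∇ · v = w` and `‖v‖ ≤ C ‖w‖`. -/
def DivStable (T : Mesh Ω) (C : ℝ) : Prop :=
  ∀ w ∈ T.W, ∃ v ∈ T.V, weakDiv Ω v = w ∧ ‖v‖ ≤ C * ‖w‖

end Mesh

/-- Pressure, flux and displacement. -/
structure State {d : ℕ} (Ω : Set (Space d)) where
  p : L2 Ω
  q : L2Vec Ω
  u : L2Vec Ω

/-- `W_h × V_h × Z_h`. -/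
def Mesh.states {d : ℕ} {Ω : Set (Space d)} (T : Mesh Ω) : Set (State Ω) :=
  {x | x.p ∈ T.W ∧ x.q ∈ T.V ∧ x.u ∈ T.Z}

/-- The coefficients of the model and the time step `τ`. -/
structure Coeffs (d : ℕ) where
  μ : ℝ
  α : ℝ
  ν : ℝ
  ρ : ℝ
  τ : ℝ
  gravity : Space d
  K : Space d → ℝ
  b : ℝ → ℝ
  h : ℝ → ℝ

/-- A strictly increasing `C¹` function with `0 < m ≤ φ' ≤ L`. -/
structure IncreasingLipschitz (φ : ℝ → ℝ) (m L : ℝ) : Prop where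
  contDiff : ContDiff ℝ 1 φ
  strictMono : StrictMono φ
  pos : 0 < m
  le_deriv : ∀ s, m ≤ deriv φ s
  deriv_le : ∀ s, deriv φ s ≤ L

/-- A (measurable) permeability with `0 < km ≤ K ≤ kM` on `Ω`. -/
structure BoundedPermeability {d : ℕ} (Ω : Set (Space d)) (K : Space d → ℝ) (km kM : ℝ) :
    Prop where
  aemeasurable : AEMeasurable K (volume.restrict Ω)
  pos : 0 < km
  le_K : ∀ x ∈ Ω, km ≤ K x
  K_le : ∀ x ∈ Ω, K x ≤ kM

section Problems

variable {d : ℕ} {Ω : Set (Space d)}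

/-- Darcy's law: `ν ⟨K⁻¹ q, v⟩ - ⟨p, ∇ · v⟩ = ⟨ρ g, v⟩` for all `v ∈ V_h`. -/
def Darcy (T : Mesh Ω) (P : Coeffs d) (p : L2 Ω) (q : L2Vec Ω) : Prop :=
  ∀ v ∈ T.V, P.ν * ∑ i, pair Ω (fun x => (P.K x)⁻¹ * q i x) (v i) - pair Ω p (weakDiv Ω v)
    = ∑ i, pair Ω (fun _ => P.ρ * P.gravity i) (v i)

/-- The fully discrete non-linear Biot problem `P_h^n`, with `old` the solution at the previous
time step. -/
structure IsSolution (T : Mesh Ω) (P : Coeffs d) (f : L2Vec Ω) (S : L2 Ω) (old x : State Ω) :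
    Prop where
  mem : x ∈ T.states
  momentum : ∀ z ∈ T.Z,
    2 * P.μ * strainPair Ω x.u z + pair Ω (fun y => P.h (weakDiv Ω x.u y)) (weakDiv Ω z)
      - P.α * pair Ω x.p (weakDiv Ω z) = ∑ i, pair Ω (f i) (z i)
  darcy : Darcy T P x.p x.q
  mass : ∀ w ∈ T.W,
    pair Ω (fun y => P.b (x.p y)) w + P.α * pair Ω (weakDiv Ω x.u) w
        + P.τ * pair Ω (weakDiv Ω x.q) w
      = P.τ * pair Ω S w + pair Ω (fun y => P.b (old.p y)) w
        + P.α * pair Ω (weakDiv Ω old.u) w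

/-- One step `x ↦ x'` of the monolithic L-scheme with parameters `L₁`, `L₂`. -/
structure IsStep (T : Mesh Ω) (P : Coeffs d) (L₁ L₂ : ℝ) (f : L2Vec Ω) (S : L2 Ω)
    (old x x' : State Ω) : Prop where
  mem : x' ∈ T.states
  momentum : ∀ z ∈ T.Z,
    2 * P.μ * strainPair Ω x'.u z
        + L₂ * pair Ω (fun y => weakDiv Ω x'.u y - weakDiv Ω x.u y) (weakDiv Ω z)
        + pair Ω (fun y => P.h (weakDiv Ω x.u y)) (weakDiv Ω z)
        - P.α * pair Ω x'.p (weakDiv Ω z) = ∑ i, pair Ω (f i) (z i)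
  darcy : Darcy T P x'.p x'.q
  mass : ∀ w ∈ T.W,
    pair Ω (fun y => P.b (x.p y)) w + L₁ * pair Ω (fun y => x'.p y - x.p y) w
        + P.α * pair Ω (weakDiv Ω x'.u) w + P.τ * pair Ω (weakDiv Ω x'.q) w
      = P.τ * pair Ω S w + pair Ω (fun y => P.b (old.p y)) w
        + P.α * pair Ω (weakDiv Ω old.u) w

/-- A sequence of iterates of the monolithic L-scheme with a discrete starting guess. -/
def IsLScheme (T : Mesh Ω) (P : Coeffs d) (L₁ L₂ : ℝ) (f : L2Vec Ω) (S : L2 Ω)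
    (old : State Ω) (X : ℕ → State Ω) : Prop :=
  X 0 ∈ T.states ∧ ∀ i, IsStep T P L₁ L₂ f S old (X i) (X (i + 1))

/-- The componentwise difference of two states. -/
def State.diff (x y : State Ω) : State Ω := ⟨x.p - y.p, x.q - y.q, x.u - y.u⟩

/-- The square of the weighted energy norm,
`(L₁ + τ km² / (ν kM C²)) ‖p‖² + (τ ν / kM) ‖q‖² + 4 μ ⟨ε(u) : ε(u)⟩ + L₂ ‖∇ · u‖²`. -/
def energySq (P : Coeffs d) (L₁ L₂ km kM C : ℝ) (e : State Ω) : ℝ :=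
  (L₁ + P.τ * km ^ 2 / (P.ν * kM * C ^ 2)) * ‖e.p‖ ^ 2 + P.τ * P.ν / kM * ‖e.q‖ ^ 2
    + 4 * P.μ * strainPair Ω e.u e.u + L₂ * ‖weakDiv Ω e.u‖ ^ 2

/-- Convergence in `L²(Ω) × H(div; Ω) × H¹(Ω)^d`. -/
structure StateTendsto (X : ℕ → State Ω) (x : State Ω) : Prop where
  p : Tendsto (fun i => (X i).p) atTop (𝓝 x.p)
  q : Tendsto (fun i => (X i).q) atTop (𝓝 x.q)
  div_q : Tendsto (fun i => weakDiv Ω (X i).q) atTop (𝓝 (weakDiv Ω x.q))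
  u : Tendsto (fun i => (X i).u) atTop (𝓝 x.u)
  grad_u : ∀ j k, Tendsto (fun i => weakPartial Ω j ((X i).u k)) atTop
    (𝓝 (weakPartial Ω j (x.u k)))

end Problems

end

end NonlinearBiot

open NonlinearBiot

/-! The contraction is an energy estimate. In the difference of two steps the data `f`, `S` and the
previous time level drop out, and the right-hand side consists of `L₂ D - (h(D₁) - h(D₂))` and `L₁ e
- (b(p₁) - b(p₂))`, where `D` and `e` are the old differences of divergence and pressure. By the
mean value theorem these are pointwise `(L₂ - t) D` and `(L₁ - t) e`, with `t` between the bounds on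
the derivative, so their norms are at most `(L₂ - hm) ‖D‖` and `L₁ ‖e‖`
(`norm_smul_sub_superpose_le`). Testing with the new difference, its flux multiplied by `τ`, cancels
all coupling terms (`stepForm_energy`). After Young's inequality the flux term is present twice. One
copy is kept; the other is traded for pressure, since Darcy's law tested with a field `v` of
divergence `p` and `‖v‖ ≤ C ‖p‖` bounds `‖p‖` by `(ν C / km) ‖q‖`. This extra pressure term brings
the rate below one, although `L₁` stands on both sides (`energySq_le_of_stepForm`, `exists_rate`).
The same identity and Korn's identity make the linear step injective, hence uniquely solvable in
finite dimension. Solutions of the non-linear problem are the fixed points of the step, and a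
contraction argument in the energy yields existence, uniqueness and convergence.

The longer part is a stability constant `C` that is uniform over shape regular meshes. For `d ≥ 2`
the flux comes from a two-point finite volume scheme: the flux through a facet is a weight times the
jump of unknown cell values (zero outside `Ω`), and the total flux out of a cell is prescribed as
volume times `w`. The quadratic form of this system is the weighted sum of squared jumps. A discrete
Poincaré inequality controls the cell values by it: the field `x` has constant divergence, so a sum
of `vol * p²` over cells is a sum over facets of fluxes of `x` times jumps of `p²`, and `p² - q² =
(p - q)(p + q)` with Cauchy–Schwarz concludes (`sum_vol_sq_le`). Besides shape regularity only a
bound for `|x|` on `Ω` enters the constant. The Raviart–Thomas field with these facet fluxes has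
weak divergence `w` because contributions of a test function cancel facet by facet. That rests on a
divergence theorem for `φ (x - a)` on a simplex, derived by differentiating the integral over
homothetic copies, and on boundary facets being disjoint from `Ω`. For `d = 1` the primitive of `w`
is the required flux. -/

namespace NonlinearBiot
noncomputable section

/-! ### Barycentric coordinates and the motion of one vertex of a simplex -/

section Simplex

variable {E : Type*} [NormedAddCommGroup E] [NormedSpace ℝ E]

/-- The vertex set of a full-dimensional simplex. -/
def IsSimplex (s : Finset E) : Prop :=
  AffineIndependent ℝ ((↑) : s → E) ∧ s.card = Module.finrank ℝ E + 1

theorem IsSimplex.exists_basis [FiniteDimensional ℝ E] {s : Finset E} (hs : IsSimplex s) :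
    ∃ b : AffineBasis s ℝ E, ⇑b = ((↑) : s → E) := by
  refine ⟨⟨(↑), hs.1, ?_⟩, rfl⟩
  rw [hs.1.affineSpan_eq_top_iff_card_eq_finrank_add_one]
  simpa using hs.2

open Classical in
/-- The barycentric coordinate of the vertex `a` in the simplex `s`. -/
def bary (s : Finset E) (a : E) : E →ᵃ[ℝ] ℝ :=
  if h : (∃ b : AffineBasis s ℝ E, ⇑b = ((↑) : s → E)) ∧ a ∈ s
    then h.1.choose.coord ⟨a, h.2⟩ else 0

namespace IsSimplex

variable [FiniteDimensional ℝ E] {s s' : Finset E} {a a' b x : E}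

theorem exists_basis_coord (hs : IsSimplex s) :
    ∃ b : AffineBasis s ℝ E, ⇑b = ((↑) : s → E) ∧ ∀ a : s, bary s a = b.coord a := by
  refine ⟨hs.exists_basis.choose, hs.exists_basis.choose_spec, fun a => ?_⟩
  rw [bary, dif_pos ⟨hs.exists_basis, a.2⟩]

theorem bary_self (hs : IsSimplex s) (ha : a ∈ s) : bary s a a = 1 := by
  obtain ⟨B, hB, h⟩ := hs.exists_basis_coord
  have := B.coord_apply_eq ⟨a, ha⟩
  rwa [← h, hB] at this

theorem bary_of_ne (hs : IsSimplex s) (ha : a ∈ s) (hb : b ∈ s) (hab : a ≠ b) :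
    bary s a b = 0 := by
  obtain ⟨B, hB, h⟩ := hs.exists_basis_coord
  have := B.coord_apply_ne (i := ⟨a, ha⟩) (j := ⟨b, hb⟩) (by simpa using hab)
  rwa [← h, hB] at this

theorem sum_bary (hs : IsSimplex s) (x : E) : ∑ a ∈ s, bary s a x = 1 := by
  obtain ⟨B, hB, h⟩ := hs.exists_basis_coord
  rw [← B.sum_coord_apply_eq_one x, ← Finset.sum_coe_sort]
  simp [h]

theorem sum_bary_smul (hs : IsSimplex s) (x : E) : ∑ a ∈ s, bary s a x • a = x := by
  obtain ⟨B, hB, h⟩ := hs.exists_basis_coord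
  conv_rhs => rw [← B.linear_combination_coord_eq_self x]
  rw [← Finset.sum_coe_sort]
  simp [h, hB]

theorem mem_convexHull_iff (hs : IsSimplex s) :
    x ∈ convexHull ℝ (s : Set E) ↔ ∀ a ∈ s, 0 ≤ bary s a x := by
  obtain ⟨B, hB, h⟩ := hs.exists_basis_coord
  have := B.convexHull_eq_nonneg_coord
  rw [hB] at this
  simp only [Subtype.range_coe_subtype, Finset.setOfPred_mem] at this
  rw [this]
  simp [← h]

theorem map_eq_sum (hs : IsSimplex s) {F : Type*} [AddCommGroup F] [Module ℝ F] (f : E →ᵃ[ℝ] F)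
    (x : E) : f x = ∑ a ∈ s, bary s a x • f a := by
  have h1 : ∀ y, f y = f.linear y + f 0 := fun y => congrFun f.decomp y
  conv_lhs => rw [h1, ← hs.sum_bary_smul x]
  conv_rhs => enter [2, a]; rw [h1]
  simp only [smul_add, Finset.sum_add_distrib, ← Finset.sum_smul, hs.sum_bary, map_sum,
    map_smul, one_smul]

theorem bary_eq_zero_of_mem_convexHull (hs : IsSimplex s) (ha : a ∈ s) {t : Set E}
    (ht : t ⊆ s) (hat : a ∉ t) (hx : x ∈ convexHull ℝ t) : bary s a x = 0 := by
  have hconv : Convex ℝ {y | bary s a y = 0} := by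
    have := (convex_singleton (𝕜 := ℝ) (0 : ℝ)).affine_preimage (bary s a)
    simpa [Set.preimage] using this
  refine convexHull_min (fun y hy => ?_) hconv hx
  exact hs.bary_of_ne ha (ht hy) (fun h => hat (h ▸ hy))

theorem bary_le_one (hs : IsSimplex s) (ha : a ∈ s) (hx : x ∈ convexHull ℝ (s : Set E)) :
    bary s a x ≤ 1 := by
  rw [← hs.sum_bary x]
  exact Finset.single_le_sum (f := fun a => bary s a x) (hs.mem_convexHull_iff.1 hx) ha

/-- Change of the vertex opposite to a common facet. -/
theorem bary_ne_zero [DecidableEq E] (hs : IsSimplex s) (hs' : IsSimplex s') (ha : a ∈ s)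
    (h : s.erase a = s'.erase a') : bary s a a' ≠ 0 := by
  intro h0
  -- A coordinate vanishing at `a'` as well as on the common facet would vanish at all vertices of
  -- `s'`, hence everywhere, but it is one at `a`.
  have h1 := hs'.map_eq_sum (bary s a) a
  rw [hs.bary_self ha, Finset.sum_eq_zero] at h1
  · exact one_ne_zero h1
  intro b hb
  by_cases hba : b = a'
  · simp [hba, h0]
  · have hb2 : b ∈ s.erase a := h ▸ Finset.mem_erase.2 ⟨hba, hb⟩
    rw [hs.bary_of_ne ha (Finset.mem_of_mem_erase hb2) (Finset.ne_of_mem_erase hb2).symm, smul_zero]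

/-- An affine function is determined by its values at the vertices of `s'`, and `bary s a` vanishes
at all of them except `a'`. Signs and facet fluxes of neighbouring cells are compared through this
proportionality. -/
theorem bary_eq_mul [DecidableEq E] (hs : IsSimplex s) (hs' : IsSimplex s') (ha : a ∈ s)
    (ha' : a' ∈ s') (h : s.erase a = s'.erase a') (x : E) :
    bary s a x = bary s' a' x * bary s a a' := by
  rw [hs'.map_eq_sum (bary s a) x, Finset.sum_eq_single_of_mem a' ha', smul_eq_mul]
  intro b hb hba
  have hb2 : b ∈ s.erase a := h ▸ Finset.mem_erase.2 ⟨hba, hb⟩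
  rw [hs.bary_of_ne ha (Finset.mem_of_mem_erase hb2) (Finset.ne_of_mem_erase hb2).symm, smul_zero]

/-- The affine map fixing the facet of `s` opposite to `a` and moving `a` to `a'`. -/
def moveVertex (s : Finset E) (a a' : E) : E →ᵃ[ℝ] E :=
  AffineMap.id ℝ E + (LinearMap.toSpanSingleton ℝ E (a' - a)).toAffineMap.comp (bary s a)

theorem moveVertex_apply (s : Finset E) (a a' x : E) :
    moveVertex s a a' x = x + bary s a x • (a' - a) := by
  simp [moveVertex]

theorem moveVertex_linear (s : Finset E) (a a' : E) :
    (moveVertex s a a').linear = LinearMap.transvection (bary s a).linear (a' - a) := by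
  ext x
  simp [moveVertex, LinearMap.transvection]

/-- A transvection with functional `λ` and vector `a' - a` has determinant `1 + λ (a' - a)`, and
here `λ (a' - a) = bary s a a' - 1`. -/
theorem det_moveVertex (hs : IsSimplex s) (ha : a ∈ s) :
    LinearMap.det (moveVertex s a a').linear = bary s a a' := by
  rw [moveVertex_linear, LinearMap.transvection.det]
  have := (bary s a).linearMap_vsub a' a
  simp only [vsub_eq_sub, hs.bary_self ha] at this
  rw [this]; ring

theorem moveVertex_self (hs : IsSimplex s) (ha : a ∈ s) : moveVertex s a a' a = a' := by
  simp [moveVertex_apply, hs.bary_self ha]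

theorem moveVertex_of_mem [DecidableEq E] (hs : IsSimplex s) (ha : a ∈ s)
    (hx : x ∈ convexHull ℝ (s.erase a : Set E)) : moveVertex s a a' x = x := by
  rw [moveVertex_apply, hs.bary_eq_zero_of_mem_convexHull ha (t := (s.erase a : Set E)) (by simp)
    (by simp) hx]
  simp

theorem moveVertex_image [DecidableEq E] (hs : IsSimplex s) (ha : a ∈ s)
    (ha' : a' ∈ s') (h : s.erase a = s'.erase a') :
    moveVertex s a a' '' convexHull ℝ (s : Set E) = convexHull ℝ (s' : Set E) := by
  rw [AffineMap.image_convexHull]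
  congr 1
  rw [← Finset.insert_erase ha, ← Finset.insert_erase ha', ← h]
  rw [Finset.coe_insert, Set.image_insert_eq, Finset.insert_erase ha, hs.moveVertex_self ha,
    Finset.coe_insert]
  congr 1
  refine (Set.image_congr (g := id) fun x hx => ?_).trans (Set.image_id _)
  exact hs.moveVertex_of_mem ha (subset_convexHull ℝ _ hx)

theorem isCompact_convexHull (s : Finset E) : IsCompact (convexHull ℝ (s : Set E)) :=
  Set.Finite.isCompact_convexHull ℝ s.finite_toSet

theorem measurableSet_convexHull [MeasurableSpace E] [BorelSpace E] (s : Finset E) :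
    MeasurableSet (convexHull ℝ (s : Set E)) :=
  (isCompact_convexHull s).isClosed.measurableSet

theorem interior_nonempty (hs : IsSimplex s) : (interior (convexHull ℝ (s : Set E))).Nonempty := by
  rw [interior_convexHull_nonempty_iff_affineSpan_eq_top]
  have := hs.1.affineSpan_eq_top_iff_card_eq_finrank_add_one.2 (by simpa using hs.2)
  simpa using this

section Measure

variable [MeasurableSpace E] [BorelSpace E] (μ : Measure E) [μ.IsAddHaarMeasure]

theorem measureReal_pos (hs : IsSimplex s) : 0 < μ.real (convexHull ℝ (s : Set E)) := by
  refine ENNReal.toReal_pos (Measure.measure_pos_of_nonempty_interior μ hs.interior_nonempty).ne' ?_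
  exact (isCompact_convexHull s).measure_lt_top.ne

/-- Change of variables along `moveVertex`, which carries `s` onto its neighbour with constant
Jacobian. Since that map fixes the common facet, integrals over the two cells become comparable
through data on the facet. -/
theorem integral_convexHull_eq [DecidableEq E] (hs : IsSimplex s) (hs' : IsSimplex s')
    (ha : a ∈ s) (ha' : a' ∈ s') (h : s.erase a = s'.erase a') (g : E → ℝ) :
    ∫ x in convexHull ℝ (s' : Set E), g x ∂μ
      = |bary s a a'| * ∫ x in convexHull ℝ (s : Set E), g (moveVertex s a a' x) ∂μ := by
  set T := moveVertex s a a'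
  set A : E →L[ℝ] E := LinearMap.toContinuousLinearMap T.linear
  have hA : A.det = bary s a a' := by
    rw [← hs.det_moveVertex ha (a' := a'), ContinuousLinearMap.det]; rfl
  have hT : ∀ x, T x = A x + T 0 := fun x => by
    have := T.decomp
    conv_lhs => rw [T.decomp]
    simp [A]
  have hinj : Function.Injective T := by
    rw [← T.linear_injective_iff]
    have : LinearMap.ker T.linear = ⊥ := by
      by_contra hk
      have := LinearMap.det_eq_zero_iff_ker_ne_bot.2 hk
      rw [hs.det_moveVertex ha] at this
      exact bary_ne_zero hs hs' ha h this
    exact LinearMap.ker_eq_bot.1 this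
  rw [← hs.moveVertex_image ha ha' h, integral_image_eq_integral_abs_det_fderiv_smul μ
    (measurableSet_convexHull s) (f := T) (f' := fun _ => A) (fun x _ => ?_) hinj.injOn]
  · simp only [hA, smul_eq_mul]
    rw [integral_const_mul]
  · have : HasFDerivAt T A x := by
      have : (T : E → E) = fun x => A x + T 0 := funext hT
      rw [this]
      exact A.hasFDerivAt.add_const _
    exact this.hasFDerivWithinAt

theorem measureReal_eq [DecidableEq E] (hs : IsSimplex s) (hs' : IsSimplex s')
    (ha : a ∈ s) (ha' : a' ∈ s') (h : s.erase a = s'.erase a') :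
    μ.real (convexHull ℝ (s' : Set E)) = |bary s a a'| * μ.real (convexHull ℝ (s : Set E)) := by
  have := integral_convexHull_eq μ hs hs' ha ha' h (fun _ => 1)
  simpa using this

end Measure

end IsSimplex
end Simplex

/-! ### A divergence theorem for radial fields -/

section Radial

variable {E : Type*} [NormedAddCommGroup E] [NormedSpace ℝ E] [FiniteDimensional ℝ E]
  [MeasurableSpace E] [BorelSpace E] (μ : Measure E) [μ.IsAddHaarMeasure]

theorem integral_homothety_image (K : Set E) (hK : MeasurableSet K) (a : E) {t : ℝ} (ht : 0 < t)
    (g : E → ℝ) :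
    ∫ x in AffineMap.homothety a t '' K, g x ∂μ
      = ∫ x in K, t ^ Module.finrank ℝ E * g (a + t • (x - a)) ∂μ := by
  have hf : ∀ x, AffineMap.homothety a t x = a + t • (x - a) := fun x => by
    simp [AffineMap.homothety_apply, add_comm]
  rw [integral_image_eq_integral_abs_det_fderiv_smul μ hK
    (f' := fun _ => t • ContinuousLinearMap.id ℝ E)]
  · have : (t • ContinuousLinearMap.id ℝ E).det = t ^ Module.finrank ℝ E := by
      rw [ContinuousLinearMap.det]; simp
    simp only [this, hf, smul_eq_mul, abs_of_pos (pow_pos ht _)]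
  · intro x _
    have h : HasFDerivAt (fun x : E => a + t • (x - a)) (t • ContinuousLinearMap.id ℝ E) x :=
      (((hasFDerivAt_id x).sub_const a).const_smul t).const_add a
    exact (h.congr_of_eventuallyEq (Eventually.of_forall hf)).hasFDerivWithinAt
  · intro x _ y _ hxy
    simp only [hf] at hxy
    have := smul_right_injective E ht.ne' (add_left_cancel hxy)
    exact sub_left_injective this

/-- Differentiation under the integral, dominated by compactness of `[0, 2] × K`. When `n` is the
dimension, the left side is the integral of `χ` over the copy of `K` scaled about `a`, and the
derivative at one is the integral of the divergence of `χ (x - a)`. -/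
theorem hasDerivAt_integral_radial {K : Set E} (hK : IsCompact K) (a : E) {χ : E → ℝ}
    (hχ : ContDiff ℝ 1 χ) (n : ℕ) :
    HasDerivAt (fun t : ℝ => ∫ x in K, t ^ n * χ (a + t • (x - a)) ∂μ)
      (∫ x in K, (fderiv ℝ χ x (x - a) + n * χ x) ∂μ) 1 := by
  set F' : ℝ → E → ℝ := fun t x =>
    n * t ^ (n - 1) * χ (a + t • (x - a)) + t ^ n * fderiv ℝ χ (a + t • (x - a)) (x - a)
  have hfc : Continuous (fderiv ℝ χ) := hχ.continuous_fderiv one_ne_zero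
  have hχc : Continuous χ := hχ.continuous
  have hF'c : Continuous (fun p : ℝ × E => F' p.1 p.2) := by
    have : Continuous fun p : ℝ × E => fderiv ℝ χ (a + p.1 • (p.2 - a)) (p.2 - a) := by
      refine Continuous.clm_apply (hfc.comp (by fun_prop)) (by fun_prop)
    simp only [F']
    fun_prop
  obtain ⟨C, hC⟩ := ((isCompact_Icc (a := (0 : ℝ)) (b := 2)).prod hK).exists_bound_of_continuousOn
    hF'c.continuousOn
  have hfin : μ K < ⊤ := hK.measure_lt_top
  have : IsFiniteMeasure (μ.restrict K) := ⟨by simpa using hfin⟩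
  have hFc : ∀ t : ℝ, Continuous fun x : E => t ^ n * χ (a + t • (x - a)) := fun t => by fun_prop
  have hF'1 : Continuous (F' 1) :=
    hF'c.comp (by fun_prop : Continuous fun x : E => ((1 : ℝ), x))
  have key := hasDerivAt_integral_of_dominated_loc_of_deriv_le (μ := μ.restrict K)
    (F := fun t x => t ^ n * χ (a + t • (x - a))) (F' := F') (x₀ := (1 : ℝ))
    (s := Metric.ball 1 1) (bound := fun _ => C) (Metric.ball_mem_nhds _ one_pos)
    (Eventually.of_forall fun t => (hFc t).aestronglyMeasurable)
    ((hFc 1).continuousOn.integrableOn_compact hK)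
    hF'1.aestronglyMeasurable
    ?_ (integrable_const C) ?_
  · have h : ∫ x in K, (fderiv ℝ χ x (x - a) + n * χ x) ∂μ = ∫ x in K, F' 1 x ∂μ :=
      integral_congr_ae (Eventually.of_forall fun x => by simp [F', add_comm])
    rw [h]
    exact key.2
  · refine (ae_restrict_iff' hK.measurableSet).2 (Eventually.of_forall fun x hx t ht => ?_)
    refine hC (t, x) ⟨?_, hx⟩
    rw [Metric.mem_ball, Real.dist_eq, abs_lt] at ht
    constructor <;> simp <;> linarith
  · refine Eventually.of_forall fun x t _ => ?_
    have h1 : HasDerivAt (fun t : ℝ => a + t • (x - a)) (x - a) t := by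
      simpa using ((hasDerivAt_id t).smul_const (x - a)).const_add a
    have h2 := (hχ.differentiable one_ne_zero (a + t • (x - a))).hasFDerivAt.comp_hasDerivAt t h1
    exact (hasDerivAt_pow n t).mul h2

/-- The divergence theorem for `χ (x - a)` on a set `K` star-shaped with respect to `a`, when `χ`
vanishes on the part `F` of the boundary not swept out by rays from `a`. -/
theorem integral_radial_eq_zero {K F : Set E} (hK : IsCompact K) (hKc : Convex ℝ K) {a : E}
    (ha : a ∈ K) (hFK : F ⊆ K)
    (hcone : ∀ x ∈ K, ∃ y ∈ F, ∃ t : ℝ, 0 ≤ t ∧ t ≤ 1 ∧ x = a + t • (y - a))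
    {χ : E → ℝ} (hχ : ContDiff ℝ 1 χ) (hF : ∀ y ∈ F, χ y = 0) :
    ∫ x in K, (fderiv ℝ χ x (x - a) + Module.finrank ℝ E * χ x) ∂μ = 0 := by
  set n := Module.finrank ℝ E
  have hder := hasDerivAt_integral_radial μ hK a hχ n
  set H : ℝ → ℝ := fun t : ℝ => ∫ x in K, t ^ n * χ (a + t • (x - a)) ∂μ
  have hfin : μ K ≠ ⊤ := hK.measure_lt_top.ne
  obtain ⟨L, hL⟩ := hK.exists_bound_of_continuousOn
    (hχ.continuous_fderiv one_ne_zero).continuousOn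
  have hLip : ∀ x ∈ K, ∀ y ∈ K, ‖χ x - χ y‖ ≤ L * ‖x - y‖ := fun x hx y hy =>
    hKc.norm_image_sub_le_of_norm_fderiv_le
      (fun z _ => hχ.differentiable one_ne_zero z) hL hy hx
  have hL0 : 0 ≤ L := (norm_nonneg _).trans (hL a ha)
  obtain ⟨D, hD⟩ := hK.exists_bound_of_continuousOn
    (f := fun y => a - y) (by fun_prop : Continuous fun y : E => a - y).continuousOn
  have hD0 : 0 ≤ D := (norm_nonneg _).trans (hD a ha)
  -- The difference of `H` is an integral over the shell between `K` and its scaled copy. The shell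
  -- has volume `(1 - t ^ n) μ(K)` and its points are within `(1 - t) D` of `F`, where `χ` vanishes,
  -- so the bound is of second order in `1 - t`.
  have hbound : ∀ t : ℝ, 0 < t → t < 1 →
      |H t - H 1| ≤ L * D * (1 - t) * ((1 - t ^ n) * μ.real K) := by
    intro t ht0 ht1
    set Kt := AffineMap.homothety a t '' K
    have hmemt : ∀ x : E, x ∈ K → a + t • (x - a) ∈ Kt := fun x hx =>
      ⟨x, hx, by simp [AffineMap.homothety_apply, add_comm]⟩
    have hsub : Kt ⊆ K := by
      rintro _ ⟨x, hx, rfl⟩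
      have := hKc.add_smul_sub_mem ha hx ⟨ht0.le, ht1.le⟩
      simpa [AffineMap.homothety_apply, add_comm] using this
    have hKt : IsCompact Kt := hK.image (AffineMap.homothety_continuous a t)
    have hvol : μ.real (K \ Kt) = (1 - t ^ n) * μ.real K := by
      have h1 := measureReal_sdiff (μ := μ) hsub hKt.measurableSet hfin
      rw [h1]
      have : μ.real Kt = t ^ n * μ.real K := by
        rw [measureReal_def, Measure.addHaar_image_homothety, ENNReal.toReal_mul,
          ENNReal.toReal_ofReal (abs_nonneg _), abs_of_pos (pow_pos ht0 _), measureReal_def]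
      rw [this]; ring
    have hint : IntegrableOn χ K μ := hχ.continuous.continuousOn.integrableOn_compact hK
    have hHt : H t = ∫ x in Kt, χ x ∂μ :=
      (integral_homothety_image μ K hK.measurableSet a ht0 χ).symm
    have hH1 : H 1 = ∫ x in K, χ x ∂μ := by simp [H]
    have hdiff : H 1 - H t = ∫ x in K \ Kt, χ x ∂μ := by
      rw [hHt, hH1, setIntegral_sdiff hKt.measurableSet hint hsub]
    rw [abs_sub_comm, hdiff, ← Real.norm_eq_abs, ← hvol]
    refine norm_setIntegral_le_of_norm_le_const
      ((measure_mono Set.sdiff_subset).trans_lt hK.measure_lt_top) (fun x hx => ?_)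
    obtain ⟨y, hy, s, hs0, hs1, rfl⟩ := hcone x hx.1
    -- A ray parameter `s ≤ t` would put the point into the scaled copy, as the image of the point
    -- with parameter `s / t`.
    have hst : t < s := by
      by_contra hle
      push Not at hle
      apply hx.2
      have := hmemt _ (hKc.add_smul_sub_mem ha (hFK hy) (t := s / t) ⟨by positivity,
        (div_le_one ht0).2 hle⟩)
      rwa [add_sub_cancel_left, smul_smul, mul_div_cancel₀ _ ht0.ne'] at this
    have h2 := hLip _ hx.1 y (hFK hy)
    rw [hF y hy, sub_zero] at h2
    refine h2.trans ?_
    have h3 : a + s • (y - a) - y = (1 - s) • (a - y) := by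
      rw [sub_smul, one_smul, smul_sub, smul_sub]; abel
    rw [h3, norm_smul, Real.norm_eq_abs, abs_of_nonneg (by linarith), mul_assoc, mul_comm D]
    gcongr
    exact hD y (hFK hy)
  have hslope := (hasDerivAt_iff_tendsto_slope.1 hder).mono_left
    (nhdsWithin_mono (1 : ℝ) (fun x hx => ne_of_lt hx : Set.Iio (1 : ℝ) ⊆ {1}ᶜ))
  -- Slopes from the left suffice: they tend to the derivative and, by the second-order bound, to
  -- zero.
  have hzero : Tendsto (slope H 1) (𝓝[<] 1) (𝓝 0) := by
    have hlim : Tendsto (fun t : ℝ => L * D * ((1 - t ^ n) * μ.real K)) (𝓝[<] 1) (𝓝 0) := by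
      have : Continuous fun t : ℝ => L * D * ((1 - t ^ n) * μ.real K) := by fun_prop
      have := (this.tendsto 1).mono_left (nhdsWithin_le_nhds (s := Set.Iio 1))
      simpa using this
    refine squeeze_zero_norm' ?_ hlim
    filter_upwards [Ioo_mem_nhdsLT (zero_lt_one' ℝ)] with t ht
    have ht1 : 0 < 1 - t := by linarith [ht.2]
    rw [slope_def_field, norm_div, Real.norm_eq_abs, Real.norm_eq_abs, abs_sub_comm t 1,
      abs_of_pos ht1, div_le_iff₀ ht1]
    refine (hbound t ht.1 ht.2).trans (le_of_eq ?_)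
    ring
  exact tendsto_nhds_unique hslope hzero

end Radial

/-! ### Radial fluxes through a facet and the effect of an inscribed ball -/

namespace IsSimplex

section

variable {E : Type*} [NormedAddCommGroup E] [NormedSpace ℝ E] [FiniteDimensional ℝ E]
  [MeasurableSpace E] [BorelSpace E] (μ : Measure E) [μ.IsAddHaarMeasure]
  {s s' : Finset E} {a a' x : E}

theorem exists_ray [DecidableEq E] (ha : a ∈ s) (hne : (s.erase a).Nonempty)
    (hx : x ∈ convexHull ℝ (s : Set E)) :
    ∃ y ∈ convexHull ℝ (s.erase a : Set E), ∃ t : ℝ, 0 ≤ t ∧ t ≤ 1 ∧ x = a + t • (y - a) := by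
  rw [← Finset.insert_erase ha, Finset.coe_insert, convexHull_insert (Finset.coe_nonempty.2 hne)] at hx
  simp only [convexJoin, Set.mem_iUnion, Set.mem_singleton_iff, exists_prop, exists_eq_left] at hx
  obtain ⟨y, hy, hxy⟩ := hx
  rw [segment_eq_image'] at hxy
  obtain ⟨t, ht, rfl⟩ := hxy
  exact ⟨y, hy, t, ht.1, ht.2, rfl⟩

theorem integral_radial_eq_zero [DecidableEq E] (ha : a ∈ s)
    (hne : (s.erase a).Nonempty) {χ : E → ℝ} (hχ : ContDiff ℝ 1 χ)
    (hF : ∀ y ∈ convexHull ℝ (s.erase a : Set E), χ y = 0) :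
    ∫ x in convexHull ℝ (s : Set E), (fderiv ℝ χ x (x - a) + Module.finrank ℝ E * χ x) ∂μ = 0 :=
  NonlinearBiot.integral_radial_eq_zero μ (isCompact_convexHull s) (convex_convexHull ℝ _)
    (subset_convexHull ℝ _ ha) (convexHull_mono (by simp))
    (fun _ hx => exists_ray ha hne hx) hχ hF

/-- The flux of `φ (x - a)` out of a simplex, relative to its volume, depends only on the facet
opposite to `a`. -/
theorem integral_radial_eq [DecidableEq E] (hs : IsSimplex s) (hs' : IsSimplex s') (ha : a ∈ s)
    (ha' : a' ∈ s') (h : s.erase a = s'.erase a') (hne : (s.erase a).Nonempty)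
    {φ : E → ℝ} (hφ : ContDiff ℝ 1 φ) :
    ∫ x in convexHull ℝ (s' : Set E), (fderiv ℝ φ x (x - a') + Module.finrank ℝ E * φ x) ∂μ
      = |bary s a a'| *
        ∫ x in convexHull ℝ (s : Set E), (fderiv ℝ φ x (x - a) + Module.finrank ℝ E * φ x) ∂μ := by
  rw [integral_convexHull_eq μ hs hs' ha ha' h]
  congr 1
  set T := moveVertex s a a'
  have hTd : ContDiff ℝ 1 T := by
    have h1 : ContDiff ℝ 1 (bary s a) := by
      have : (bary s a : E → ℝ) = fun x => LinearMap.toContinuousLinearMap (bary s a).linear x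
        + bary s a 0 := funext fun y => congrFun (bary s a).decomp y
      rw [this]
      fun_prop
    have h2 : (T : E → E) = fun x => x + bary s a x • (a' - a) := funext (moveVertex_apply s a a')
    rw [h2]; fun_prop
  -- `T` fixes the common facet, so `χ` vanishes there and its radial integral is zero. Since `T`
  -- turns `x - a` into `T x - a'`, the part with `φ ∘ T` is the integrand of `s'` pulled back to
  -- `s`.
  set χ : E → ℝ := fun x => φ (T x) - φ x
  have hχ : ContDiff ℝ 1 χ := (hφ.comp hTd).sub hφ
  have hz := IsSimplex.integral_radial_eq_zero μ ha hne hχ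
    (fun y hy => by simp only [χ, T, hs.moveVertex_of_mem ha hy, sub_self])
  have hTf : ∀ x, fderiv ℝ (fun x => φ (T x)) x (x - a) = fderiv ℝ φ (T x) (T x - a') := by
    intro x
    have hTx : HasFDerivAt T (LinearMap.toContinuousLinearMap T.linear) x := by
      have : (T : E → E) = fun x => LinearMap.toContinuousLinearMap T.linear x + T 0 :=
        funext fun y => congrFun T.decomp y
      rw [this]
      exact (ContinuousLinearMap.hasFDerivAt _).add_const _
    have h1 := ((hφ.differentiable one_ne_zero (T x)).hasFDerivAt).comp x hTx
    have h2 : fderiv ℝ (fun x => φ (T x)) x = _ := h1.fderiv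
    rw [h2]
    have h3 := T.linearMap_vsub x a
    simp only [vsub_eq_sub] at h3
    simp [h3, T, hs.moveVertex_self ha]
  have hint : ∀ g : E → ℝ, Continuous g → IntegrableOn g (convexHull ℝ (s : Set E)) μ :=
    fun g hg => hg.continuousOn.integrableOn_compact (isCompact_convexHull s)
  have hc : ∀ ψ : E → ℝ, ContDiff ℝ 1 ψ →
      Continuous fun x => fderiv ℝ ψ x (x - a) + Module.finrank ℝ E * ψ x := fun ψ hψ => by
    have h0 := hψ.continuous
    have : Continuous fun x => fderiv ℝ ψ x (x - a) :=
      (hψ.continuous_fderiv one_ne_zero).clm_apply (by fun_prop)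
    fun_prop
  rw [← sub_eq_zero, ← integral_sub, ← hz]
  · refine integral_congr_ae (Eventually.of_forall fun x => ?_)
    have h4 : fderiv ℝ χ x = fderiv ℝ (fun x => φ (T x)) x - fderiv ℝ φ x :=
      fderiv_sub ((hφ.comp hTd).differentiable one_ne_zero x) (hφ.differentiable one_ne_zero x)
    simp only [h4, _root_.sub_apply, hTf, χ]
    ring
  · refine (hint _ (hc _ (hφ.comp hTd))).congr (Eventually.of_forall fun x => ?_)
    have := hTf x
    simp only [Function.comp_def, this]
  · exact hint _ (hc _ hφ)

end

section Metric

variable {E : Type*} [NormedAddCommGroup E] [NormedSpace ℝ E] [FiniteDimensional ℝ E]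
  {s s' : Finset E} {a a' x y c : E} {r : ℝ}

/-- Barycentric coordinates are Lipschitz with constant the inverse of the diameter of an inscribed
ball. -/
theorem bary_sub_le (hs : IsSimplex s) (ha : a ∈ s) (hr : 0 < r)
    (hball : Metric.closedBall c r ⊆ convexHull ℝ (s : Set E)) (x y : E) :
    |bary s a x - bary s a y| * (2 * r) ≤ ‖x - y‖ := by
  have hlin : ∀ u v : E, bary s a u - bary s a v = (bary s a).linear (u - v) := fun u v => by
    have := (bary s a).linearMap_vsub u v
    simpa using this.symm
  have key : ∀ z : E, (bary s a).linear z * (2 * r) ≤ ‖z‖ := by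
    intro z
    rcases eq_or_ne z 0 with rfl | hz
    · simp
    have hz' := norm_pos_iff.2 hz
    -- The opposite points of the ball in the directions `± z` are at distance `2 r`, and the
    -- coordinate lies in `[0, 1]` at both.
    have h1 : ∀ e : ℝ, |e| = r → c + (e / ‖z‖) • z ∈ convexHull ℝ (s : Set E) := fun e he => by
      apply hball
      simp [norm_smul, he, div_mul_cancel₀ _ hz'.ne']
    have h2 := hs.bary_le_one ha (h1 r (abs_of_pos hr))
    have h3 := hs.mem_convexHull_iff.1 (h1 (-r) (by simp [abs_of_pos hr])) a ha
    have h4 := hlin (c + (r / ‖z‖) • z) (c + (-r / ‖z‖) • z)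
    have h5 : c + (r / ‖z‖) • z - (c + (-r / ‖z‖) • z) = (2 * r / ‖z‖) • z := by
      rw [add_sub_add_left_eq_sub, ← sub_smul]; congr 1; ring
    rw [h5, map_smul, smul_eq_mul] at h4
    have h6 : 2 * r / ‖z‖ * (bary s a).linear z ≤ 1 := by linarith
    rw [div_mul_eq_mul_div, div_le_one hz'] at h6
    linarith
  rw [hlin]
  rcases abs_cases ((bary s a).linear (x - y)) with ⟨h, _⟩ | ⟨h, _⟩
  · rw [h]; exact key _
  · rw [h, ← map_neg, ← norm_neg]; exact key _

end Metric

end IsSimplex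

section

variable {E : Type*} [NormedAddCommGroup E] [NormedSpace ℝ E] [FiniteDimensional ℝ E]
  {s s' : Finset E} {a a' x y c : E} {r : ℝ}

theorem _root_.AffineMap.apply_sum_smul {V W ι : Type*} [AddCommGroup V] [Module ℝ V]
    [AddCommGroup W] [Module ℝ W] (f : V →ᵃ[ℝ] W) (t : Finset ι) (w : ι → ℝ) (p : ι → V)
    (hw : ∑ i ∈ t, w i = 1) : f (∑ i ∈ t, w i • p i) = ∑ i ∈ t, w i • f (p i) := by
  have h1 : ∀ y, f y = f.linear y + f 0 := fun y => congrFun f.decomp y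
  conv_lhs => rw [h1]
  conv_rhs => enter [2, a]; rw [h1]
  simp only [smul_add, Finset.sum_add_distrib, ← Finset.sum_smul, hw, map_sum, map_smul, one_smul]

/-- The point of the facet opposite to `a` with equal barycentric coordinates. -/
theorem exists_facet_center [DecidableEq E] (hne : (s.erase a).Nonempty) :
    ∃ y ∈ convexHull ℝ (s.erase a : Set E), ∀ (s' : Finset E) (a' : E), IsSimplex s' →
      s.erase a = s'.erase a' → ∀ b ∈ s'.erase a', 0 < bary s' b y := by
  set F := s.erase a
  have hF : (0 : ℝ) < F.card := by exact_mod_cast hne.card_pos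
  have hsum : ∑ _b ∈ F, (F.card : ℝ)⁻¹ = 1 := by
    rw [Finset.sum_const, nsmul_eq_mul, mul_inv_cancel₀ hF.ne']
  refine ⟨∑ b ∈ F, (F.card : ℝ)⁻¹ • b, ?_, fun s' a' hs' h b hb => ?_⟩
  · exact (convex_convexHull ℝ _).sum_mem (fun _ _ => by positivity) hsum
      (fun b hb => subset_convexHull ℝ _ hb)
  · rw [AffineMap.apply_sum_smul _ _ _ _ hsum]
    rw [← h] at hb
    have hFs : ∀ b ∈ F, b ∈ s' := fun b hb => Finset.mem_of_mem_erase (h ▸ hb)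
    rw [Finset.sum_eq_single_of_mem b hb, hs'.bary_self (hFs b hb), smul_eq_mul, mul_one]
    · positivity
    · intro c hc hcb
      rw [hs'.bary_of_ne (hFs b hb) (hFs c hc) hcb.symm, smul_zero]

theorem apply_lineMap_eq (f : E →ᵃ[ℝ] ℝ) (x y : E) (t : ℝ) :
    f (AffineMap.lineMap x y t) = f x + t * (f y - f x) := by
  rw [AffineMap.apply_lineMap, AffineMap.lineMap_apply]
  simp [add_comm]

end

/-! ### Conforming meshes: neighbours, boundary facets, null overlaps -/

namespace Mesh

variable {d : ℕ} {Ω : Set (Space d)} (T : Mesh Ω) {s s' : Finset (Space d)} {a a' : Space d}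

theorem isSimplex (hs : s ∈ T.cells) : IsSimplex s :=
  ⟨T.complex.indep hs.1, by simpa using hs.2⟩

theorem cells_finite : T.cells.Finite := T.finite.subset fun _ h => h.1

theorem inter_subset (hs : s ∈ T.cells) (hs' : s' ∈ T.cells) :
    convexHull ℝ (s : Set (Space d)) ∩ convexHull ℝ (s' : Set (Space d))
      ⊆ convexHull ℝ (s ∩ s' : Set (Space d)) :=
  T.complex.inter_subset_convexHull hs.1 hs'.1

theorem iUnion_cells : ⋃ s ∈ T.cells, convexHull ℝ (s : Set (Space d)) = closure Ω := T.covers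

theorem subset_closure_of_mem (hs : s ∈ T.cells) :
    convexHull ℝ (s : Set (Space d)) ⊆ closure Ω := by
  rw [← T.iUnion_cells]
  exact Set.subset_biUnion_of_mem
    (u := fun s : Finset (Space d) => convexHull ℝ (s : Set (Space d))) hs

theorem facet_nonempty (hd : 1 ≤ d) (hs : s ∈ T.cells) (ha : a ∈ s) : (s.erase a).Nonempty := by
  rw [← Finset.card_pos, Finset.card_erase_of_mem ha, hs.2]; omega

/-- Distinct cells with a common facet lie on opposite sides of it. -/
theorem bary_neg (hd : 1 ≤ d) (hs : s ∈ T.cells) (hs' : s' ∈ T.cells)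
    (hne : s ≠ s') (ha : a ∈ s) (ha' : a' ∈ s') (h : s.erase a = s'.erase a') :
    bary s a a' < 0 := by
  have Hs := T.isSimplex hs
  have Hs' := T.isSimplex hs'
  have h0 := Hs.bary_ne_zero Hs' ha h
  refine lt_of_le_of_ne (not_lt.1 fun hpos => ?_) h0
  obtain ⟨y, hyF, hy⟩ := exists_facet_center (T.facet_nonempty hd hs ha)
  have hpos' : 0 < bary s' a' a := by
    have := Hs.bary_eq_mul Hs' ha ha' h a
    rw [Hs.bary_self ha] at this
    by_contra hle
    nlinarith
  -- Points slightly off the facet centre `y` in the direction of `a` belong to every simplex with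
  -- this facet that has `a` on its inner side: the coordinates of the facet vertices are positive
  -- at `y`, the remaining one grows linearly from zero.
  have key : ∀ (t : Finset (Space d)) (c : Space d), IsSimplex t → c ∈ t →
      s.erase a = t.erase c → 0 < bary t c a →
      ∀ᶠ ε in 𝓝[>] (0 : ℝ), AffineMap.lineMap y a ε ∈ convexHull ℝ (t : Set (Space d)) := by
    intro t c ht hc hst hca
    simp only [ht.mem_convexHull_iff]
    rw [Filter.eventually_all_finset]
    intro b hb
    by_cases hbc : b = c
    · subst hbc
      filter_upwards [self_mem_nhdsWithin] with ε hε
      have : bary t b y = 0 :=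
        ht.bary_eq_zero_of_mem_convexHull hc (t := (t.erase b : Set _)) (by simp) (by simp)
          (hst ▸ hyF)
      rw [apply_lineMap_eq, this]
      have : (0 : ℝ) < ε := hε
      simp only [zero_add, sub_zero]
      positivity
    · have h1 : 0 < bary t b y := hy t c ht hst b (Finset.mem_erase.2 ⟨hbc, hb⟩)
      have h2 : Continuous fun ε : ℝ => bary t b (AffineMap.lineMap y a ε) := by
        simp only [apply_lineMap_eq]; fun_prop
      have h3 := (h2.tendsto 0).eventually (lt_mem_nhds (a := 0) (by simpa using h1))
      exact (h3.filter_mono nhdsWithin_le_nhds).mono fun _ h => h.le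
  have e1 := key s a Hs ha rfl (by rw [Hs.bary_self ha]; exact one_pos)
  have e2 := key s' a' Hs' ha' h hpos'
  obtain ⟨ε, ⟨h1, h2⟩, hε⟩ := ((e1.and e2).and self_mem_nhdsWithin).exists
  have hε : 0 < ε := hε
  -- Conformity places this common point in the hull of the common vertices, which do not include
  -- `a`. The coordinate of `a` is zero there, yet it equals `ε` at the point.
  have h3 := T.inter_subset hs hs' ⟨h1, h2⟩
  have hnot : a ∉ s' := by
    intro hmem
    apply hne
    refine Finset.eq_of_subset_of_card_le (fun b hb => ?_) (by rw [hs.2, hs'.2])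
    by_cases hba : b = a
    · exact hba ▸ hmem
    · exact Finset.mem_of_mem_erase (h ▸ Finset.mem_erase.2 ⟨hba, hb⟩)
  have h4 := Hs.bary_eq_zero_of_mem_convexHull ha Set.inter_subset_left
    (fun hx => hnot (by simpa using hx.2)) h3
  have h5 : bary s a y = 0 :=
    Hs.bary_eq_zero_of_mem_convexHull ha (t := (s.erase a : Set _)) (by simp) (by simp) hyF
  rw [apply_lineMap_eq, Hs.bary_self ha, h5] at h4
  simp at h4
  exact hε.ne' h4

/-- A facet of only one cell lies outside `Ω`. -/
theorem facet_disjoint (hd : 1 ≤ d) (hΩ : IsOpen Ω) (hs : s ∈ T.cells) (ha : a ∈ s)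
    (huniq : ∀ s' ∈ T.cells, s.erase a ⊆ s' → s' = s) :
    ∀ x ∈ convexHull ℝ (s.erase a : Set (Space d)), x ∉ Ω := by
  intro x hxF hxΩ
  have Hs := T.isSimplex hs
  obtain ⟨c, hcF, hc⟩ := exists_facet_center (T.facet_nonempty hd hs ha)
  have hFs : (s.erase a : Set (Space d)) ⊆ s := by simp
  have hlin : Continuous fun ε : ℝ => AffineMap.lineMap x c ε := AffineMap.lineMap_continuous
  have e1 : ∀ᶠ ε in 𝓝[>] (0 : ℝ), AffineMap.lineMap x c ε ∈ Ω :=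
    ((hlin.tendsto 0).eventually (hΩ.mem_nhds (by simpa using hxΩ))).filter_mono
      nhdsWithin_le_nhds
  -- Moving `x` slightly towards the facet centre stays in `Ω` and makes all coordinates of facet
  -- vertices positive.
  obtain ⟨ε, hyΩ, hε0, hε1⟩ := (e1.and (Ioo_mem_nhdsGT (zero_lt_one' ℝ))).exists
  set y := AffineMap.lineMap x c ε
  have hyF : y ∈ convexHull ℝ (s.erase a : Set (Space d)) :=
    (convex_convexHull ℝ _).lineMap_mem hxF hcF ⟨hε0.le, hε1.le⟩
  have hypos : ∀ b ∈ s.erase a, 0 < bary s b y := fun b hb => by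
    have h1 := hc s a Hs rfl b hb
    have h2 := Hs.mem_convexHull_iff.1 (convexHull_mono hFs hxF) b (Finset.mem_of_mem_erase hb)
    simp only [y, apply_lineMap_eq]
    nlinarith
  have hya : bary s a y = 0 := Hs.bary_eq_zero_of_mem_convexHull ha hFs (by simp) hyF
  have hlin2 : Continuous fun ε : ℝ => AffineMap.lineMap y a (-ε) :=
    AffineMap.lineMap_continuous.comp continuous_neg
  have e2 : ∀ᶠ ε in 𝓝[>] (0 : ℝ), AffineMap.lineMap y a (-ε) ∈ Ω :=
    ((hlin2.tendsto 0).eventually (hΩ.mem_nhds (by simpa using hyΩ))).filter_mono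
      nhdsWithin_le_nhds
  -- The point leaves `s` across the facet. As there are finitely many cells and they are closed, a
  -- short step meets only cells that contain `y`.
  have e3 : ∀ᶠ ε in 𝓝[>] (0 : ℝ), ∀ s' ∈ T.cells, y ∉ convexHull ℝ (s' : Set (Space d)) →
      AffineMap.lineMap y a (-ε) ∉ convexHull ℝ (s' : Set (Space d)) := by
    rw [Filter.eventually_all_finite T.cells_finite]
    intro s' _
    by_cases hys : y ∈ convexHull ℝ (s' : Set (Space d))
    · simp [hys]
    · have : ∀ᶠ z in 𝓝 y, z ∉ convexHull ℝ (s' : Set (Space d)) :=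
        (IsSimplex.isCompact_convexHull s').isClosed.isOpen_compl.mem_nhds hys
      have := (hlin2.tendsto 0).eventually (p := fun z => z ∉ convexHull ℝ (s' : Set (Space d)))
        (by simpa using this)
      exact (this.filter_mono nhdsWithin_le_nhds).mono fun _ h _ => h
  obtain ⟨ε', ⟨h2, h3⟩, hε'⟩ := ((e2.and e3).and self_mem_nhdsWithin).exists
  have hε' : 0 < ε' := hε'
  have h4 := subset_closure h2
  rw [← T.iUnion_cells, Set.mem_iUnion₂] at h4
  obtain ⟨s', hs', hz⟩ := h4
  have hys' : y ∈ convexHull ℝ (s' : Set (Space d)) := by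
    by_contra hn
    exact h3 s' hs' hn hz
  -- The cell containing the exit point contains `y`, and positivity of the facet coordinates at `y`
  -- forces it to contain the whole facet. By uniqueness it is `s`, where the coordinate of `a`
  -- cannot be negative.
  have hyI := T.inter_subset hs hs' ⟨convexHull_mono hFs hyF, hys'⟩
  have hsub : s.erase a ⊆ s' := by
    intro b hb
    by_contra hbs
    have := Hs.bary_eq_zero_of_mem_convexHull (Finset.mem_of_mem_erase hb) Set.inter_subset_left
      (fun hx => hbs (by simpa using hx.2)) hyI
    exact (hypos b hb).ne' this
  have := huniq s' hs' hsub
  subst this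
  have h5 := Hs.mem_convexHull_iff.1 hz a ha
  rw [apply_lineMap_eq, hya, Hs.bary_self ha] at h5
  linarith

theorem interior_subset (hΩr : interior (closure Ω) = Ω) (hs : s ∈ T.cells) :
    interior (convexHull ℝ (s : Set (Space d))) ⊆ Ω := by
  rw [← hΩr]
  exact interior_mono (T.subset_closure_of_mem hs)

theorem volume_diff_interior (s : Finset (Space d)) :
    volume (convexHull ℝ (s : Set (Space d)) \ interior (convexHull ℝ (s : Set (Space d)))) = 0 :=
  measure_mono_null (Set.sdiff_subset_sdiff_left subset_closure)
    ((convex_convexHull ℝ _).addHaar_frontier volume)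

/-- Interiors of cells lie in `interior (closure Ω) = Ω`, so what is left of the closure consists of
boundaries of finitely many convex sets, which are null. -/
theorem volume_closure_diff (T : Mesh Ω) (hΩr : interior (closure Ω) = Ω) : volume (closure Ω \ Ω) = 0 := by
  refine measure_mono_null (t := ⋃ s ∈ T.cells, (convexHull ℝ (s : Set (Space d)) \
    interior (convexHull ℝ (s : Set (Space d))))) ?_ ?_
  · rintro x ⟨hx, hxΩ⟩
    rw [← T.iUnion_cells, Set.mem_iUnion₂] at hx
    obtain ⟨s, hs, hxs⟩ := hx
    exact Set.mem_iUnion₂.2 ⟨s, hs, hxs, fun h => hxΩ (T.interior_subset hΩr hs h)⟩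
  · exact (measure_biUnion_null_iff T.cells_finite.countable).2 fun s _ => volume_diff_interior s

/-- By conformity the overlap lies in the hyperplane on which the coordinate of a vertex of `s`
outside `s'` vanishes. -/
theorem aedisjoint (hs : s ∈ T.cells) (hs' : s' ∈ T.cells) (hne : s ≠ s') :
    AEDisjoint volume (convexHull ℝ (s : Set (Space d))) (convexHull ℝ (s' : Set (Space d))) := by
  have hex : ∃ a ∈ s, a ∉ s' := by
    by_contra! h
    exact hne (Finset.eq_of_subset_of_card_le h (by rw [hs.2, hs'.2]))
  obtain ⟨a, ha, has'⟩ := hex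
  have Hs := T.isSimplex hs
  refine measure_mono_null (t := (AffineSubspace.comap (bary s a)
    (AffineSubspace.mk' (0 : ℝ) ⊥) : Set (Space d))) ?_ ?_
  · intro x hx
    have := Hs.bary_eq_zero_of_mem_convexHull ha Set.inter_subset_left
      (fun hx => has' (by simpa using hx.2)) (T.inter_subset hs hs' hx)
    simp [this]
  · refine Measure.addHaar_affineSubspace _ _ fun htop => ?_
    have : a ∈ AffineSubspace.comap (bary s a) (AffineSubspace.mk' (0 : ℝ) ⊥) :=
      htop ▸ AffineSubspace.mem_top _ _ _
    simp [Hs.bary_self ha] at this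

instance : Fintype T.cells := T.cells_finite.fintype

theorem iUnion_ae_eq (hΩr : interior (closure Ω) = Ω) :
    (⋃ s : T.cells, convexHull ℝ (s.1 : Set (Space d))) =ᵐ[volume] Ω := by
  rw [Set.iUnion_coe_set, T.iUnion_cells]
  exact (ae_le_set.2 (T.volume_closure_diff hΩr)).antisymm subset_closure.eventuallyLE

theorem integral_eq_sum (hΩr : interior (closure Ω) = Ω) {g : Space d → ℝ}
    (hg : IntegrableOn g Ω) :
    ∫ x in Ω, g x = ∑ s : T.cells, ∫ x in convexHull ℝ (s.1 : Set (Space d)), g x := by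
  rw [← setIntegral_congr_set (T.iUnion_ae_eq hΩr), integral_iUnion_ae, tsum_fintype]
  · exact fun s => (IsSimplex.measurableSet_convexHull s.1).nullMeasurableSet
  · exact fun s s' hne => T.aedisjoint s.2 s'.2 (by simpa [Subtype.ext_iff] using hne)
  · exact hg.congr_set_ae (T.iUnion_ae_eq hΩr)

end Mesh

/-! ### Weak derivatives: uniqueness and linearity -/

section WeakDerivatives

variable {d : ℕ} {Ω : Set (Space d)}

theorem pair_eq_inner (f g : L2 Ω) : pair Ω f g = inner ℝ f g := by
  rw [L2.inner_def, pair]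
  refine integral_congr_ae (Eventually.of_forall fun x => ?_)
  simp [mul_comm]

theorem pair_congr {f f' g g' : Space d → ℝ} (hf : f =ᵐ[volume.restrict Ω] f')
    (hg : g =ᵐ[volume.restrict Ω] g') : pair Ω f g = pair Ω f' g' := by
  refine integral_congr_ae ?_
  filter_upwards [hf, hg] with x h1 h2
  rw [h1, h2]

theorem pair_toLp (f : L2 Ω) {φ : Space d → ℝ} (h : MemLp φ 2 (volume.restrict Ω)) :
    pair Ω f φ = inner ℝ f h.toLp := by
  rw [← pair_eq_inner]
  exact pair_congr (ae_eq_refl _) h.coeFn_toLp.symm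

namespace IsTest

variable {φ ψ : Space d → ℝ}

theorem memLp (h : IsTest Ω φ) : MemLp φ 2 (volume.restrict Ω) :=
  h.1.continuous.memLp_of_hasCompactSupport h.2.1

theorem partialDeriv (h : IsTest Ω φ) (i : Fin d) : IsTest Ω (partialDeriv i φ) := by
  refine ⟨?_, ?_, ?_⟩
  · exact (h.1.fderiv_right (m := ∞) (by simp)).clm_apply contDiff_const
  · refine (h.2.1.fderiv_apply (𝕜 := ℝ) (EuclideanSpace.single i (1 : ℝ)))
  · exact (tsupport_fderiv_apply_subset ℝ _).trans h.2.2

theorem eq_zero (h : IsTest Ω φ) {x : Space d} (hx : x ∉ Ω) : φ x = 0 :=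
  image_eq_zero_of_notMem_tsupport fun hm => hx (h.2.2 hm)

end IsTest

theorem partialDeriv_comm {φ : Space d → ℝ} (h : ContDiff ℝ ∞ φ) (i j : Fin d) :
    partialDeriv i (partialDeriv j φ) = partialDeriv j (partialDeriv i φ) := by
  ext x
  have hd : DifferentiableAt ℝ (fderiv ℝ φ) x :=
    ((h.fderiv_right (m := ∞) (by simp)).differentiable (by simp)) x
  have key : ∀ v w : Space d, fderiv ℝ (fun y => fderiv ℝ φ y v) x w
      = fderiv ℝ (fderiv ℝ φ) x w v := fun v w => by
    rw [fderiv_clm_apply hd (differentiableAt_const v)]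
    simp
  have hs : IsSymmSndFDerivAt ℝ φ x := h.contDiffAt.isSymmSndFDerivAt (by
    simpa using (WithTop.coe_le_coe.2 le_top : ((2 : ℕ∞) : WithTop ℕ∞) ≤ ∞))
  change fderiv ℝ (fun y => fderiv ℝ φ y _) x _ = fderiv ℝ (fun y => fderiv ℝ φ y _) x _
  rw [key, key]
  exact hs _ _

/-- The fundamental lemma of the calculus of variations. It makes weak derivatives unique, so that
the choices in `weakPartial` and `weakDiv` do not matter and both are linear where derivatives
exist. -/
theorem eq_zero_of_forall_test (hΩ : IsOpen Ω) [IsFiniteMeasure (volume.restrict Ω)] {g : L2 Ω}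
    (h : ∀ φ, IsTest Ω φ → pair Ω g φ = 0) : g = 0 := by
  have hint : IntegrableOn g Ω := (Lp.memLp g).integrable (by norm_num)
  have key := hΩ.ae_eq_zero_of_integral_contDiff_smul_eq_zero (μ := volume) (f := g)
    hint.locallyIntegrableOn (fun φ h1 h2 h3 => by
      rw [← setIntegral_eq_integral_of_forall_compl_eq_zero (s := Ω), ← h φ ⟨h1, h2, h3⟩, pair]
      · simp [mul_comm]
      · intro x hx
        rw [IsTest.eq_zero ⟨h1, h2, h3⟩ hx, zero_smul])
  rw [Lp.eq_zero_iff_ae_eq_zero]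
  exact (ae_restrict_iff' hΩ.measurableSet).2 key

namespace HasWeakPartial

variable {i : Fin d} {u v g g' : L2 Ω}

theorem iff_inner : HasWeakPartial Ω i u g ↔ ∀ (φ : Space d → ℝ) (h : IsTest Ω φ),
    inner ℝ u (h.partialDeriv i).memLp.toLp = - inner ℝ g h.memLp.toLp := by
  refine forall_congr' fun φ => forall_congr' fun h => ?_
  rw [pair_toLp u (h.partialDeriv i).memLp, pair_toLp g h.memLp]

theorem add (h : HasWeakPartial Ω i u g) (h' : HasWeakPartial Ω i v g') :
    HasWeakPartial Ω i (u + v) (g + g') := by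
  rw [iff_inner] at *
  intro φ hφ
  rw [inner_add_left, inner_add_left, h φ hφ, h' φ hφ, neg_add]

theorem smul (c : ℝ) (h : HasWeakPartial Ω i u g) : HasWeakPartial Ω i (c • u) (c • g) := by
  rw [iff_inner] at *
  intro φ hφ
  rw [real_inner_smul_left, real_inner_smul_left, h φ hφ, mul_neg]

theorem unique (hΩ : IsOpen Ω) [IsFiniteMeasure (volume.restrict Ω)]
    (h : HasWeakPartial Ω i u g) (h' : HasWeakPartial Ω i u g') : g = g' := by
  rw [← sub_eq_zero]
  refine eq_zero_of_forall_test hΩ fun φ hφ => ?_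
  have h1 := iff_inner.1 h φ hφ
  have h2 := iff_inner.1 h' φ hφ
  rw [pair_toLp _ hφ.memLp, inner_sub_left]
  linarith

theorem weakPartial_eq (hΩ : IsOpen Ω) [IsFiniteMeasure (volume.restrict Ω)]
    (h : HasWeakPartial Ω i u g) : weakPartial Ω i u = g := by
  have H : ∃ g, HasWeakPartial Ω i u g := ⟨g, h⟩
  rw [weakPartial, dif_pos H]
  exact H.choose_spec.unique hΩ h

end HasWeakPartial

theorem hasWeakPartial_weakPartial {u : L2 Ω} (hu : u ∈ H1 Ω) (i : Fin d) :
    HasWeakPartial Ω i u (weakPartial Ω i u) := by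
  rw [weakPartial, dif_pos (hu i)]
  exact (hu i).choose_spec

namespace HasWeakDiv

variable {v w : L2Vec Ω} {g g' : L2 Ω}

theorem iff_inner : HasWeakDiv Ω v g ↔ ∀ (φ : Space d → ℝ) (h : IsTest Ω φ),
    ∑ i, inner ℝ (v i) (h.partialDeriv i).memLp.toLp = - inner ℝ g h.memLp.toLp := by
  refine forall_congr' fun φ => forall_congr' fun h => ?_
  rw [pair_toLp g h.memLp]
  simp only [fun i => pair_toLp (v i) (h.partialDeriv i).memLp]

theorem add (h : HasWeakDiv Ω v g) (h' : HasWeakDiv Ω w g') :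
    HasWeakDiv Ω (v + w) (g + g') := by
  rw [iff_inner] at *
  intro φ hφ
  simp only [PiLp.add_apply, inner_add_left, Finset.sum_add_distrib, h φ hφ, h' φ hφ, neg_add]

theorem smul (c : ℝ) (h : HasWeakDiv Ω v g) : HasWeakDiv Ω (c • v) (c • g) := by
  rw [iff_inner] at *
  intro φ hφ
  simp only [PiLp.smul_apply, real_inner_smul_left, ← Finset.mul_sum, h φ hφ, mul_neg]

theorem unique (hΩ : IsOpen Ω) [IsFiniteMeasure (volume.restrict Ω)]
    (h : HasWeakDiv Ω v g) (h' : HasWeakDiv Ω v g') : g = g' := by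
  rw [← sub_eq_zero]
  refine eq_zero_of_forall_test hΩ fun φ hφ => ?_
  have h1 := iff_inner.1 h φ hφ
  have h2 := iff_inner.1 h' φ hφ
  rw [pair_toLp _ hφ.memLp, inner_sub_left]
  linarith

theorem weakDiv_eq (hΩ : IsOpen Ω) [IsFiniteMeasure (volume.restrict Ω)]
    (h : HasWeakDiv Ω v g) : weakDiv Ω v = g := by
  have H : ∃ g, HasWeakDiv Ω v g := ⟨g, h⟩
  rw [weakDiv, dif_pos H]
  exact H.choose_spec.unique hΩ h

end HasWeakDiv

theorem hasWeakDiv_weakDiv {v : L2Vec Ω} (hv : v ∈ Hdiv Ω) : HasWeakDiv Ω v (weakDiv Ω v) := by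
  have H : ∃ g, HasWeakDiv Ω v g := hv
  rw [weakDiv, dif_pos H]
  exact H.choose_spec

/-- `H(div; Ω)` as a subspace. -/
def HdivSub (Ω : Set (Space d)) : Submodule ℝ (L2Vec Ω) where
  carrier := Hdiv Ω
  add_mem' := fun ⟨g, h⟩ ⟨g', h'⟩ => ⟨g + g', h.add h'⟩
  zero_mem' := ⟨0, fun φ h => by
    have h0 : pair Ω (0 : L2 Ω) φ = 0 := by rw [pair_toLp _ h.memLp, inner_zero_left]
    rw [h0, neg_zero]
    refine Finset.sum_eq_zero fun i _ => ?_
    rw [pair_toLp _ (h.partialDeriv i).memLp]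
    exact inner_zero_left _⟩
  smul_mem' := fun c _ ⟨g, h⟩ => ⟨c • g, h.smul c⟩

/-- `H¹(Ω)` as a subspace. -/
def H1Sub (Ω : Set (Space d)) : Submodule ℝ (L2 Ω) where
  carrier := H1 Ω
  add_mem' := fun hu hv i => by
    obtain ⟨g, hg⟩ := hu i
    obtain ⟨g', hg'⟩ := hv i
    exact ⟨g + g', hg.add hg'⟩
  zero_mem' := fun i => ⟨0, fun φ h => by
    rw [pair_toLp _ h.memLp, pair_toLp _ (h.partialDeriv i).memLp, inner_zero_left,
      inner_zero_left, neg_zero]⟩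
  smul_mem' := fun c u hu i => by
    obtain ⟨g, hg⟩ := hu i
    exact ⟨c • g, hg.smul c⟩

/-- The approximation is expressed by convergence of `L²` classes, so that limits pass through inner
products. -/
theorem mem_H10_iff {u : L2 Ω} : u ∈ H10 Ω ↔ u ∈ H1 Ω ∧ ∃ (φ : ℕ → Space d → ℝ)
    (h : ∀ n, IsTest Ω (φ n)), Tendsto (fun n => (h n).memLp.toLp) atTop (𝓝 u) ∧
    ∀ i, Tendsto (fun n => ((h n).partialDeriv i).memLp.toLp) atTop (𝓝 (weakPartial Ω i u)) := by
  have key : ∀ (f : L2 Ω) (ψ : ℕ → Space d → ℝ) (hψ : ∀ n, MemLp (ψ n) 2 (volume.restrict Ω)),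
      Tendsto (fun n => eLpNorm (fun x => f x - ψ n x) 2 (volume.restrict Ω)) atTop (𝓝 0) ↔
        Tendsto (fun n => (hψ n).toLp) atTop (𝓝 f) := by
    intro f ψ hψ
    rw [tendsto_iff_edist_tendsto_0]
    refine tendsto_congr fun n => ?_
    rw [edist_comm, Lp.edist_def]
    refine eLpNorm_congr_ae ?_
    filter_upwards [(hψ n).coeFn_toLp] with x hx
    simp [hx]
  constructor
  · rintro ⟨hu, φ, h, h1, h2⟩
    exact ⟨hu, φ, h, (key _ _ _).1 h1, fun i => (key _ _ _).1 (h2 i)⟩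
  · rintro ⟨hu, φ, h, h1, h2⟩
    exact ⟨hu, φ, h, (key _ _ _).2 h1, fun i => (key _ _ _).2 (h2 i)⟩

theorem hasWeakDiv_of_H1 {z : L2Vec Ω} (hz : ∀ i, z i ∈ H1 Ω) :
    HasWeakDiv Ω z (∑ i, weakPartial Ω i (z i)) := by
  rw [HasWeakDiv.iff_inner]
  intro φ hφ
  simp only [sum_inner, ← Finset.sum_neg_distrib]
  exact Finset.sum_congr rfl fun i _ =>
    HasWeakPartial.iff_inner.1 (hasWeakPartial_weakPartial (hz i) i) φ hφ

section Linear

variable (hΩ : IsOpen Ω) [IsFiniteMeasure (volume.restrict Ω)]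
include hΩ

theorem weakDiv_add {v w : L2Vec Ω} (hv : v ∈ Hdiv Ω) (hw : w ∈ Hdiv Ω) :
    weakDiv Ω (v + w) = weakDiv Ω v + weakDiv Ω w :=
  ((hasWeakDiv_weakDiv hv).add (hasWeakDiv_weakDiv hw)).weakDiv_eq hΩ

theorem weakDiv_smul {v : L2Vec Ω} (c : ℝ) (hv : v ∈ Hdiv Ω) :
    weakDiv Ω (c • v) = c • weakDiv Ω v :=
  ((hasWeakDiv_weakDiv hv).smul c).weakDiv_eq hΩ

theorem weakPartial_add {u v : L2 Ω} (i : Fin d) (hu : u ∈ H1 Ω) (hv : v ∈ H1 Ω) :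
    weakPartial Ω i (u + v) = weakPartial Ω i u + weakPartial Ω i v :=
  ((hasWeakPartial_weakPartial hu i).add (hasWeakPartial_weakPartial hv i)).weakPartial_eq hΩ

theorem weakPartial_smul {u : L2 Ω} (i : Fin d) (c : ℝ) (hu : u ∈ H1 Ω) :
    weakPartial Ω i (c • u) = c • weakPartial Ω i u :=
  ((hasWeakPartial_weakPartial hu i).smul c).weakPartial_eq hΩ

theorem weakDiv_of_H1 {z : L2Vec Ω} (hz : ∀ i, z i ∈ H1 Ω) :
    weakDiv Ω z = ∑ i, weakPartial Ω i (z i) :=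
  (hasWeakDiv_of_H1 hz).weakDiv_eq hΩ

end Linear

end WeakDerivatives

/-! ### Korn's identity and vanishing of strain-free displacements -/

section Korn

variable {d : ℕ} {Ω : Set (Space d)}

/-- For a test function `φ` in place of `v` both sides equal `-⟨u, ∂ᵢ∂ⱼ φ⟩`; the general case
follows by density. Only `v` needs zero boundary values. -/
theorem H10.inner_weakPartial_comm {u v : L2 Ω} (hu : u ∈ H1 Ω) (hv : v ∈ H10 Ω) (i j : Fin d) :
    inner ℝ (weakPartial Ω i u) (weakPartial Ω j v)
      = inner ℝ (weakPartial Ω j u) (weakPartial Ω i v) := by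
  obtain ⟨_, φ, h, -, h2⟩ := mem_H10_iff.1 hv
  have l1 := (h2 j).inner (𝕜 := ℝ) (tendsto_const_nhds (x := weakPartial Ω i u))
  have l2 := (h2 i).inner (𝕜 := ℝ) (tendsto_const_nhds (x := weakPartial Ω j u))
  rw [real_inner_comm, real_inner_comm _ (weakPartial Ω j u)]
  refine tendsto_nhds_unique l1 (l2.congr fun n => ?_)
  have e1 := hasWeakPartial_weakPartial hu i _ ((h n).partialDeriv j)
  have e2 := hasWeakPartial_weakPartial hu j _ ((h n).partialDeriv i)
  rw [partialDeriv_comm (h n).1 j i, e1, pair_toLp _ ((h n).partialDeriv j).memLp,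
    pair_toLp _ ((h n).partialDeriv i).memLp] at e2
  rw [real_inner_comm, real_inner_comm (weakPartial Ω i u)]
  linarith

/-- Korn's identity on `H¹₀(Ω)^d`. -/
theorem strainPair_self (hΩ : IsOpen Ω) [IsFiniteMeasure (volume.restrict Ω)] {u : L2Vec Ω}
    (hu : ∀ i, u i ∈ H10 Ω) :
    strainPair Ω u u
      = 2⁻¹ * (∑ i, ∑ j, ‖weakPartial Ω i (u j)‖ ^ 2 + ‖weakDiv Ω u‖ ^ 2) := by
  -- The mixed term `⟨∂ᵢ uⱼ, ∂ⱼ uᵢ⟩` of the square becomes `⟨∂ᵢ uᵢ, ∂ⱼ uⱼ⟩` by exchanging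
  -- derivatives; summed over `i` and `j` this is the squared norm of the divergence.
  have h1 : ∀ i j, pair Ω (strain Ω u i j) (strain Ω u i j)
      = 4⁻¹ * ‖weakPartial Ω i (u j)‖ ^ 2 + 4⁻¹ * ‖weakPartial Ω j (u i)‖ ^ 2
        + 2⁻¹ * inner ℝ (weakPartial Ω i (u i)) (weakPartial Ω j (u j)) := fun i j => by
    rw [pair_eq_inner, strain, real_inner_smul_left, real_inner_smul_right,
      real_inner_self_eq_norm_sq, norm_add_sq_real,
      H10.inner_weakPartial_comm (hu j).1 (hu i), real_inner_comm]
    ring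
  have h2 : ‖weakDiv Ω u‖ ^ 2
      = ∑ i, ∑ j, inner ℝ (weakPartial Ω i (u i)) (weakPartial Ω j (u j)) := by
    rw [weakDiv_of_H1 hΩ (fun i => (hu i).1), ← real_inner_self_eq_norm_sq, sum_inner]
    simp only [inner_sum]
  rw [strainPair, h2]
  simp only [h1, Finset.sum_add_distrib, ← Finset.mul_sum]
  rw [Finset.sum_comm (f := fun i j => ‖weakPartial Ω j (u i)‖ ^ 2)]
  ring

theorem abs_coord_le_norm (x : Space d) (i : Fin d) : |x i| ≤ ‖x‖ := by
  have := PiLp.norm_apply_le (p := 2) x i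
  simpa using this

/-- An element of `H¹₀(Ω)` with a vanishing partial derivative is zero. -/
theorem H10.eq_zero_of_weakPartial (hΩb : Bornology.IsBounded Ω) (hΩ : IsOpen Ω) {u : L2 Ω}
    (hu : u ∈ H10 Ω) (i : Fin d) (h0 : weakPartial Ω i u = 0) : u = 0 := by
  obtain ⟨hu1, φ, h, h1, h2⟩ := mem_H10_iff.1 hu
  obtain ⟨R, hR⟩ := hΩb.exists_norm_le
  have hmul : ∀ ψ : Space d → ℝ, IsTest Ω ψ → IsTest Ω (fun x => x i * ψ x) := by
    intro ψ hψ
    refine ⟨?_, hψ.2.1.mul_left, (tsupport_mul_subset_right).trans hψ.2.2⟩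
    exact ContDiff.mul (by fun_prop) hψ.1
  have hder : ∀ ψ : Space d → ℝ, IsTest Ω ψ →
      partialDeriv i (fun x => x i * ψ x) = fun x => ψ x + x i * partialDeriv i ψ x := by
    intro ψ hψ
    ext x
    have e1 : HasFDerivAt (fun x : Space d => x i) (EuclideanSpace.proj i : Space d →L[ℝ] ℝ) x :=
      (EuclideanSpace.proj i : Space d →L[ℝ] ℝ).hasFDerivAt
    have e2 := e1.mul ((hψ.1.differentiable (by simp)) x).hasFDerivAt
    have e3 : fderiv ℝ (fun x : Space d => x i * ψ x) x = _ := e2.fderiv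
    rw [partialDeriv, e3]
    simp [partialDeriv]
    ring
  -- The Poincaré argument: testing `∂ᵢ u = 0` with `xᵢ φₙ` gives `⟨u, φₙ⟩ = -⟨u, xᵢ ∂ᵢ φₙ⟩`. The
  -- left side tends to `‖u‖²`, the right side to zero because `xᵢ` is bounded on `Ω` and `∂ᵢ φₙ`
  -- tends to `∂ᵢ u = 0`.
  have key : ∀ n, inner ℝ u (h n).memLp.toLp
      = - inner ℝ u (hmul _ ((h n).partialDeriv i)).memLp.toLp := by
    intro n
    have e1 := HasWeakPartial.iff_inner.1 (hasWeakPartial_weakPartial hu1 i) _ (hmul _ (h n))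
    rw [h0, inner_zero_left, neg_zero] at e1
    have e2 : ((hmul _ (h n)).partialDeriv i).memLp.toLp
        = (h n).memLp.toLp + (hmul _ ((h n).partialDeriv i)).memLp.toLp := by
      rw [← MemLp.toLp_add]
      refine MemLp.toLp_congr _ _ (Eventually.of_forall fun x => ?_)
      rw [hder _ (h n)]; rfl
    rw [e2, inner_add_right] at e1
    linarith
  have hlim : Tendsto (fun n => (hmul _ ((h n).partialDeriv i)).memLp.toLp) atTop
      (𝓝 (0 : L2 Ω)) := by
    have h3 := (h2 i).norm.const_mul R
    rw [h0, norm_zero, mul_zero] at h3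
    refine squeeze_zero_norm (fun n => ?_) h3
    refine Lp.norm_le_mul_norm_of_ae_le_mul ?_
    filter_upwards [(hmul _ ((h n).partialDeriv i)).memLp.coeFn_toLp,
      ((h n).partialDeriv i).memLp.coeFn_toLp, ae_restrict_mem hΩ.measurableSet] with x e1 e2 e3
    rw [e1, e2, norm_mul]
    gcongr
    exact (abs_coord_le_norm x i).trans (hR x e3)
  have l1 := h1.inner (𝕜 := ℝ) (tendsto_const_nhds (x := u))
  have l2 := (hlim.inner (𝕜 := ℝ) (tendsto_const_nhds (x := u))).neg
  rw [inner_zero_left, neg_zero] at l2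
  have : inner ℝ u u = (0 : ℝ) := tendsto_nhds_unique l1 (l2.congr fun n => by
    rw [real_inner_comm, ← key n, real_inner_comm])
  exact inner_self_eq_zero.1 this

theorem eq_zero_of_strainPair_eq_zero (hd : 1 ≤ d) (hΩ : IsOpen Ω)
    (hΩb : Bornology.IsBounded Ω) [IsFiniteMeasure (volume.restrict Ω)] {u : L2Vec Ω}
    (hu : ∀ i, u i ∈ H10 Ω) (h0 : strainPair Ω u u = 0) : u = 0 := by
  rw [strainPair_self hΩ hu] at h0
  have hnn : ∀ i ∈ Finset.univ, 0 ≤ ∑ j, ‖weakPartial Ω i (u j)‖ ^ 2 :=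
    fun i _ => Finset.sum_nonneg fun j _ => sq_nonneg _
  have hs := Finset.sum_nonneg hnn
  have h1 : ∑ i, ∑ j, ‖weakPartial Ω i (u j)‖ ^ 2 = 0 := by
    nlinarith [sq_nonneg ‖weakDiv Ω u‖]
  rw [Finset.sum_eq_zero_iff_of_nonneg hnn] at h1
  refine PiLp.ext fun j => ?_
  have h2 := h1 ⟨0, hd⟩ (Finset.mem_univ _)
  rw [Finset.sum_eq_zero_iff_of_nonneg fun j _ => sq_nonneg _] at h2
  exact H10.eq_zero_of_weakPartial hΩb hΩ (hu j) ⟨0, hd⟩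
    (by simpa using h2 j (Finset.mem_univ _))

theorem strainPair_self_nonneg (u : L2Vec Ω) : 0 ≤ strainPair Ω u u :=
  Finset.sum_nonneg fun i _ => Finset.sum_nonneg fun j _ => by
    rw [pair_eq_inner]; exact real_inner_self_nonneg

/-- `H¹₀(Ω)` as a subspace. -/
def H10Sub (Ω : Set (Space d)) (hΩ : IsOpen Ω) [IsFiniteMeasure (volume.restrict Ω)] :
    Submodule ℝ (L2 Ω) where
  carrier := H10 Ω
  add_mem' := fun {u v} hu hv => by
    obtain ⟨hu1, φ, h, h1, h2⟩ := mem_H10_iff.1 hu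
    obtain ⟨hv1, ψ, k, k1, k2⟩ := mem_H10_iff.1 hv
    have ht : ∀ n, IsTest Ω (φ n + ψ n) := fun n =>
      ⟨(h n).1.add (k n).1, (h n).2.1.add (k n).2.1,
        (tsupport_add _ _).trans (Set.union_subset (h n).2.2 (k n).2.2)⟩
    refine mem_H10_iff.2 ⟨(H1Sub Ω).add_mem hu1 hv1, fun n => φ n + ψ n, ht, ?_, fun i => ?_⟩
    · exact h1.add k1
    · rw [weakPartial_add hΩ i hu1 hv1]
      refine ((h2 i).add (k2 i)).congr fun n => ?_
      rw [← MemLp.toLp_add]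
      refine MemLp.toLp_congr _ _ (Eventually.of_forall fun x => ?_)
      have := fderiv_add ((h n).1.differentiable (by simp) x) ((k n).1.differentiable (by simp) x)
      simp [partialDeriv, this]
  zero_mem' := by
    have h1 : (0 : L2 Ω) ∈ H1 Ω := (H1Sub Ω).zero_mem
    have ht : IsTest Ω (0 : Space d → ℝ) :=
      ⟨contDiff_const, HasCompactSupport.zero, by simp [tsupport]⟩
    refine mem_H10_iff.2 ⟨h1, fun _ => 0, fun _ => ht, ?_, fun i => ?_⟩
    · exact tendsto_const_nhds
    · have e1 : weakPartial Ω i (0 : L2 Ω) = 0 := by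
        have := weakPartial_smul hΩ i 0 h1
        simpa using this
      rw [e1]
      refine tendsto_const_nhds.congr fun n => ?_
      symm
      rw [Lp.eq_zero_iff_ae_eq_zero]
      refine (MemLp.coeFn_toLp _).trans (Eventually.of_forall fun x => ?_)
      simp [partialDeriv]
  smul_mem' := fun c u hu => by
    obtain ⟨hu1, φ, h, h1, h2⟩ := mem_H10_iff.1 hu
    have ht : ∀ n, IsTest Ω (c • φ n) := fun n =>
      ⟨(h n).1.const_smul c, (h n).2.1.smul_left (f := fun _ => c),
        (tsupport_smul_subset_right (fun _ => c) _).trans (h n).2.2⟩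
    refine mem_H10_iff.2 ⟨(H1Sub Ω).smul_mem c hu1, fun n => c • φ n, ht, ?_, fun i => ?_⟩
    · exact h1.const_smul c
    · rw [weakPartial_smul hΩ i c hu1]
      refine ((h2 i).const_smul c).congr fun n => ?_
      rw [← MemLp.toLp_const_smul]
      refine MemLp.toLp_congr _ _ (Eventually.of_forall fun x => ?_)
      have := fderiv_const_smul ((h n).1.differentiable (by simp) x) c
      simp [partialDeriv, this]

end Korn
-- The discrete spaces are finite-dimensional subspaces
namespace Mesh

variable {d : ℕ} {Ω : Set (Space d)} (T : Mesh Ω)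

theorem ae_mem_cell (hΩr : interior (closure Ω) = Ω) :
    ∀ᵐ x ∂(volume.restrict Ω), ∃ s : T.cells, x ∈ convexHull ℝ (s.1 : Set (Space d)) := by
  have hΩ : MeasurableSet Ω := hΩr ▸ isOpen_interior.measurableSet
  refine (ae_restrict_iff' hΩ).2 (Eventually.of_forall fun x hx => ?_)
  have := subset_closure hx
  rw [← T.iUnion_cells, Set.mem_iUnion₂] at this
  obtain ⟨s, hs, hx⟩ := this
  exact ⟨⟨s, hs⟩, hx⟩

theorem ae_unique_cell : ∀ᵐ x ∂(volume.restrict Ω), ∀ s s' : T.cells, s ≠ s' →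
    x ∈ convexHull ℝ (s.1 : Set (Space d)) → x ∉ convexHull ℝ (s'.1 : Set (Space d)) := by
  refine ae_restrict_of_ae ?_
  rw [ae_all_iff]
  intro s
  rw [ae_all_iff]
  intro s'
  by_cases h : s = s'
  · simp [h]
  · have := T.aedisjoint s.2 s'.2 (by simpa [Subtype.ext_iff] using h)
    have h2 := measure_eq_zero_iff_ae_notMem.1 this
    filter_upwards [h2] with x hx _ h1 h3
    exact hx ⟨h1, h3⟩

theorem ae_eq_of_cells (hΩr : interior (closure Ω) = Ω) {β : Type*} {f g : Space d → β}
    (h : ∀ s : T.cells, ∀ᵐ x ∂(volume.restrict Ω),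
      x ∈ convexHull ℝ (s.1 : Set (Space d)) → f x = g x) : f =ᵐ[volume.restrict Ω] g := by
  filter_upwards [ae_all_iff.2 h, T.ae_mem_cell hΩr] with x h1 ⟨s, hs⟩
  exact h1 s hs

/-- The piecewise affine function with values `θ_s.1 + θ_s.2 · x` on the cell `s`. -/
def cellFun (θ : T.cells → ℝ × Space d) (x : Space d) : ℝ :=
  ∑ s, (convexHull ℝ (s.1 : Set (Space d))).indicator (fun x => (θ s).1 + inner ℝ (θ s).2 x) x

theorem cellFun_ae (θ : T.cells → ℝ × Space d) : ∀ᵐ x ∂(volume.restrict Ω), ∀ s : T.cells,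
    x ∈ convexHull ℝ (s.1 : Set (Space d)) → T.cellFun θ x = (θ s).1 + inner ℝ (θ s).2 x := by
  filter_upwards [T.ae_unique_cell] with x hx s hs
  rw [cellFun, Finset.sum_eq_single s, Set.indicator_of_mem hs]
  · intro s' _ hne
    exact Set.indicator_of_notMem (hx s s' hne.symm hs) _
  · simp

theorem memLp_cellFun (θ : T.cells → ℝ × Space d) :
    MemLp (T.cellFun θ) 2 (volume.restrict Ω) := by
  refine MemLp.restrict _ ?_
  refine memLp_finsetSum (f := fun (s : T.cells) x => (convexHull ℝ (s.1 : Set (Space d))).indicator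
    (fun x => (θ s).1 + inner ℝ (θ s).2 x) x) _ fun s _ => ?_
  have hK := IsSimplex.isCompact_convexHull (s.1 : Finset (Space d))
  have hc : ContinuousOn (fun x => (θ s).1 + inner ℝ (θ s).2 x)
      (convexHull ℝ (s.1 : Set (Space d))) := by fun_prop
  rw [memLp_indicator_iff_restrict hK.measurableSet]
  have : IsFiniteMeasure (volume.restrict (convexHull ℝ (s.1 : Set (Space d)))) :=
    ⟨by simpa using hK.measure_lt_top⟩
  obtain ⟨C, hC⟩ := hK.exists_bound_of_continuousOn hc
  refine MemLp.of_bound (hc.aestronglyMeasurable hK.measurableSet) C ?_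
  exact (ae_restrict_iff' hK.measurableSet).2 (Eventually.of_forall hC)

/-- The `L²` class of a piecewise affine function. -/
def cellLp : (T.cells → ℝ × Space d) →ₗ[ℝ] L2 Ω where
  toFun θ := (T.memLp_cellFun θ).toLp
  map_add' θ θ' := by
    rw [← MemLp.toLp_add]
    refine MemLp.toLp_congr _ _ (Eventually.of_forall fun x => ?_)
    simp only [cellFun, Pi.add_apply, Prod.fst_add, Prod.snd_add, inner_add_left]
    rw [← Finset.sum_add_distrib]
    refine Finset.sum_congr rfl fun s _ => ?_
    by_cases hx : x ∈ convexHull ℝ (s.1 : Set (Space d))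
    · simp only [Set.indicator_of_mem hx]; ring
    · simp only [Set.indicator_of_notMem hx]; ring
  map_smul' c θ := by
    rw [RingHom.id_apply, ← MemLp.toLp_const_smul]
    refine MemLp.toLp_congr _ _ (Eventually.of_forall fun x => ?_)
    simp only [cellFun, Pi.smul_apply, Prod.smul_fst, Prod.smul_snd, real_inner_smul_left,
      smul_eq_mul, Finset.mul_sum]
    refine Finset.sum_congr rfl fun s _ => ?_
    by_cases hx : x ∈ convexHull ℝ (s.1 : Set (Space d))
    · simp only [Set.indicator_of_mem hx]; ring
    · simp only [Set.indicator_of_notMem hx]; ring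

theorem cellLp_ae (θ : T.cells → ℝ × Space d) : ∀ᵐ x ∂(volume.restrict Ω), ∀ s : T.cells,
    x ∈ convexHull ℝ (s.1 : Set (Space d)) → T.cellLp θ x = (θ s).1 + inner ℝ (θ s).2 x := by
  filter_upwards [T.cellFun_ae θ, (T.memLp_cellFun θ).coeFn_toLp] with x h1 h2 s hs
  rw [← h1 s hs, ← h2]
  rfl

/-- The parameters form a finite-dimensional space. Hence `W_h` and the components of `V_h` and
`Z_h` lie in a finite-dimensional range. -/
theorem mem_range_cellLp (hΩr : interior (closure Ω) = Ω) {f : L2 Ω}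
    (h : ∀ s ∈ T.cells, ∃ θ : ℝ × Space d, ∀ᵐ x ∂(volume.restrict Ω),
      x ∈ convexHull ℝ (s : Set (Space d)) → f x = θ.1 + inner ℝ θ.2 x) :
    f ∈ LinearMap.range T.cellLp := by
  choose θ hθ using fun s : T.cells => h s.1 s.2
  refine ⟨θ, Lp.ext (T.ae_eq_of_cells hΩr fun s => ?_)⟩
  filter_upwards [hθ s, T.cellLp_ae θ] with x h1 h2 hs
  rw [h1 hs, h2 s hs]

variable (hΩ : IsOpen Ω) [IsFiniteMeasure (volume.restrict Ω)]

/-- `W_h` as a subspace. -/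
def WSub : Submodule ℝ (L2 Ω) where
  carrier := T.W
  add_mem' := fun {u v} hu hv s hs => by
    obtain ⟨c, hc⟩ := hu s hs
    obtain ⟨c', hc'⟩ := hv s hs
    refine ⟨c + c', ?_⟩
    filter_upwards [hc, hc', Lp.coeFn_add u v] with x h1 h2 h3 hx
    rw [h3, Pi.add_apply, h1 hx, h2 hx]
  zero_mem' := fun s hs => ⟨0, by
    filter_upwards [Lp.coeFn_zero ℝ 2 (volume.restrict Ω)] with x h _
    rw [h, Pi.zero_apply]⟩
  smul_mem' := fun c u hu s hs => by
    obtain ⟨a, ha⟩ := hu s hs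
    refine ⟨c * a, ?_⟩
    filter_upwards [ha, Lp.coeFn_smul c u] with x h1 h2 hx
    rw [h2, Pi.smul_apply, h1 hx, smul_eq_mul]

/-- `V_h` as a subspace. -/
def VSub : Submodule ℝ (L2Vec Ω) where
  carrier := T.V
  add_mem' := fun {u v} hu hv => ⟨(HdivSub Ω).add_mem hu.1 hv.1, fun s hs => by
    obtain ⟨a, c, hc⟩ := hu.2 s hs
    obtain ⟨a', c', hc'⟩ := hv.2 s hs
    refine ⟨a + a', c + c', ?_⟩
    filter_upwards [hc, hc', ae_all_iff.2 fun i => Lp.coeFn_add (u i) (v i)] with x h1 h2 h3 hx i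
    rw [PiLp.add_apply, h3, Pi.add_apply, h1 hx, h2 hx, PiLp.add_apply]
    ring⟩
  zero_mem' := ⟨(HdivSub Ω).zero_mem, fun s hs => ⟨0, 0, by
    filter_upwards [Lp.coeFn_zero ℝ 2 (volume.restrict Ω)] with x h _ i
    simp only [PiLp.zero_apply, h, Pi.zero_apply]
    simp⟩⟩
  smul_mem' := fun c u hu => ⟨(HdivSub Ω).smul_mem c hu.1, fun s hs => by
    obtain ⟨a, b, ha⟩ := hu.2 s hs
    refine ⟨c • a, c * b, ?_⟩
    filter_upwards [ha, ae_all_iff.2 fun i => Lp.coeFn_smul c (u i)] with x h1 h2 hx i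
    rw [PiLp.smul_apply, h2, Pi.smul_apply, h1 hx, PiLp.smul_apply]
    simp only [smul_eq_mul]
    ring⟩

/-- `Z_h` as a subspace. -/
def ZSub : Submodule ℝ (L2Vec Ω) where
  carrier := T.Z
  add_mem' := fun {u v} hu hv => ⟨fun i => (H10Sub Ω hΩ).add_mem (hu.1 i) (hv.1 i), fun s hs i => by
    obtain ⟨a, ha⟩ := hu.2 s hs i
    obtain ⟨a', ha'⟩ := hv.2 s hs i
    refine ⟨a + a', ?_⟩
    filter_upwards [ha, ha', Lp.coeFn_add (u i) (v i)] with x h1 h2 h3 hx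
    rw [PiLp.add_apply, h3, Pi.add_apply, h1 hx, h2 hx, AffineMap.coe_add, Pi.add_apply]⟩
  zero_mem' := ⟨fun i => (H10Sub Ω hΩ).zero_mem, fun s hs i => ⟨0, by
    filter_upwards [Lp.coeFn_zero ℝ 2 (volume.restrict Ω)] with x h _
    simp only [PiLp.zero_apply, h, Pi.zero_apply]
    simp⟩⟩
  smul_mem' := fun c u hu => ⟨fun i => (H10Sub Ω hΩ).smul_mem c (hu.1 i), fun s hs i => by
    obtain ⟨a, ha⟩ := hu.2 s hs i
    refine ⟨c • a, ?_⟩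
    filter_upwards [ha, Lp.coeFn_smul c (u i)] with x h1 h2 hx
    rw [PiLp.smul_apply, h2, Pi.smul_apply, h1 hx, AffineMap.coe_smul, Pi.smul_apply]⟩

omit [IsFiniteMeasure (volume.restrict Ω)] in
theorem finiteDimensional_of_components (hΩr : interior (closure Ω) = Ω)
    (S : Submodule ℝ (L2Vec Ω)) (h : ∀ v ∈ S, ∀ s ∈ T.cells, ∀ i, ∃ θ : ℝ × Space d,
      ∀ᵐ x ∂(volume.restrict Ω), x ∈ convexHull ℝ (s : Set (Space d)) →
        v i x = θ.1 + inner ℝ θ.2 x) : FiniteDimensional ℝ S := by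
  let f : S →ₗ[ℝ] (Fin d → LinearMap.range T.cellLp) :=
    { toFun := fun v i => ⟨v.1 i, T.mem_range_cellLp hΩr fun s hs => h v.1 v.2 s hs i⟩
      map_add' := fun _ _ => rfl
      map_smul' := fun _ _ => rfl }
  refine FiniteDimensional.of_injective f fun v w hvw => ?_
  refine Subtype.ext (PiLp.ext fun i => ?_)
  exact congrArg Subtype.val (congrFun hvw i)

omit [IsFiniteMeasure (volume.restrict Ω)] in
theorem finiteDimensional_WSub (hΩr : interior (closure Ω) = Ω) : FiniteDimensional ℝ T.WSub := by
  have : T.WSub ≤ LinearMap.range T.cellLp := fun w hw => T.mem_range_cellLp hΩr fun s hs => by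
    obtain ⟨c, hc⟩ := hw s hs
    exact ⟨(c, 0), by simpa using hc⟩
  exact Submodule.finiteDimensional_of_le this

omit [IsFiniteMeasure (volume.restrict Ω)] in
theorem finiteDimensional_VSub (hΩr : interior (closure Ω) = Ω) : FiniteDimensional ℝ T.VSub :=
  T.finiteDimensional_of_components hΩr _ fun v hv s hs i => by
    obtain ⟨a, c, h⟩ := hv.2 s hs
    refine ⟨(a i, c • EuclideanSpace.single i 1), ?_⟩
    filter_upwards [h] with x hx hxs
    rw [hx hxs i, real_inner_smul_left, EuclideanSpace.inner_single_left]
    simp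

theorem finiteDimensional_ZSub (hΩr : interior (closure Ω) = Ω) :
    FiniteDimensional ℝ (T.ZSub hΩ) :=
  T.finiteDimensional_of_components hΩr _ fun v hv s hs i => by
    obtain ⟨a, h⟩ := hv.2 s hs i
    refine ⟨(a 0, (InnerProductSpace.toDual ℝ _).symm
      (LinearMap.toContinuousLinearMap a.linear)), ?_⟩
    filter_upwards [h] with x hx hxs
    rw [hx hxs, InnerProductSpace.toDual_symm_apply]
    simpa [add_comm] using congrFun a.decomp x

end Mesh

/-! ### The two-point flux scheme in abstract form -/

section TwoPointFlux

variable {C H Φ : Type*} [Fintype C] [Fintype H] [DecidableEq C] [DecidableEq Φ]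

/-- The jump across the facet `F` of the cell values `p`. -/
def jump (cell : H → C) (fac : H → Φ) (ε : H → ℝ) (p : C → ℝ) (F : Φ) : ℝ :=
  ∑ h with fac h = F, ε h * p (cell h)

variable {cell : H → C} {fac : H → Φ} {ε : H → ℝ} {vol : C → ℝ} {f c : Φ → ℝ} {M N : ℝ}

omit [Fintype C] [DecidableEq C] in
theorem sum_fiber_le_two_mul (hF : ∀ F, ((Finset.univ.filter fun h => fac h = F).card : ℝ) ≤ 2)
    {G : Φ → ℝ} (hG : ∀ h, 0 ≤ G (fac h)) :
    ∑ h, G (fac h) ≤ 2 * ∑ F ∈ Finset.univ.image fac, G F := by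
  rw [← Finset.sum_fiberwise_of_maps_to (s := Finset.univ) (t := Finset.univ.image fac) (g := fac)
    (by simp), Finset.mul_sum]
  refine Finset.sum_le_sum fun F hFm => ?_
  obtain ⟨h0, -, rfl⟩ := Finset.mem_image.1 hFm
  rw [Finset.sum_congr rfl (g := fun _ => G (fac h0)) (by simp +contextual), Finset.sum_const,
    nsmul_eq_mul]
  gcongr
  · exact hG h0
  · exact hF _

-- Discrete integration by parts: grouping half facets by facet collects the signed cell values into
-- a second factor of the jump.
omit [Fintype C] [DecidableEq C] in
theorem sum_mul_jump (p : C → ℝ) :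
    ∑ h, p (cell h) * (ε h * (c (fac h) * jump cell fac ε p (fac h)))
      = ∑ F ∈ Finset.univ.image fac, c F * jump cell fac ε p F ^ 2 := by
  rw [← Finset.sum_fiberwise_of_maps_to (s := Finset.univ) (t := Finset.univ.image fac) (g := fac)
    (by simp)]
  refine Finset.sum_congr rfl fun F _ => ?_
  rw [Finset.sum_congr rfl
    (g := fun h => (ε h * p (cell h)) * (c F * jump cell fac ε p F)) (fun h hh => ?_),
    ← Finset.sum_mul]
  · change jump cell fac ε p F * _ = _
    ring
  · rw [(Finset.mem_filter.1 hh).2]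
    ring

/-- The discrete Poincaré inequality for piecewise constant functions. -/
theorem sum_vol_sq_le (hvol : ∀ s, 0 < vol s) (hM : 0 ≤ M) (hN : 0 ≤ N)
    (hc : ∀ h, 0 < c (fac h))
    (h1 : ∀ s, ∑ h with cell h = s, ε h * f (fac h) = vol s)
    (h2 : ∀ (F : Φ) (p : C → ℝ), |∑ h with fac h = F, ε h * p (cell h) ^ 2|
      ≤ |jump cell fac ε p F| * ∑ h with fac h = F, |p (cell h)|)
    (h3 : ∀ h, f (fac h) ^ 2 ≤ M * (c (fac h) * vol (cell h)))
    (hC : ∀ s, ((Finset.univ.filter fun h => cell h = s).card : ℝ) ≤ N) (p : C → ℝ) :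
    ∑ s, vol s * p s ^ 2 ≤ M * N * ∑ h, c (fac h) * jump cell fac ε p (fac h) ^ 2 := by
  set J := jump cell fac ε p
  set S := ∑ s, vol s * p s ^ 2
  set EH := ∑ h, c (fac h) * J (fac h) ^ 2
  have hS0 : 0 ≤ S := Finset.sum_nonneg fun s _ => mul_nonneg (hvol s).le (sq_nonneg _)
  have hE0 : 0 ≤ EH := Finset.sum_nonneg fun h _ => mul_nonneg (hc h).le (sq_nonneg _)
  -- Hypothesis `h1` writes the volume of a cell as its total outward flux `f`. Regrouped by facets,
  -- `S` becomes a sum of fluxes times jumps of `p²`, which `h2` factors into the jump of `p` and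
  -- the sum of `|p|`.
  have e1 : S = ∑ h, ε h * f (fac h) * p (cell h) ^ 2 := by
    rw [← Finset.sum_fiberwise (s := Finset.univ) (g := cell)]
    refine Finset.sum_congr rfl fun s _ => ?_
    rw [← h1 s, Finset.sum_mul]
    refine Finset.sum_congr rfl fun h hh => ?_
    rw [(Finset.mem_filter.1 hh).2]
  have e2 : S ≤ ∑ h, |f (fac h)| * |J (fac h)| * |p (cell h)| := by
    rw [e1, ← Finset.sum_fiberwise_of_maps_to (s := Finset.univ) (t := Finset.univ.image fac)
      (g := fac) (by simp), ← Finset.sum_fiberwise_of_maps_to (s := Finset.univ)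
      (t := Finset.univ.image fac) (g := fac)
      (f := fun h => |f (fac h)| * |J (fac h)| * |p (cell h)|) (by simp)]
    refine Finset.sum_le_sum fun F _ => ?_
    have a1 : ∑ h with fac h = F, ε h * f (fac h) * p (cell h) ^ 2
        = f F * ∑ h with fac h = F, ε h * p (cell h) ^ 2 := by
      rw [Finset.mul_sum]
      exact Finset.sum_congr rfl fun h hh => by rw [(Finset.mem_filter.1 hh).2]; ring
    have a2 : ∑ h with fac h = F, |f (fac h)| * |J (fac h)| * |p (cell h)|
        = |f F| * |J F| * ∑ h with fac h = F, |p (cell h)| := by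
      rw [Finset.mul_sum]
      exact Finset.sum_congr rfl fun h hh => by rw [(Finset.mem_filter.1 hh).2]
    rw [a1, a2]
    refine (le_abs_self _).trans ?_
    rw [abs_mul, mul_assoc]
    exact mul_le_mul_of_nonneg_left (h2 F p) (abs_nonneg _)
  have e3 : (∑ h, |f (fac h)| * |J (fac h)| * |p (cell h)|) ^ 2
      ≤ EH * ∑ h, M * (vol (cell h) * p (cell h) ^ 2) := by
    refine Finset.sum_sq_le_sum_mul_sum_of_sq_le_mul _
      (fun h _ => mul_nonneg (hc h).le (sq_nonneg _))
      (fun h _ => mul_nonneg hM (mul_nonneg (hvol _).le (sq_nonneg _))) (fun h _ => ?_)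
    have := mul_le_mul_of_nonneg_right (h3 h)
      (mul_nonneg (sq_nonneg (J (fac h))) (sq_nonneg (p (cell h))))
    calc _ = f (fac h) ^ 2 * (J (fac h) ^ 2 * p (cell h) ^ 2) := by
          rw [mul_pow, mul_pow, sq_abs, sq_abs, sq_abs]; ring
      _ ≤ _ := this
      _ = _ := by ring
  have e4 : ∑ h, M * (vol (cell h) * p (cell h) ^ 2) ≤ M * (N * S) := by
    rw [← Finset.mul_sum, ← Finset.sum_fiberwise (s := Finset.univ) (g := cell)]
    refine mul_le_mul_of_nonneg_left ?_ hM
    rw [Finset.mul_sum]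
    refine Finset.sum_le_sum fun s _ => ?_
    rw [Finset.sum_congr rfl (g := fun h => vol s * p s ^ 2) (fun h hh => by
      rw [(Finset.mem_filter.1 hh).2]), Finset.sum_const, nsmul_eq_mul]
    exact mul_le_mul_of_nonneg_right (hC s) (mul_nonneg (hvol s).le (sq_nonneg _))
  -- Cauchy–Schwarz leaves a factor `S` on the right, since each cell value occurs in at most `N`
  -- half facets; it is cancelled below.
  have e5 : S ^ 2 ≤ M * N * EH * S :=
    calc S ^ 2 ≤ _ := pow_le_pow_left₀ hS0 e2 2
      _ ≤ _ := e3
      _ ≤ EH * (M * (N * S)) := mul_le_mul_of_nonneg_left e4 hE0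
      _ = _ := by ring
  rcases hS0.eq_or_lt with h0 | h0
  · rw [← h0]; positivity
  · rw [sq] at e5
    exact le_of_mul_le_mul_right e5 h0

/-- Solvability and stability of the two-point flux approximation. -/
theorem exists_twoPointFlux (hvol : ∀ s, 0 < vol s) (hM : 0 ≤ M) (hN : 0 ≤ N)
    (hc : ∀ h, 0 < c (fac h))
    (h1 : ∀ s, ∑ h with cell h = s, ε h * f (fac h) = vol s)
    (h2 : ∀ (F : Φ) (p : C → ℝ), |∑ h with fac h = F, ε h * p (cell h) ^ 2|
      ≤ |jump cell fac ε p F| * ∑ h with fac h = F, |p (cell h)|)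
    (h3 : ∀ h, f (fac h) ^ 2 ≤ M * (c (fac h) * vol (cell h)))
    (hF : ∀ F, ((Finset.univ.filter fun h => fac h = F).card : ℝ) ≤ 2)
    (hC : ∀ s, ((Finset.univ.filter fun h => cell h = s).card : ℝ) ≤ N) (w : C → ℝ) :
    ∃ J : Φ → ℝ, (∀ s, ∑ h with cell h = s, ε h * (c (fac h) * J (fac h)) = vol s * w s) ∧
      ∑ h, c (fac h) * J (fac h) ^ 2 ≤ 4 * (M * N) * ∑ s, vol s * w s ^ 2 := by
  -- The finite volume Laplacian. Its quadratic form is the weighted sum of squared jumps, so the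
  -- Poincaré inequality makes it injective and therefore surjective.
  let B : (C → ℝ) →ₗ[ℝ] (C → ℝ) :=
    { toFun := fun p s => ∑ h with cell h = s, ε h * (c (fac h) * jump cell fac ε p (fac h))
      map_add' := fun p q => by
        ext s
        simp only [jump, Pi.add_apply, mul_add, Finset.sum_add_distrib]
      map_smul' := fun a p => by
        ext s
        simp only [jump, Pi.smul_apply, smul_eq_mul, RingHom.id_apply, Finset.mul_sum]
        exact Finset.sum_congr rfl fun _ _ => Finset.sum_congr rfl fun _ _ => by ring }
  have hB : ∀ p : C → ℝ, ∑ s, p s * B p s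
      = ∑ F ∈ Finset.univ.image fac, c F * jump cell fac ε p F ^ 2 := fun p => by
    rw [← sum_mul_jump, ← Finset.sum_fiberwise (s := Finset.univ) (g := cell)]
    refine Finset.sum_congr rfl fun s _ => ?_
    change p s * ∑ h with cell h = s, _ = _
    rw [Finset.mul_sum]
    exact Finset.sum_congr rfl fun h hh => by rw [(Finset.mem_filter.1 hh).2]
  have hEH : ∀ p : C → ℝ, ∑ h, c (fac h) * jump cell fac ε p (fac h) ^ 2
      ≤ 2 * ∑ s, p s * B p s := fun p => by
    rw [hB]
    exact sum_fiber_le_two_mul (G := fun F => c F * jump cell fac ε p F ^ 2) hF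
      fun h => mul_nonneg (hc h).le (sq_nonneg _)
  have hP := sum_vol_sq_le hvol hM hN hc h1 h2 h3 hC
  have hinj : Function.Injective B := by
    rw [← LinearMap.ker_eq_bot, LinearMap.ker_eq_bot']
    intro p hp
    have e1 := hEH p
    rw [hp] at e1
    simp only [Pi.zero_apply, mul_zero, Finset.sum_const_zero] at e1
    have e2 := (hP p).trans (mul_le_mul_of_nonneg_left e1 (mul_nonneg hM hN))
    rw [mul_zero] at e2
    have hnn : ∀ s ∈ Finset.univ, 0 ≤ vol s * p s ^ 2 :=
      fun s _ => mul_nonneg (hvol s).le (sq_nonneg _)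
    have e3 := (Finset.sum_eq_zero_iff_of_nonneg hnn).1 (le_antisymm e2 (Finset.sum_nonneg hnn))
    ext s
    have := e3 s (Finset.mem_univ s)
    rcases mul_eq_zero.1 this with h | h
    · exact absurd h (hvol s).ne'
    · simpa using h
  obtain ⟨p, hp⟩ := (LinearMap.injective_iff_surjective.1 hinj) fun s => vol s * w s
  refine ⟨jump cell fac ε p, fun s => congrFun hp s, ?_⟩
  set EH := ∑ h, c (fac h) * jump cell fac ε p (fac h) ^ 2
  set W := ∑ s, vol s * w s ^ 2
  set S := ∑ s, vol s * p s ^ 2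
  have hE0 : 0 ≤ EH := Finset.sum_nonneg fun h _ => mul_nonneg (hc h).le (sq_nonneg _)
  have hW0 : 0 ≤ W := Finset.sum_nonneg fun s _ => mul_nonneg (hvol s).le (sq_nonneg _)
  have e1 : EH ≤ 2 * ∑ s, p s * (vol s * w s) := by
    have := hEH p
    rwa [hp] at this
  have e2 : (∑ s, p s * (vol s * w s)) ^ 2 ≤ S * W := by
    refine Finset.sum_sq_le_sum_mul_sum_of_sq_le_mul _
      (fun s _ => mul_nonneg (hvol s).le (sq_nonneg _))
      (fun s _ => mul_nonneg (hvol s).le (sq_nonneg _)) (fun s _ => le_of_eq ?_)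
    ring
  -- Here `EH ≤ 2 ∑ p vol w`, the two arising because `EH` counts each facet at most twice; then
  -- Cauchy–Schwarz and `S ≤ M N EH` apply.
  have e3 : EH ^ 2 ≤ 4 * (M * N) * W * EH := by
    have := pow_le_pow_left₀ hE0 e1 2
    have h4 := mul_le_mul_of_nonneg_right (hP p) hW0
    change S * W ≤ M * N * EH * W at h4
    nlinarith
  rcases hE0.eq_or_lt with h0 | h0
  · rw [← h0]; positivity
  · rw [sq] at e3
    exact le_of_mul_le_mul_right e3 h0

end TwoPointFlux
-- Half facets: orientation, cancellation of fluxes, shape regularity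
namespace Mesh

variable {d : ℕ} {Ω : Set (Space d)} (T : Mesh Ω)

/-- A cell together with a vertex, standing for the facet of the cell opposite to the vertex. -/
abbrev HalfFacet := (s : T.cells) × s.1

/-- The volume of a cell. -/
def vol (s : T.cells) : ℝ := volume.real (convexHull ℝ (s.1 : Set (Space d)))

/-- The diameter of a cell. -/
def diam (s : T.cells) : ℝ := Metric.diam (convexHull ℝ (s.1 : Set (Space d)))

variable {T}

/-- The vertices of a half facet. -/
def facet (h : T.HalfFacet) : Finset (Space d) := h.1.1.erase h.2.1

theorem vol_pos (s : T.cells) : 0 < T.vol s := (T.isSimplex s.2).measureReal_pos volume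

theorem dist_le_diam (s : T.cells) {x y : Space d} (hx : x ∈ convexHull ℝ (s.1 : Set (Space d)))
    (hy : y ∈ convexHull ℝ (s.1 : Set (Space d))) : ‖x - y‖ ≤ T.diam s := by
  rw [← dist_eq_norm]
  exact Metric.dist_le_diam_of_mem (IsSimplex.isCompact_convexHull s.1).isBounded hx hy

theorem cell_ne_of_facet_eq {h h' : T.HalfFacet} (hne : h ≠ h') (hf : facet h = facet h') :
    h.1 ≠ h'.1 := by
  obtain ⟨s, a⟩ := h
  obtain ⟨s', a'⟩ := h'
  intro hs
  simp only at hs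
  subst hs
  apply hne
  congr 1
  by_contra hne'
  have : a'.1 ∈ facet (⟨s, a⟩ : T.HalfFacet) :=
    Finset.mem_erase.2 ⟨fun h => hne' (Subtype.ext h.symm), a'.2⟩
  rw [hf] at this
  exact (Finset.notMem_erase _ _) this

theorem facet_subset (h : T.HalfFacet) : (facet h : Set (Space d)) ⊆ (h.1.1 : Set (Space d)) :=
  Finset.coe_subset.2 (Finset.erase_subset _ _)

variable (T) in
/-- A choice of unit normals of the facets, in terms of the signs `ε` of the half facets, together
with the fluxes `f` of the field `x`. -/
theorem exists_orientation (hd : 1 ≤ d) :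
    ∃ (ε : T.HalfFacet → ℝ) (f : Finset (Space d) → ℝ), (∀ h, ε h = 1 ∨ ε h = -1) ∧
      (∀ h h', h ≠ h' → facet h = facet h' → ε h' = - ε h) ∧
      ∀ h, T.vol h.1 * bary h.1.1 h.2.1 0 = ε h * f (facet h) := by
  -- One half facet `R h` represents each facet. The coordinate `β h` of the vertex of `h` in the
  -- cell of `R h` reveals its side, so its sign serves as `ε h`. The number `f` is `vol * bary` at
  -- the origin for the representative, which is the flux of the field `x` divided by `d`.
  choose r hr using fun F : Set.range (facet (T := T)) => F.2
  set R : T.HalfFacet → T.HalfFacet := fun h => r ⟨facet h, h, rfl⟩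
  have hR : ∀ h, facet (R h) = facet h := fun h => hr ⟨facet h, h, rfl⟩
  have hRR : ∀ h h', facet h = facet h' → R h = R h' := fun h h' hh => by
    simp only [R, hh]
  set β : T.HalfFacet → ℝ := fun h => bary (R h).1.1 (R h).2.1 h.2.1
  have hS : ∀ h : T.HalfFacet, IsSimplex h.1.1 := fun h => T.isSimplex h.1.2
  have hβ : ∀ h, β h ≠ 0 := fun h =>
    (hS (R h)).bary_ne_zero (hS h) (R h).2.2 (hR h)
  classical
  refine ⟨fun h => β h / |β h|, fun F => if H : F ∈ Set.range (facet (T := T)) then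
    T.vol (r ⟨F, H⟩).1 * bary (r ⟨F, H⟩).1.1 (r ⟨F, H⟩).2.1 0 else 0, fun h => ?_,
    fun h h' hne hf => ?_, fun h => ?_⟩
  · rcases lt_or_gt_of_ne (hβ h) with h1 | h1
    · right; simp only [abs_of_neg h1, div_neg, div_self h1.ne]
    · left; simp only [abs_of_pos h1, div_self h1.ne']
  -- Coordinates multiply when the reference cell changes, and the factor is negative because
  -- distinct neighbours lie on opposite sides.
  · have h1 : β h' = bary h.1.1 h.2.1 h'.2.1 * β h := by
      have := (hS (R h)).bary_eq_mul (hS h) (R h).2.2 h.2.2 (hR h) h'.2.1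
      simp only [β]
      rw [← this, ← hRR h h' hf]
    have h2 : bary h.1.1 h.2.1 h'.2.1 < 0 :=
      T.bary_neg hd h.1.2 h'.1.2 (fun hh => cell_ne_of_facet_eq hne hf (Subtype.ext hh)) h.2.2
        h'.2.2 hf
    have h3 := abs_pos.2 (hβ h)
    simp only [h1, abs_mul, abs_of_neg h2]
    field_simp
    rw [mul_div_cancel_left₀ _ h2.ne]
  · have H : facet h ∈ Set.range (facet (T := T)) := ⟨h, rfl⟩
    beta_reduce
    rw [dif_pos H]
    change _ = β h / |β h| * (T.vol (R h).1 * bary (R h).1.1 (R h).2.1 0)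
    have h1 : T.vol h.1 = |β h| * T.vol (R h).1 :=
      (hS (R h)).measureReal_eq volume (hS h) (R h).2.2 h.2.2 (hR h)
    have h2 : bary (R h).1.1 (R h).2.1 0 = bary h.1.1 h.2.1 0 * β h :=
      (hS (R h)).bary_eq_mul (hS h) (R h).2.2 h.2.2 (hR h) 0
    have h3 := abs_pos.2 (hβ h)
    rw [h1, h2]
    have h4 : |β h| * |β h| = β h * β h := abs_mul_abs_self _
    field_simp
    rw [sq, h4]; ring

section Fiber

variable {ε : T.HalfFacet → ℝ} (h1 : ∀ h, ε h = 1 ∨ ε h = -1)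
  (hε : ∀ h h', h ≠ h' → facet h = facet h' → ε h' = - ε h)
include h1 hε

/-- A facet belongs to one cell, or to two cells on opposite sides. -/
theorem fiber_cases (F : Finset (Space d)) :
    (Finset.univ.filter fun h : T.HalfFacet => facet h = F) = ∅ ∨
    (∃ h, facet h = F ∧ (Finset.univ.filter fun h : T.HalfFacet => facet h = F) = {h}) ∨
    ∃ h h', h ≠ h' ∧ facet h = F ∧ facet h' = F ∧ ε h' = - ε h ∧
      (Finset.univ.filter fun h : T.HalfFacet => facet h = F) = {h, h'} := by
  classical
  by_cases e1 : ∃ h : T.HalfFacet, facet h = F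
  swap
  · left
    ext h
    simpa using fun hh => e1 ⟨h, hh⟩
  obtain ⟨h, hh⟩ := e1
  right
  by_cases e2 : ∃ h' : T.HalfFacet, h ≠ h' ∧ facet h' = F
  swap
  · left
    push Not at e2
    refine ⟨h, hh, ?_⟩
    ext h'
    simp only [Finset.mem_filter, Finset.mem_univ, true_and, Finset.mem_singleton]
    exact ⟨fun h2 => by_contra fun hne => e2 h' (Ne.symm hne) h2, fun h2 => h2 ▸ hh⟩
  obtain ⟨h', hne, hh'⟩ := e2
  right
  have h3 := hε h h' hne (hh.trans hh'.symm)
  refine ⟨h, h', hne, hh, hh', h3, ?_⟩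
  ext k
  simp only [Finset.mem_filter, Finset.mem_univ, true_and, Finset.mem_insert,
    Finset.mem_singleton]
  constructor
  · intro hk
    by_contra! hcon
    -- Three half facets of one facet would carry pairwise opposite signs, impossible for `± 1`.
    have h4 := hε h k hcon.1.symm (hh.trans hk.symm)
    have h5 := hε h' k hcon.2.symm (hh'.trans hk.symm)
    rcases h1 h with h6 | h6 <;> rw [h6] at h3 h4 <;> rw [h3, h4] at h5 <;> norm_num at h5
  · rintro (rfl | rfl)
    · exact hh
    · exact hh'

theorem card_fiber_le (F : Finset (Space d)) :
    ((Finset.univ.filter fun h : T.HalfFacet => facet h = F).card : ℝ) ≤ 2 := by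
  classical
  rcases fiber_cases h1 hε F with e | ⟨h, -, e⟩ | ⟨h, h', hne, -, -, -, e⟩
  · simp [e]
  · simp [e]
  · rw [e, Finset.card_pair hne]; norm_num

/-- Between two cells this is `p² - q² = (p - q)(p + q)`. On a facet of one cell the jump is `± p`,
which amounts to the value zero outside `Ω`. -/
theorem abs_sum_fiber_sq_le (F : Finset (Space d)) (p : T.cells → ℝ) :
    |∑ h : T.HalfFacet with facet h = F, ε h * p h.1 ^ 2|
      ≤ |jump (fun h : T.HalfFacet => h.1) facet ε p F|
        * ∑ h : T.HalfFacet with facet h = F, |p h.1| := by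
  classical
  have ha : ∀ h, |ε h| = 1 := fun h => by rcases h1 h with e | e <;> simp [e]
  rw [jump]
  rcases fiber_cases h1 hε F with e | ⟨h, -, e⟩ | ⟨h, h', hne, -, -, e', e⟩
  · simp [e]
  · simp [e, abs_mul, ha, ← sq]
  · rw [e]
    simp only [Finset.sum_pair hne, e']
    have e1 : ε h * p h.1 ^ 2 + -ε h * p h'.1 ^ 2 = ε h * ((p h.1 - p h'.1) * (p h.1 + p h'.1)) := by
      ring
    have e2 : ε h * p h.1 + -ε h * p h'.1 = ε h * (p h.1 - p h'.1) := by ring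
    rw [e1, e2]
    simp only [abs_mul, ha, one_mul]
    exact mul_le_mul_of_nonneg_left (abs_add_le _ _) (abs_nonneg _)

/-- The fluxes of a test function across the facets of the mesh cancel. -/
theorem sum_flux_eq_zero (hd : 1 ≤ d) (hΩ : IsOpen Ω) (g : Finset (Space d) → ℝ)
    {φ : Space d → ℝ} (hφ : IsTest Ω φ) :
    ∑ h : T.HalfFacet, ε h * g (facet h) * ((T.vol h.1)⁻¹ *
      ∫ x in convexHull ℝ (h.1.1 : Set (Space d)), (fderiv ℝ φ x (x - h.2.1) + d * φ x)) = 0 := by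
  classical
  have hφ1 : ContDiff ℝ 1 φ := hφ.1.of_le (by simp)
  set A : T.HalfFacet → ℝ := fun h => (T.vol h.1)⁻¹ *
      ∫ x in convexHull ℝ (h.1.1 : Set (Space d)), (fderiv ℝ φ x (x - h.2.1) + d * φ x)
  have hne : ∀ h : T.HalfFacet, (h.1.1.erase h.2.1).Nonempty :=
    fun h => T.facet_nonempty hd h.1.2 h.2.2
  -- Radial integral and volume scale by the same factor when the opposite vertex moves, so the
  -- quotient belongs to the facet and opposite signs cancel.
  have hA : ∀ h h', facet h = facet h' → A h' = A h := by
    intro h h' hf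
    have e1 := (T.isSimplex h.1.2).integral_radial_eq volume (T.isSimplex h'.1.2) h.2.2 h'.2.2 hf
      (hne h) hφ1
    have e2 : T.vol h'.1 = _ :=
      (T.isSimplex h.1.2).measureReal_eq volume (T.isSimplex h'.1.2) h.2.2 h'.2.2 hf
    have e3 := abs_pos.2 ((T.isSimplex h.1.2).bary_ne_zero (T.isSimplex h'.1.2) h.2.2 hf)
    rw [finrank_euclideanSpace_fin] at e1
    simp only [A]
    rw [e1, e2, mul_inv]
    change _ * (T.vol h.1)⁻¹ * _ = _
    field_simp
  rw [← Finset.sum_fiberwise_of_maps_to (s := Finset.univ)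
    (t := Finset.univ.image (facet (T := T))) (g := facet)
    (fun h _ => Finset.mem_image_of_mem _ (Finset.mem_univ h))]
  refine Finset.sum_eq_zero fun F _ => ?_
  rcases fiber_cases h1 hε F with e | ⟨h, hF, e⟩ | ⟨h, h', hne', hF, hF', e', e⟩
  · simp [e]
  · rw [e, Finset.sum_singleton]
    -- A facet of a single cell lies outside `Ω`, where the test function is zero.
    have hz : A h = 0 := by
      have := IsSimplex.integral_radial_eq_zero volume h.2.2 (hne h) hφ1 (fun y hy =>
        hφ.eq_zero (T.facet_disjoint hd hΩ h.1.2 h.2.2 (fun s' hs' hsub => ?_) y hy))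
      · rw [finrank_euclideanSpace_fin] at this
        simp only [A, this, mul_zero]
      -- A cell containing the facet has one further vertex, hence yields a half facet of the same
      -- fibre, which has only one element.
      · have hcard : (h.1.1.erase h.2.1).card < s'.card := by
          rw [Finset.card_erase_of_mem h.2.2, h.1.2.2, hs'.2]; omega
        obtain ⟨a', ha', hna'⟩ := Finset.exists_mem_notMem_of_card_lt_card hcard
        have hk : facet (⟨⟨s', hs'⟩, ⟨a', ha'⟩⟩ : T.HalfFacet) = F := by
          rw [← hF]
          symm
          refine Finset.eq_of_subset_of_card_le (fun b hb => Finset.mem_erase.2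
            ⟨fun hba => hna' (by have hba : b = a' := hba; exact hba ▸ hb), hsub hb⟩) ?_
          simp only [facet]
          rw [Finset.card_erase_of_mem ha', Finset.card_erase_of_mem h.2.2, h.1.2.2, hs'.2]
        have hm : (⟨⟨s', hs'⟩, ⟨a', ha'⟩⟩ : T.HalfFacet) ∈
            (Finset.univ.filter fun h : T.HalfFacet => facet h = F) := by simp [hk]
        rw [e, Finset.mem_singleton] at hm
        rw [← hm]
    change _ * A h = 0
    rw [hz, mul_zero]
  · rw [e, Finset.sum_pair hne']
    change ε h * g (facet h) * A h + ε h' * g (facet h') * A h' = 0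
    rw [hA h h' (hF.trans hF'.symm), e', hF, hF']
    ring

end Fiber

section Shape

variable {σ : ℝ} (hσ : T.ShapeRegular σ)
include hσ

/-- The gradient of a barycentric coordinate is bounded by `σ / diam`. -/
theorem bary_mul_diam_le (h : T.HalfFacet) (x y : Space d) :
    |bary h.1.1 h.2.1 x - bary h.1.1 h.2.1 y| * T.diam h.1 ≤ σ * ‖x - y‖ := by
  obtain ⟨c, r, hr, hball, hdiam⟩ := hσ h.1.1 h.1.2
  have key := (T.isSimplex h.1.2).bary_sub_le h.2.2 hr hball x y
  have hσ0 : 0 ≤ σ := by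
    have : 0 ≤ σ * (2 * r) := Metric.diam_nonneg.trans hdiam
    by_contra hneg
    nlinarith
  calc _ ≤ |bary h.1.1 h.2.1 x - bary h.1.1 h.2.1 y| * (σ * (2 * r)) :=
        mul_le_mul_of_nonneg_left hdiam (abs_nonneg _)
    _ = σ * (|bary h.1.1 h.2.1 x - bary h.1.1 h.2.1 y| * (2 * r)) := by ring
    _ ≤ _ := mul_le_mul_of_nonneg_left key hσ0

theorem diam_pos (hd : 1 ≤ d) (s : T.cells) : 0 < T.diam s := by
  have : Nonempty (Fin d) := ⟨⟨0, hd⟩⟩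
  obtain ⟨c, r, hr, hball, hdiam⟩ := hσ s.1 s.2
  have h1 : c + EuclideanSpace.single (⟨0, hd⟩ : Fin d) r ∈ Metric.closedBall c r := by
    simp [abs_of_pos hr]
  have h2 := dist_le_diam s (hball h1) (hball (Metric.mem_closedBall_self hr.le))
  simp [abs_of_pos hr] at h2
  linarith

/-- For `d ≥ 2` a facet contains an edge. Its length is at least `diam / σ` in one cell and at most
the diameter of the other. -/
theorem diam_le_mul_diam (hd : 2 ≤ d) {h h' : T.HalfFacet} (hf : facet h = facet h') :
    T.diam h.1 ≤ σ * T.diam h'.1 := by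
  have hcard : 1 < (facet h).card := by
    simp only [facet]
    rw [Finset.card_erase_of_mem h.2.2, h.1.2.2]; omega
  obtain ⟨b, hb, b', hb', hbb⟩ := Finset.one_lt_card.1 hcard
  have e1 := bary_mul_diam_le hσ ⟨h.1, ⟨b, facet_subset h hb⟩⟩ b b'
  simp only [(T.isSimplex h.1.2).bary_self (facet_subset h hb),
    (T.isSimplex h.1.2).bary_of_ne (facet_subset h hb) (facet_subset h hb') hbb, sub_zero,
    abs_one, one_mul] at e1
  have hσ0 : 0 ≤ σ := by
    by_contra hneg
    have := diam_pos hσ (by omega) h.1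
    have := norm_nonneg (b - b')
    nlinarith
  refine e1.trans (mul_le_mul_of_nonneg_left ?_ hσ0)
  rw [hf] at hb hb'
  exact dist_le_diam h'.1 (subset_convexHull ℝ _ (facet_subset h' hb))
    (subset_convexHull ℝ _ (facet_subset h' hb'))

theorem abs_bary_mul_diam_le (h : T.HalfFacet) {x y : Space d}
    (hy : y ∈ convexHull ℝ (facet h : Set (Space d))) :
    |bary h.1.1 h.2.1 x| * T.diam h.1 ≤ σ * ‖x - y‖ := by
  have := bary_mul_diam_le hσ h x y
  rwa [(T.isSimplex h.1.2).bary_eq_zero_of_mem_convexHull h.2.2 (facet_subset h)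
    (by simp [facet]) hy, sub_zero] at this

/-- The ratio of volumes is the absolute coordinate of the opposite vertex, at most `σ` times the
ratio of diameters; comparability of diameters supplies the other factor `σ`. -/
theorem vol_div_le (hd : 2 ≤ d) {h h' : T.HalfFacet} (hf : facet h = facet h') :
    T.vol h'.1 / T.diam h'.1 ^ 2 * T.diam h.1 ^ 2 ≤ σ ^ 2 * T.vol h.1 := by
  have hp := diam_pos hσ (by omega) h.1
  have hp' := diam_pos hσ (by omega) h'.1
  obtain ⟨b, hb⟩ := T.facet_nonempty (by omega) h.1.2 h.2.2
  have hb : b ∈ facet h := hb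
  have hσ0 : 0 ≤ σ := by
    have := diam_le_mul_diam hσ hd hf
    by_contra hneg
    nlinarith
  have e1 : T.vol h'.1 = |bary h.1.1 h.2.1 h'.2.1| * T.vol h.1 :=
    (T.isSimplex h.1.2).measureReal_eq volume (T.isSimplex h'.1.2) h.2.2 h'.2.2 hf
  have e2 := abs_bary_mul_diam_le hσ h (x := h'.2.1) (subset_convexHull ℝ _ hb)
  have e3 : ‖h'.2.1 - b‖ ≤ T.diam h'.1 := dist_le_diam h'.1 (subset_convexHull ℝ _ h'.2.2)
    (subset_convexHull ℝ _ (facet_subset h' (hf ▸ hb)))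
  have e4 : |bary h.1.1 h.2.1 h'.2.1| * T.diam h.1 ≤ σ * T.diam h'.1 :=
    e2.trans (mul_le_mul_of_nonneg_left e3 hσ0)
  have e5 := diam_le_mul_diam hσ hd hf
  rw [e1, div_mul_eq_mul_div, div_le_iff₀ (by positivity)]
  have hv := vol_pos h.1
  calc _ = T.vol h.1 * ((|bary h.1.1 h.2.1 h'.2.1| * T.diam h.1) * T.diam h.1) := by ring
    _ ≤ T.vol h.1 * ((σ * T.diam h'.1) * (σ * T.diam h'.1)) := by gcongr
    _ = _ := by ring

end Shape

end Mesh

/-! ### Raviart–Thomas fields from facet fluxes in dimension at least two -/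

theorem norm_sq_eq_integral {d : ℕ} {Ω : Set (Space d)} (f : L2 Ω) :
    ‖f‖ ^ 2 = ∫ x in Ω, f x ^ 2 := by
  rw [← real_inner_self_eq_norm_sq, ← pair_eq_inner, pair]
  simp only [sq]

theorem integrable_mul {d : ℕ} {Ω : Set (Space d)} {f g : Space d → ℝ}
    (hf : MemLp f 2 (volume.restrict Ω)) (hg : MemLp g 2 (volume.restrict Ω)) :
    IntegrableOn (fun x => f x * g x) Ω :=
  hf.integrable_mul hg

theorem sum_mul_partialDeriv {d : ℕ} (φ : Space d → ℝ) (x y : Space d) :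
    ∑ i, y i * partialDeriv i φ x = fderiv ℝ φ x y := by
  conv_rhs => rw [← (EuclideanSpace.basisFun (Fin d) ℝ).sum_repr y, map_sum]
  simp [partialDeriv]

namespace Mesh

variable {d : ℕ} {Ω : Set (Space d)} {T : Mesh Ω}

theorem ae_cell_of_ae (hΩr : interior (closure Ω) = Ω) (s : T.cells) {P : Space d → Prop}
    (h : ∀ᵐ x ∂(volume.restrict Ω), P x) :
    ∀ᵐ x ∂(volume.restrict (convexHull ℝ (s.1 : Set (Space d)))), P x := by
  refine ae_mono (Measure.restrict_mono_ae ?_) h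
  refine (Set.subset_iUnion (fun s : T.cells => convexHull ℝ (s.1 : Set (Space d)))
    s).eventuallyLE.trans (T.iUnion_ae_eq hΩr).le

theorem sum_cell_fiber (s : T.cells) (G : T.HalfFacet → ℝ) :
    ∑ h : T.HalfFacet with h.1 = s, G h = ∑ a : s.1, G ⟨s, a⟩ := by
  rw [Finset.sum_filter, Fintype.sum_sigma, Finset.sum_eq_single s]
  · simp
  · intro s' _ hne
    simp [hne]
  · simp

theorem card_cell_fiber (s : T.cells) :
    ((Finset.univ.filter fun h : T.HalfFacet => h.1 = s).card : ℝ) = d + 1 := by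
  have := sum_cell_fiber s (fun _ => 1)
  rw [Finset.sum_const, Finset.sum_const, nsmul_eq_mul, mul_one] at this
  rw [this]
  have h2 : s.1.card = d + 1 := s.2.2
  simp [h2]

variable (T) in
/-- The piecewise Raviart-Thomas field `∑ G_h (x - a_h)`, the sum over the half facets of a cell. -/
def fluxField (G : T.HalfFacet → ℝ) : L2Vec Ω :=
  WithLp.toLp 2 fun i => T.cellLp fun s =>
    (-(∑ a : s.1, G ⟨s, a⟩ * a.1 i), (∑ a : s.1, G ⟨s, a⟩) • EuclideanSpace.single i 1)

theorem fluxField_ae (G : T.HalfFacet → ℝ) : ∀ᵐ x ∂(volume.restrict Ω), ∀ s : T.cells,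
    x ∈ convexHull ℝ (s.1 : Set (Space d)) → ∀ i,
      T.fluxField G i x = -(∑ a : s.1, G ⟨s, a⟩ * a.1 i) + (∑ a : s.1, G ⟨s, a⟩) * x i := by
  have := ae_all_iff.2 fun i : Fin d => T.cellLp_ae fun s =>
    (-(∑ a : s.1, G ⟨s, a⟩ * a.1 i), (∑ a : s.1, G ⟨s, a⟩) • EuclideanSpace.single i 1)
  filter_upwards [this] with x hx s hs i
  have h2 := hx i s hs
  change T.cellLp _ x = _
  rw [h2, real_inner_smul_left, EuclideanSpace.inner_single_left]
  simp

theorem fluxField_ae' (G : T.HalfFacet → ℝ) : ∀ᵐ x ∂(volume.restrict Ω), ∀ s : T.cells,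
    x ∈ convexHull ℝ (s.1 : Set (Space d)) → ∀ i,
      T.fluxField G i x = (∑ a : s.1, G ⟨s, a⟩ • (x - a.1)) i := by
  filter_upwards [fluxField_ae G] with x hx s hs i
  rw [hx s hs i]
  simp only [WithLp.ofLp_sum, Finset.sum_apply, PiLp.smul_apply, PiLp.sub_apply, smul_eq_mul,
    mul_sub, Finset.sum_sub_distrib, Finset.sum_mul]
  ring

/-- On each cell `G (x - a)` has divergence `d G`, so the assumption on `G` is the defining identity
of the weak divergence, summed over cells. Continuity of normal components enters only in this
integrated form. -/
theorem hasWeakDiv_fluxField (hΩr : interior (closure Ω) = Ω) {G : T.HalfFacet → ℝ}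
    (hG : ∀ φ, IsTest Ω φ → ∑ h : T.HalfFacet, G h *
      ∫ x in convexHull ℝ (h.1.1 : Set (Space d)), (fderiv ℝ φ x (x - h.2.1) + d * φ x) = 0) :
    HasWeakDiv Ω (T.fluxField G) (T.cellLp fun s => (d * ∑ a : s.1, G ⟨s, a⟩, 0)) := by
  intro φ hφ
  rw [← add_eq_zero_iff_eq_neg]
  set v := T.fluxField G
  set q := T.cellLp fun s => (d * ∑ a : s.1, G ⟨s, a⟩, 0)
  have i1 : ∀ i, IntegrableOn (fun x => v i x * partialDeriv i φ x) Ω := fun i =>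
    integrable_mul (Lp.memLp (v i)) (hφ.partialDeriv i).memLp
  have i2 : IntegrableOn (fun x => q x * φ x) Ω := integrable_mul (Lp.memLp q) hφ.memLp
  have i3 : IntegrableOn (fun x => ∑ i, v i x * partialDeriv i φ x) Ω :=
    integrable_finsetSum _ fun i _ => i1 i
  simp only [pair]
  have i5 : IntegrableOn (fun x => ∑ i, v i x * partialDeriv i φ x + q x * φ x) Ω := i3.add i2
  rw [← integral_finsetSum _ fun i _ => i1 i, ← integral_add i3 i2,
    T.integral_eq_sum hΩr i5, ← hG φ hφ, Fintype.sum_sigma]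
  refine Finset.sum_congr rfl fun s _ => ?_
  have hφc := hφ.1.continuous
  have hfc : Continuous (fderiv ℝ φ) := hφ.1.continuous_fderiv (by simp)
  have i4 : ∀ a : s.1, IntegrableOn (fun x => G ⟨s, a⟩ * (fderiv ℝ φ x (x - a.1) + d * φ x))
      (convexHull ℝ (s.1 : Set (Space d))) := fun a => by
    refine ContinuousOn.integrableOn_compact (IsSimplex.isCompact_convexHull _) ?_
    have : Continuous fun x => fderiv ℝ φ x (x - a.1) := hfc.clm_apply (by fun_prop)
    fun_prop
  simp only [← integral_const_mul]
  rw [← integral_finsetSum _ fun a _ => i4 a]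
  refine integral_congr_ae ?_
  filter_upwards [ae_cell_of_ae hΩr s (fluxField_ae' G), ae_cell_of_ae hΩr s (T.cellLp_ae _),
    ae_restrict_mem (IsSimplex.measurableSet_convexHull s.1)] with x h1 h2 hx
  rw [h2 s hx]
  simp only [v, h1 s hx]
  rw [sum_mul_partialDeriv, map_sum, inner_zero_left, add_zero, Finset.mul_sum, Finset.sum_mul,
    ← Finset.sum_add_distrib]
  refine Finset.sum_congr rfl fun a _ => ?_
  rw [map_smul, smul_eq_mul]
  ring

theorem fluxField_mem_V {G : T.HalfFacet → ℝ} (h : T.fluxField G ∈ Hdiv Ω) :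
    T.fluxField G ∈ T.V := by
  refine ⟨h, fun s hs => ⟨WithLp.toLp 2 fun i => -(∑ a : s, G ⟨⟨s, hs⟩, a⟩ * a.1 i),
    ∑ a : s, G ⟨⟨s, hs⟩, a⟩, ?_⟩⟩
  filter_upwards [fluxField_ae G] with x hx hxs i
  exact hx ⟨s, hs⟩ hxs i

/-- Each `|x - a|` is at most the diameter, and Cauchy–Schwarz over the vertices of a cell costs the
factor `d + 1`. -/
theorem norm_fluxField_sq_le (hΩr : interior (closure Ω) = Ω) (G : T.HalfFacet → ℝ) :
    ‖T.fluxField G‖ ^ 2 ≤ (d + 1) * ∑ h : T.HalfFacet, T.vol h.1 * T.diam h.1 ^ 2 * G h ^ 2 := by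
  have hi : ∀ i, IntegrableOn (fun x => T.fluxField G i x ^ 2) Ω := fun i =>
    (Lp.memLp (T.fluxField G i)).integrable_sq
  rw [PiLp.norm_sq_eq_of_L2]
  simp only [norm_sq_eq_integral]
  rw [← integral_finsetSum _ fun i _ => hi i,
    T.integral_eq_sum hΩr (integrable_finsetSum _ fun i _ => hi i), Fintype.sum_sigma,
    Finset.mul_sum]
  refine Finset.sum_le_sum fun s _ => ?_
  set B := (d + 1) * ∑ a : s.1, T.diam s ^ 2 * G ⟨s, a⟩ ^ 2
  have hb : ∀ᵐ x ∂(volume.restrict (convexHull ℝ (s.1 : Set (Space d)))),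
      ‖∑ i, T.fluxField G i x ^ 2‖ ≤ B := by
    filter_upwards [ae_cell_of_ae hΩr s (fluxField_ae' G),
      ae_restrict_mem (IsSimplex.measurableSet_convexHull s.1)] with x h1 hx
    simp only [h1 s hx]
    have e1 : ∑ i, (∑ a : s.1, G ⟨s, a⟩ • (x - a.1)) i ^ 2
        = ‖∑ a : s.1, G ⟨s, a⟩ • (x - a.1)‖ ^ 2 := by
      rw [EuclideanSpace.norm_sq_eq]; simp
    rw [e1, Real.norm_eq_abs, abs_of_nonneg (sq_nonneg _)]
    have e2 : ‖∑ a : s.1, G ⟨s, a⟩ • (x - a.1)‖ ≤ ∑ a : s.1, T.diam s * |G ⟨s, a⟩| := by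
      refine (norm_sum_le _ _).trans (Finset.sum_le_sum fun a _ => ?_)
      rw [norm_smul, Real.norm_eq_abs, mul_comm]
      exact mul_le_mul_of_nonneg_right (dist_le_diam s hx (subset_convexHull ℝ _ a.2))
        (abs_nonneg _)
    refine (pow_le_pow_left₀ (norm_nonneg _) e2 2).trans ?_
    refine (sq_sum_le_card_mul_sum_sq).trans ?_
    have h2 : s.1.card = d + 1 := s.2.2
    simp only [mul_pow, sq_abs, B]
    simp [h2]
  have hfin : volume (convexHull ℝ (s.1 : Set (Space d))) < ⊤ :=
    (IsSimplex.isCompact_convexHull s.1).measure_lt_top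
  have hle := norm_setIntegral_le_of_norm_le_const_ae' hfin
    ((ae_restrict_iff' (IsSimplex.measurableSet_convexHull s.1)).1 hb)
  rw [Real.norm_eq_abs] at hle
  refine (le_abs_self _).trans (hle.trans (le_of_eq ?_))
  · simp only [B]
    rw [mul_assoc, Finset.sum_mul]
    congr 1
    refine Finset.sum_congr rfl fun a _ => ?_
    simp only [vol]
    ring

theorem norm_cellLp_const_sq (hΩr : interior (closure Ω) = Ω) (c : T.cells → ℝ) :
    ‖T.cellLp fun s => (c s, 0)‖ ^ 2 = ∑ s, T.vol s * c s ^ 2 := by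
  rw [norm_sq_eq_integral, T.integral_eq_sum hΩr ((Lp.memLp _).integrable_sq)]
  refine Finset.sum_congr rfl fun s _ => ?_
  have : ∀ᵐ x ∂(volume.restrict (convexHull ℝ (s.1 : Set (Space d)))),
      (T.cellLp fun s => (c s, 0)) x ^ 2 = c s ^ 2 := by
    filter_upwards [ae_cell_of_ae hΩr s (T.cellLp_ae fun s => (c s, 0)),
      ae_restrict_mem (IsSimplex.measurableSet_convexHull s.1)] with x h1 hx
    rw [h1 s hx]
    simp
  rw [integral_congr_ae this]
  simp [vol]

theorem eq_cellLp_of_mem_W (hΩr : interior (closure Ω) = Ω) {w : L2 Ω} (hw : w ∈ T.W) :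
    ∃ c : T.cells → ℝ, w = T.cellLp fun s => (c s, 0) := by
  choose c hc using fun s : T.cells => hw s.1 s.2
  refine ⟨c, Lp.ext (T.ae_eq_of_cells hΩr fun s => ?_)⟩
  filter_upwards [hc s, T.cellLp_ae fun s => (c s, 0)] with x h1 h2 hs
  rw [h1 hs, h2 s hs]
  simp

/-- The fluxes of the two-point flux approximation on a shape regular mesh. -/
theorem exists_discrete_flux (hd : 2 ≤ d) {R : ℝ}
    (hR : ∀ x ∈ closure Ω, ‖x‖ ≤ R) {σ : ℝ} (hσ : T.ShapeRegular σ) (w : T.cells → ℝ) :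
    ∃ (ε : T.HalfFacet → ℝ) (c J : Finset (Space d) → ℝ), (∀ h, ε h = 1 ∨ ε h = -1) ∧
      (∀ h h', h ≠ h' → facet h = facet h' → ε h' = - ε h) ∧ (∀ h : T.HalfFacet, 0 < c (facet h)) ∧
      (∀ h : T.HalfFacet, c (facet h) * T.diam h.1 ^ 2 ≤ 2 * σ ^ 2 * T.vol h.1) ∧
      (∀ s, ∑ a : s.1, ε ⟨s, a⟩ * (c (facet (T := T) ⟨s, a⟩) * J (facet (T := T) ⟨s, a⟩))
        = T.vol s * w s) ∧
      ∑ h : T.HalfFacet, c (facet h) * J (facet h) ^ 2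
        ≤ 4 * (σ ^ 2 * R ^ 2 * (d + 1)) * ∑ s, T.vol s * w s ^ 2 := by
  have hd1 : 1 ≤ d := by omega
  obtain ⟨ε, f, hε1, hε2, hf⟩ := T.exists_orientation hd1
  set κ : T.HalfFacet → ℝ := fun h => T.vol h.1 / T.diam h.1 ^ 2
  have hκ : ∀ h, 0 < κ h := fun h =>
    div_pos (vol_pos _) (pow_pos (diam_pos hσ hd1 _) 2)
  -- The weight of a facet is the sum of `vol / diam²` over its cells. It dominates each summand, as
  -- the Poincaré inequality requires, and is at most `2 σ² vol / diam²` in either cell, as the norm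
  -- bound requires.
  set c : Finset (Space d) → ℝ := fun F => ∑ h : T.HalfFacet with facet h = F, κ h
  have hκc : ∀ h, κ h ≤ c (facet h) := fun h =>
    Finset.single_le_sum (f := κ) (fun h _ => (hκ h).le) (by simp)
  have hεsq : ∀ h, ε h ^ 2 = 1 := fun h => by rcases hε1 h with e | e <;> simp [e]
  -- The barycentric coordinates of the origin sum to one.
  have hsum : ∀ s, ∑ h : T.HalfFacet with h.1 = s, ε h * f (facet h) = T.vol s := fun s => by
    rw [sum_cell_fiber]
    simp only [← hf]
    rw [← Finset.mul_sum, Finset.sum_coe_sort s.1 (fun a => bary s.1 a 0),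
      (T.isSimplex s.2).sum_bary, mul_one]
  have hfl : ∀ h : T.HalfFacet,
      f (facet h) ^ 2 ≤ σ ^ 2 * R ^ 2 * (c (facet h) * T.vol h.1) := fun h => by
    obtain ⟨b, hb⟩ := T.facet_nonempty hd1 h.1.2 h.2.2
    have hb : b ∈ facet h := hb
    have e1 := abs_bary_mul_diam_le hσ h (x := 0) (subset_convexHull ℝ _ hb)
    have e2 : ‖0 - b‖ ≤ R := by
      rw [zero_sub, norm_neg]
      exact hR b (T.subset_closure_of_mem h.1.2 (subset_convexHull ℝ _ (facet_subset h hb)))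
    have hp := diam_pos hσ hd1 h.1
    have hσ0 : 0 ≤ σ := by
      have := diam_le_mul_diam hσ hd (rfl : facet h = facet h)
      by_contra hneg
      nlinarith
    have e3 : f (facet h) ^ 2 = T.vol h.1 ^ 2 * bary h.1.1 h.2.1 0 ^ 2 := by
      have := congrArg (fun z => z ^ 2) (hf h)
      simp only [mul_pow, hεsq, one_mul] at this
      exact this.symm
    have e4 : (|bary h.1.1 h.2.1 0| * T.diam h.1) ^ 2 ≤ (σ * R) ^ 2 :=
      pow_le_pow_left₀ (by positivity) (e1.trans (mul_le_mul_of_nonneg_left e2 hσ0)) 2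
    rw [mul_pow, sq_abs, mul_pow] at e4
    have e5 : bary h.1.1 h.2.1 0 ^ 2 ≤ σ ^ 2 * R ^ 2 / T.diam h.1 ^ 2 :=
      (le_div_iff₀ (by positivity)).2 e4
    have hv := vol_pos h.1
    have e6 := hκc h
    calc f (facet h) ^ 2 = T.vol h.1 ^ 2 * bary h.1.1 h.2.1 0 ^ 2 := e3
      _ ≤ T.vol h.1 ^ 2 * (σ ^ 2 * R ^ 2 / T.diam h.1 ^ 2) := by gcongr
      _ = σ ^ 2 * R ^ 2 * (κ h * T.vol h.1) := by simp only [κ]; ring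
      _ ≤ _ := by gcongr
  obtain ⟨J, hJ1, hJ2⟩ := exists_twoPointFlux (cell := fun h : T.HalfFacet => h.1) (fac := facet)
    (ε := ε) (vol := T.vol) (f := f) (c := c) (M := σ ^ 2 * R ^ 2) (N := d + 1) vol_pos
    (by positivity) (by positivity) (fun h => (hκ h).trans_le (hκc h)) hsum
    (abs_sum_fiber_sq_le hε1 hε2) hfl
    (card_fiber_le hε1 hε2) (fun s => (card_cell_fiber s).le) w
  refine ⟨ε, c, J, hε1, hε2, fun h => (hκ h).trans_le (hκc h), fun h => ?_, fun s => ?_, hJ2⟩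
  · simp only [c]
    rw [Finset.sum_mul]
    refine (Finset.sum_le_card_nsmul _ _ (σ ^ 2 * T.vol h.1) fun h' hh' => ?_).trans ?_
    · exact vol_div_le hσ hd (Finset.mem_filter.1 hh').2.symm
    · rw [nsmul_eq_mul]
      have hv := vol_pos h.1
      have := mul_le_mul_of_nonneg_right (card_fiber_le hε1 hε2 (facet h))
        (by positivity : 0 ≤ σ ^ 2 * T.vol h.1)
      linarith
  · rw [← hJ1 s, sum_cell_fiber]

/-- Uniform discrete inf-sup stability of the lowest order Raviart-Thomas pair on shape regular
meshes in dimension at least two. -/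
theorem divStable_of_two_le (hd : 2 ≤ d) (hΩ : IsOpen Ω) (hΩr : interior (closure Ω) = Ω)
    [IsFiniteMeasure (volume.restrict Ω)] {R : ℝ} (hR0 : 0 ≤ R) (hR : ∀ x ∈ closure Ω, ‖x‖ ≤ R)
    {σ : ℝ} (hσ : T.ShapeRegular σ) : T.DivStable (4 * (d + 1) * σ ^ 2 * R) := by
  intro w hw
  obtain ⟨w', rfl⟩ := eq_cellLp_of_mem_W hΩr hw
  have hd1 : 1 ≤ d := by omega
  have hd0 : (0 : ℝ) < d := by exact_mod_cast hd1
  obtain ⟨ε, c, J, hε1, hε2, hc0, hc, hJ1, hJ2⟩ := exists_discrete_flux hd hR hσ w'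
  have hεsq : ∀ h, ε h ^ 2 = 1 := fun h => by rcases hε1 h with e | e <;> simp [e]
  -- The field `(x - a) / (d vol)` has unit flux through the facet opposite to `a` and is tangential
  -- to the other facets; it is multiplied by the signed flux `ε c J`.
  set G : T.HalfFacet → ℝ :=
    fun h => ε h * (c (facet h) * J (facet h)) * ((d : ℝ) * T.vol h.1)⁻¹ with hGdef
  have hdiv : HasWeakDiv Ω (T.fluxField G) (T.cellLp fun s => (w' s, 0)) := by
    have h1 := hasWeakDiv_fluxField (T := T) hΩr (G := G) fun φ hφ => by
      have := sum_flux_eq_zero hε1 hε2 hd1 hΩ (fun F => (d : ℝ)⁻¹ * (c F * J F)) hφ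
      rw [← this]
      refine Finset.sum_congr rfl fun h _ => ?_
      simp only [hGdef, mul_inv]
      ring
    have h2 : (fun s : T.cells => ((d : ℝ) * ∑ a : s.1, G ⟨s, a⟩, (0 : Space d)))
        = fun s => (w' s, 0) := by
      ext1 s
      have hv := vol_pos s
      simp only [hGdef]
      rw [← Finset.sum_mul, hJ1 s]
      congr 1
      field_simp
    rwa [h2] at h1
  refine ⟨T.fluxField G, fluxField_mem_V ⟨_, hdiv⟩, hdiv.weakDiv_eq hΩ, ?_⟩
  refine le_of_sq_le_sq ?_ (by positivity)
  set EH := ∑ h : T.HalfFacet, c (facet h) * J (facet h) ^ 2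
  have hle : ∑ h : T.HalfFacet, T.vol h.1 * T.diam h.1 ^ 2 * G h ^ 2 ≤ 2 * σ ^ 2 * EH := by
    simp only [EH]
    rw [Finset.mul_sum]
    refine Finset.sum_le_sum fun h _ => ?_
    have hv := vol_pos h.1
    have hd2 : (1 : ℝ) ≤ (d : ℝ) ^ 2 := one_le_pow₀ (by exact_mod_cast hd1)
    have e1 : T.vol h.1 * T.diam h.1 ^ 2 * G h ^ 2
        = (c (facet h) * T.diam h.1 ^ 2) * (c (facet h) * J (facet h) ^ 2)
          / ((d : ℝ) ^ 2 * T.vol h.1) := by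
      simp only [hGdef, mul_pow, hεsq, inv_pow]
      field_simp
    rw [e1, div_le_iff₀ (by positivity)]
    have h0 : 0 ≤ c (facet h) * J (facet h) ^ 2 := mul_nonneg (hc0 h).le (sq_nonneg _)
    calc _ ≤ (2 * σ ^ 2 * T.vol h.1) * (c (facet h) * J (facet h) ^ 2) :=
          mul_le_mul_of_nonneg_right (hc h) h0
      _ = 2 * σ ^ 2 * (c (facet h) * J (facet h) ^ 2) * (1 * T.vol h.1) := by ring
      _ ≤ _ := by gcongr
  rw [mul_pow _ ‖_‖]
  have hn := (norm_fluxField_sq_le hΩr G).trans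
    (mul_le_mul_of_nonneg_left hle (by positivity : (0 : ℝ) ≤ d + 1))
  rw [← norm_cellLp_const_sq hΩr] at hJ2
  set W := ‖T.cellLp fun s => (w' s, 0)‖ ^ 2
  have hW0 : 0 ≤ W := sq_nonneg _
  have hn2 := mul_le_mul_of_nonneg_left hJ2 (by positivity : (0 : ℝ) ≤ (d + 1) * (2 * σ ^ 2))
  -- The estimates give the factor `8 (d + 1)² σ⁴ R²`, half the square of the stated constant; this
  -- term is the slack.
  have h3 : 0 ≤ (d + 1 : ℝ) ^ 2 * σ ^ 4 * R ^ 2 * W := by positivity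
  linarith

end Mesh

/-! ### Divergence stability in dimension one -/

section Line

/-- The identification of `ℝ` with `ℝ¹`. -/
def lineEquiv : ℝ ≃ᵐ Space 1 :=
  (MeasurableEquiv.funUnique (Fin 1) ℝ).symm.trans (MeasurableEquiv.toLp 2 (Fin 1 → ℝ))

theorem lineEquiv_apply (t : ℝ) (i : Fin 1) : lineEquiv t i = t := by
  simp [lineEquiv, MeasurableEquiv.funUnique]

theorem lineEquiv_coord (x : Space 1) : lineEquiv (x 0) = x := by
  ext i
  rw [lineEquiv_apply, Subsingleton.elim i 0]

theorem lineEquiv_eq_smul (t : ℝ) : lineEquiv t = t • EuclideanSpace.single (0 : Fin 1) (1 : ℝ) := by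
  ext i
  rw [lineEquiv_apply, Subsingleton.elim i 0]
  simp

theorem measurePreserving_lineEquiv : MeasurePreserving lineEquiv volume volume :=
  (volume_preserving_funUnique (Fin 1) ℝ).symm.trans (PiLp.volume_preserving_toLp (Fin 1))

theorem integral_halfLine_partialDeriv {φ : Space 1 → ℝ} (hφ : ContDiff ℝ ∞ φ)
    (hc : HasCompactSupport φ) (y : Space 1) :
    ∫ x in {x : Space 1 | y 0 < x 0}, partialDeriv 0 φ x = - φ y := by
  have hcont : Continuous lineEquiv := by
    have : (lineEquiv : ℝ → Space 1) = fun t => t • EuclideanSpace.single (0 : Fin 1) (1 : ℝ) :=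
      funext lineEquiv_eq_smul
    rw [this]; fun_prop
  have hder : ∀ t, HasDerivAt (fun t => φ (lineEquiv t)) (partialDeriv 0 φ (lineEquiv t)) t := by
    intro t
    have e1 : HasDerivAt lineEquiv (EuclideanSpace.single (0 : Fin 1) (1 : ℝ)) t := by
      have := (hasDerivAt_id t).smul_const (EuclideanSpace.single (0 : Fin 1) (1 : ℝ))
      rw [one_smul] at this
      exact this.congr_of_eventuallyEq (Eventually.of_forall lineEquiv_eq_smul)
    exact (hφ.differentiable (by simp) (lineEquiv t)).hasFDerivAt.comp_hasDerivAt t e1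
  have hsm : ContDiff ℝ 1 fun t => φ (lineEquiv t) := by
    have : (fun t => φ (lineEquiv t))
        = fun t : ℝ => φ (t • EuclideanSpace.single (0 : Fin 1) (1 : ℝ)) := by
      ext t; rw [lineEquiv_eq_smul]
    rw [this]
    exact (hφ.of_le (by simp)).comp (by fun_prop)
  have hcs : HasCompactSupport fun t => φ (lineEquiv t) := by
    refine HasCompactSupport.intro (K := (fun x : Space 1 => x 0) '' tsupport φ)
      (hc.isCompact.image (by fun_prop)) fun t ht => ?_
    by_contra hne
    exact ht ⟨lineEquiv t, subset_tsupport _ hne, lineEquiv_apply t 0⟩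
  have h1 := hcs.integral_Ioi_deriv_eq hsm (y 0)
  rw [lineEquiv_coord] at h1
  rw [← h1, ← measurePreserving_lineEquiv.setIntegral_preimage_emb lineEquiv.measurableEmbedding]
  have : lineEquiv ⁻¹' {x : Space 1 | y 0 < x 0} = Set.Ioi (y 0) := by
    ext t
    simp [lineEquiv_apply]
  rw [this]
  refine integral_congr_ae (Eventually.of_forall fun t => ?_)
  exact ((hder t).deriv).symm

theorem measurableSet_lt_coord (c : ℝ) : MeasurableSet {y : Space 1 | y 0 < c} :=
  measurableSet_lt (by fun_prop) measurable_const

theorem measurableSet_strip (a b : ℝ) : MeasurableSet {y : Space 1 | a ≤ y 0 ∧ y 0 < b} := by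
  have h : MeasurableSet {y : Space 1 | a ≤ y 0} := measurableSet_le measurable_const (by fun_prop)
  have : {y : Space 1 | a ≤ y 0 ∧ y 0 < b} = {y : Space 1 | a ≤ y 0} ∩ {y : Space 1 | y 0 < b} := by
    ext y; simp
  rw [this]
  exact h.inter (measurableSet_lt_coord b)

theorem volume_strip {a b : ℝ} (hab : a ≤ b) :
    volume.real {x : Space 1 | a ≤ x 0 ∧ x 0 < b} = b - a := by
  have h := measurePreserving_lineEquiv.measureReal_preimage
    (s := {x : Space 1 | a ≤ x 0 ∧ x 0 < b})
    (measurableSet_strip a b).nullMeasurableSet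
  rw [← h]
  have : lineEquiv ⁻¹' {x : Space 1 | a ≤ x 0 ∧ x 0 < b} = Set.Ico a b := by
    ext t
    simp [lineEquiv_apply]
  rw [this, Real.volume_real_Ico_of_le hab]

theorem mem_of_between {K : Set (Space 1)} (hK : Convex ℝ K) {x y z : Space 1} (hx : x ∈ K)
    (hz : z ∈ K) (h1 : x 0 ≤ y 0) (h2 : y 0 ≤ z 0) : y ∈ K := by
  have hc : Convex ℝ ((fun t : ℝ => t • EuclideanSpace.single (0 : Fin 1) (1 : ℝ)) ⁻¹' K) :=
    hK.linear_preimage (LinearMap.toSpanSingleton ℝ (Space 1) _)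
  have key : ∀ u : Space 1, u ∈ K ↔
      u 0 ∈ (fun t : ℝ => t • EuclideanSpace.single (0 : Fin 1) (1 : ℝ)) ⁻¹' K := fun u => by
    rw [Set.mem_preimage, ← lineEquiv_eq_smul, lineEquiv_coord]
  rw [key] at *
  exact hc.ordConnected.out hx hz ⟨h1, h2⟩

variable {Ω : Set (Space 1)} [IsFiniteMeasure (volume.restrict Ω)]

/-- The primitive of `w` on the line, vanishing at `-∞`. -/
def primitive (w : L2 Ω) (x : Space 1) : ℝ := ∫ y in Ω, {y : Space 1 | y 0 < x 0}.indicator w y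

theorem abs_primitive_le (w : L2 Ω) (x : Space 1) :
    primitive w x ^ 2 ≤ volume.real Ω * ‖w‖ ^ 2 := by
  have hw : IntegrableOn w Ω := (Lp.memLp w).integrable (by norm_num)
  have h1 : |primitive w x| ≤ ∫ y in Ω, |w y| := by
    refine (abs_integral_le_integral_abs).trans (integral_mono_of_nonneg ?_ hw.abs ?_)
    · exact Eventually.of_forall fun _ => abs_nonneg _
    · refine Eventually.of_forall fun y => ?_
      simp only [Set.indicator]
      split_ifs
      · exact le_rfl
      · simp
  have hone : MemLp (fun _ : Space 1 => (1 : ℝ)) 2 (volume.restrict Ω) := memLp_const 1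
  set one : L2 Ω := hone.toLp
  have h2 : ∫ y in Ω, |w y| ≤ ‖w‖ * ‖one‖ := by
    have e1 : ∫ y in Ω, |w y| = pair Ω (|w| : L2 Ω) (fun _ => 1) := by
      refine integral_congr_ae ?_
      filter_upwards [Lp.coeFn_abs w] with y hy
      rw [hy, mul_one]
    rw [e1, pair_toLp _ hone, ← norm_abs_eq_norm w]
    exact real_inner_le_norm _ _
  have h3 : ‖one‖ ^ 2 = volume.real Ω := by
    rw [norm_sq_eq_integral]
    have : ∫ x in Ω, one x ^ 2 = ∫ _x in Ω, (1 : ℝ) := by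
      refine integral_congr_ae ?_
      filter_upwards [hone.coeFn_toLp] with y hy
      rw [hy, one_pow]
    rw [this]
    simp
  rw [← sq_abs, ← h3, mul_comm, ← mul_pow]
  exact pow_le_pow_left₀ (abs_nonneg _) (h1.trans h2) 2

/-- Fubini: after exchanging the integrals, `∂φ` is integrated over a half-line and gives `-φ`. -/
theorem integral_primitive_mul (w : L2 Ω) {φ : Space 1 → ℝ} (hφ : IsTest Ω φ) :
    ∫ x in Ω, primitive w x * partialDeriv 0 φ x = - ∫ y in Ω, w y * φ y := by
  have hw : IntegrableOn w Ω := (Lp.memLp w).integrable (by norm_num)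
  have hφ' : IntegrableOn (partialDeriv 0 φ) Ω :=
    ((hφ.partialDeriv 0).memLp).integrable (by norm_num)
  have hS : MeasurableSet {z : Space 1 × Space 1 | z.2 0 < z.1 0} :=
    measurableSet_lt (by fun_prop) (by fun_prop)
  have hint : Integrable (Function.uncurry fun x y : Space 1 =>
      {y : Space 1 | y 0 < x 0}.indicator w y * partialDeriv 0 φ x)
      ((volume.restrict Ω).prod (volume.restrict Ω)) := by
    refine ((hφ'.mul_prod hw).indicator hS).congr (Eventually.of_forall fun z => ?_)
    simp only [Function.uncurry, Set.indicator, Set.mem_ofPred_eq]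
    split_ifs
    · ring
    · ring
  have e1 : ∫ x in Ω, primitive w x * partialDeriv 0 φ x
      = ∫ x in Ω, ∫ y in Ω, {y : Space 1 | y 0 < x 0}.indicator w y * partialDeriv 0 φ x := by
    simp only [integral_mul_const, primitive]
  rw [e1, integral_integral_swap hint, ← integral_neg]
  refine integral_congr_ae (Eventually.of_forall fun y => ?_)
  have hzero : ∀ x ∉ Ω, partialDeriv 0 φ x = 0 := fun x hx => (hφ.partialDeriv 0).eq_zero hx
  have e2 : ∀ x : Space 1, {y : Space 1 | y 0 < x 0}.indicator w y * partialDeriv 0 φ x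
      = w y * {x : Space 1 | y 0 < x 0}.indicator (partialDeriv 0 φ) x := fun x => by
    simp only [Set.indicator, Set.mem_ofPred_eq]
    split_ifs <;> simp
  simp only [e2]
  rw [integral_const_mul, setIntegral_eq_integral_of_forall_compl_eq_zero, integral_indicator,
    integral_halfLine_partialDeriv hφ.1 hφ.2.1]
  · ring
  · exact measurableSet_lt measurable_const (by fun_prop)
  · intro x hx
    simp [Set.indicator, hzero x hx]

theorem primitive_sub (w : L2 Ω) {x z : Space 1} (hxz : x 0 ≤ z 0) :
    primitive w z - primitive w x = ∫ y in Ω, {y : Space 1 | x 0 ≤ y 0 ∧ y 0 < z 0}.indicator w y := by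
  have hw : IntegrableOn w Ω := (Lp.memLp w).integrable (by norm_num)
  rw [primitive, primitive, ← integral_sub (hw.indicator (measurableSet_lt_coord _))
    (hw.indicator (measurableSet_lt_coord _))]
  refine integral_congr_ae (Eventually.of_forall fun y => ?_)
  simp only [Set.indicator, Set.mem_ofPred_eq]
  by_cases h1 : y 0 < x 0
  · simp [h1, h1.trans_le hxz, not_le.2 h1]
  · simp [h1, not_lt.1 h1]

namespace Mesh

variable {T : Mesh Ω}

/-- A cell is convex, so the strip between two of its points lies in it and `w` equals `c` there.
Thus the primitive of an element of `W_h` is affine on cells and belongs to `V_h`. -/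
theorem primitive_sub_of_mem (hΩr : interior (closure Ω) = Ω) (w : L2 Ω) (s : T.cells) {c : ℝ}
    (hc : ∀ᵐ x ∂(volume.restrict Ω), x ∈ convexHull ℝ (s.1 : Set (Space 1)) → w x = c)
    {x z : Space 1} (hx : x ∈ convexHull ℝ (s.1 : Set (Space 1)))
    (hz : z ∈ convexHull ℝ (s.1 : Set (Space 1))) (hxz : x 0 ≤ z 0) :
    primitive w z - primitive w x = c * (z 0 - x 0) := by
  set S := {y : Space 1 | x 0 ≤ y 0 ∧ y 0 < z 0}
  have hS : MeasurableSet S := measurableSet_strip _ _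
  have hSK : S ⊆ convexHull ℝ (s.1 : Set (Space 1)) := fun y hy =>
    mem_of_between (convex_convexHull ℝ _) hx hz hy.1 hy.2.le
  rw [primitive_sub w hxz]
  have e1 : ∫ y in Ω, S.indicator w y = ∫ y in Ω, S.indicator (fun _ => c) y := by
    refine integral_congr_ae ?_
    filter_upwards [hc] with y hy
    by_cases h : y ∈ S
    · simp only [Set.indicator_of_mem h, hy (hSK h)]
    · simp only [Set.indicator_of_notMem h]
  rw [e1, integral_indicator_const _ hS, smul_eq_mul, mul_comm]
  congr 1
  rw [← volume_strip hxz, measureReal_restrict_apply hS]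
  refine measureReal_congr ?_
  have h1 : S ≤ᵐ[volume] Ω := (hSK.trans (Set.subset_iUnion
    (fun s : T.cells => convexHull ℝ (s.1 : Set (Space 1))) s)).eventuallyLE.trans
      (T.iUnion_ae_eq hΩr).le
  exact (Set.inter_subset_left.eventuallyLE).antisymm (h1.mono fun y hy hyS => ⟨hyS, hy hyS⟩)

/-- Discrete inf-sup stability on an interval. -/
theorem divStable_one (hΩ : IsOpen Ω) (hΩr : interior (closure Ω) = Ω) :
    T.DivStable (volume.real Ω) := by
  intro w hw
  choose c hc using fun s : T.cells => hw s.1 s.2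
  have hne : ∀ s : T.cells, s.1.Nonempty := fun s => by
    rw [← Finset.card_pos, s.2.2]; omega
  choose x0 hx0 using hne
  have hx0 : ∀ s : T.cells, x0 s ∈ convexHull ℝ (s.1 : Set (Space 1)) :=
    fun s => subset_convexHull ℝ _ (hx0 s)
  have haff : ∀ s : T.cells, ∀ x ∈ convexHull ℝ (s.1 : Set (Space 1)),
      primitive w x = (primitive w (x0 s) - c s * x0 s 0) + c s * x 0 := by
    intro s x hx
    rcases le_total (x0 s 0) (x 0) with h | h
    · have := primitive_sub_of_mem hΩr w s (hc s) (hx0 s) hx h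
      linarith
    · have := primitive_sub_of_mem hΩr w s (hc s) hx (hx0 s) h
      linarith
  set θ : T.cells → ℝ × Space 1 := fun s =>
    (primitive w (x0 s) - c s * x0 s 0, c s • EuclideanSpace.single 0 1)
  have hθ : ∀ᵐ x ∂(volume.restrict Ω), ∀ s : T.cells,
      x ∈ convexHull ℝ (s.1 : Set (Space 1)) →
        T.cellLp θ x = (primitive w (x0 s) - c s * x0 s 0) + c s * x 0 := by
    filter_upwards [T.cellLp_ae θ] with x hx s hs
    rw [hx s hs]
    simp [θ, real_inner_smul_left, EuclideanSpace.inner_single_left]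
  have hp : T.cellLp θ =ᵐ[volume.restrict Ω] primitive w := by
    refine T.ae_eq_of_cells hΩr fun s => ?_
    filter_upwards [hθ] with x hx hxs
    rw [hx s hxs, haff s x hxs]
  set v : L2Vec Ω := WithLp.toLp 2 fun _ => T.cellLp θ
  have hdiv : HasWeakDiv Ω v w := by
    intro φ hφ
    rw [Fin.sum_univ_one, pair, pair, ← integral_primitive_mul w hφ]
    refine integral_congr_ae ?_
    filter_upwards [hp] with x hx
    change T.cellLp θ x * _ = _
    rw [hx]
  refine ⟨v, ⟨⟨w, hdiv⟩, fun s hs => ?_⟩, hdiv.weakDiv_eq hΩ, ?_⟩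
  · refine ⟨WithLp.toLp 2 fun _ => primitive w (x0 ⟨s, hs⟩) - c ⟨s, hs⟩ * x0 ⟨s, hs⟩ 0,
      c ⟨s, hs⟩, ?_⟩
    filter_upwards [hθ] with x hx hxs i
    rw [Subsingleton.elim i 0]
    exact hx ⟨s, hs⟩ hxs
  · refine le_of_sq_le_sq ?_ (by positivity)
    rw [PiLp.norm_sq_eq_of_L2, Fin.sum_univ_one]
    change ‖T.cellLp θ‖ ^ 2 ≤ _
    rw [norm_sq_eq_integral]
    -- Integrating the uniform bound of the primitive over `Ω` brings a second factor `volume.real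
    -- Ω`, whence the constant.
    have hb : ∀ᵐ x ∂(volume.restrict Ω), ‖T.cellLp θ x ^ 2‖ ≤ volume.real Ω * ‖w‖ ^ 2 := by
      filter_upwards [hp] with x hx
      rw [hx, Real.norm_eq_abs, abs_of_nonneg (sq_nonneg _)]
      exact abs_primitive_le w x
    have h1 := norm_integral_le_of_norm_le_const hb
    refine (le_abs_self _).trans (h1.trans (le_of_eq ?_))
    simp only [measureReal_restrict_apply_univ]
    ring

end Mesh

end Line

/-! ### Superposition operators and the permeability form -/

section Operators

variable {d : ℕ} {Ω : Set (Space d)}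

theorem IncreasingLipschitz.exists_slope {φ : ℝ → ℝ} {m L : ℝ} (hφ : IncreasingLipschitz φ m L)
    (a b : ℝ) : ∃ t, m ≤ t ∧ t ≤ L ∧ φ a - φ b = t * (a - b) := by
  have hd : Differentiable ℝ φ := hφ.contDiff.differentiable one_ne_zero
  wlog h : b < a generalizing a b
  · rcases eq_or_lt_of_le (not_lt.1 h) with h1 | h1
    · exact ⟨deriv φ 0, hφ.le_deriv 0, hφ.deriv_le 0, by rw [h1]; ring⟩
    · obtain ⟨t, h2, h3, h4⟩ := this b a h1
      exact ⟨t, h2, h3, by linarith⟩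
  obtain ⟨c, -, hc⟩ := exists_deriv_eq_slope φ h hd.continuous.continuousOn hd.differentiableOn
  refine ⟨deriv φ c, hφ.le_deriv c, hφ.deriv_le c, ?_⟩
  rw [hc, div_mul_cancel₀ _ (sub_ne_zero.2 h.ne')]

theorem IncreasingLipschitz.memLp_comp [IsFiniteMeasure (volume.restrict Ω)] {φ : ℝ → ℝ}
    {m L : ℝ} (hφ : IncreasingLipschitz φ m L) (f : L2 Ω) :
    MemLp (fun x => φ (f x)) 2 (volume.restrict Ω) := by
  have h1 : MemLp (fun x => |φ 0| + L * |f x|) 2 (volume.restrict Ω) :=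
    (memLp_const |φ 0|).add ((Lp.memLp f).abs.const_mul L)
  refine h1.of_le (hφ.contDiff.continuous.comp_aestronglyMeasurable
    (Lp.aestronglyMeasurable f)) (Eventually.of_forall fun x => ?_)
  obtain ⟨t, ht1, ht2, ht3⟩ := hφ.exists_slope (f x) 0
  have ht0 : 0 ≤ t := hφ.pos.le.trans ht1
  have h2 : φ (f x) = φ 0 + t * f x := by linarith
  have hL : 0 ≤ L := ht0.trans ht2
  rw [h2, Real.norm_eq_abs, Real.norm_eq_abs, abs_of_nonneg (a := |φ 0| + L * |f x|)
    (by positivity)]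
  refine (abs_add_le _ _).trans ?_
  rw [abs_mul, abs_of_nonneg ht0]
  gcongr

/-- The superposition operator `f ↦ φ ∘ f` on `L²(Ω)`. -/
def superpose [IsFiniteMeasure (volume.restrict Ω)] {φ : ℝ → ℝ} {m L : ℝ}
    (hφ : IncreasingLipschitz φ m L) (f : L2 Ω) : L2 Ω := (hφ.memLp_comp f).toLp

theorem pair_comp [IsFiniteMeasure (volume.restrict Ω)] {φ : ℝ → ℝ} {m L : ℝ}
    (hφ : IncreasingLipschitz φ m L) (f g : L2 Ω) :
    pair Ω (fun x => φ (f x)) g = inner ℝ (superpose hφ f) g := by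
  rw [← pair_eq_inner]
  exact pair_congr (hφ.memLp_comp f).coeFn_toLp.symm (ae_eq_refl _)

/-- Pointwise `φ(f) - φ(g) = t (f - g)` with `m ≤ t ≤ L`, leaving `(c - t)(f - g)`. This is where
the stabilisation by `L₁` and `L₂` acts. -/
theorem norm_smul_sub_superpose_le [IsFiniteMeasure (volume.restrict Ω)] {φ : ℝ → ℝ} {m L : ℝ}
    (hφ : IncreasingLipschitz φ m L) {c M : ℝ} (hc : ∀ t, m ≤ t → t ≤ L → |c - t| ≤ M)
    (f g : L2 Ω) :
    ‖c • (f - g) - (superpose hφ f - superpose hφ g)‖ ≤ M * ‖f - g‖ := by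
  refine Lp.norm_le_mul_norm_of_ae_le_mul ?_
  filter_upwards [Lp.coeFn_sub (c • (f - g)) (superpose hφ f - superpose hφ g),
    Lp.coeFn_smul c (f - g), Lp.coeFn_sub f g, Lp.coeFn_sub (superpose hφ f) (superpose hφ g),
    (hφ.memLp_comp f).coeFn_toLp, (hφ.memLp_comp g).coeFn_toLp] with x h1 h2 h3 h4 h5 h6
  obtain ⟨t, ht1, ht2, ht3⟩ := hφ.exists_slope (f x) (g x)
  have h5' : superpose hφ f x = φ (f x) := h5
  have h6' : superpose hφ g x = φ (g x) := h6
  rw [h1, Pi.sub_apply, h2, h4, Pi.sub_apply, Pi.smul_apply, h3, Pi.sub_apply, h5', h6', ht3,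
    smul_eq_mul, ← sub_mul, norm_mul]
  exact mul_le_mul_of_nonneg_right (hc t ht1 ht2) (norm_nonneg _)

section Permeability

variable {K : Space d → ℝ} {km kM : ℝ}

theorem BoundedPermeability.memLp (hΩ : IsOpen Ω) (hK : BoundedPermeability Ω K km kM)
    (f : L2 Ω) : MemLp (fun x => (K x)⁻¹ * f x) 2 (volume.restrict Ω) := by
  refine (Lp.memLp f).of_le_mul (c := km⁻¹)
    (hK.aemeasurable.inv.aestronglyMeasurable.mul (Lp.aestronglyMeasurable f)) ?_
  filter_upwards [ae_restrict_mem hΩ.measurableSet] with x hx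
  have h1 := hK.le_K x hx
  rw [norm_mul, norm_inv, Real.norm_eq_abs, abs_of_pos (hK.pos.trans_le h1)]
  gcongr
  exact hK.pos

/-- Multiplication by `K⁻¹` on `L²(Ω)`. -/
def invMul (hΩ : IsOpen Ω) (hK : BoundedPermeability Ω K km kM) : L2 Ω →ₗ[ℝ] L2 Ω where
  toFun f := (hK.memLp hΩ f).toLp
  map_add' f g := by
    rw [← MemLp.toLp_add]
    refine MemLp.toLp_congr _ _ ?_
    filter_upwards [Lp.coeFn_add f g] with x hx
    rw [hx, Pi.add_apply, Pi.add_apply, mul_add]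
  map_smul' c f := by
    rw [RingHom.id_apply, ← MemLp.toLp_const_smul]
    refine MemLp.toLp_congr _ _ ?_
    filter_upwards [Lp.coeFn_smul c f] with x hx
    rw [hx, Pi.smul_apply, Pi.smul_apply, smul_eq_mul, smul_eq_mul]
    ring

variable (hΩ : IsOpen Ω) (hK : BoundedPermeability Ω K km kM)

theorem invMul_ae (f : L2 Ω) :
    invMul hΩ hK f =ᵐ[volume.restrict Ω] fun x => (K x)⁻¹ * f x := (hK.memLp hΩ f).coeFn_toLp

theorem pair_inv_mul (f g : L2 Ω) :
    pair Ω (fun x => (K x)⁻¹ * f x) g = inner ℝ (invMul hΩ hK f) g := by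
  rw [← pair_eq_inner]
  exact pair_congr (invMul_ae hΩ hK f).symm (ae_eq_refl _)

theorem norm_invMul_le (f : L2 Ω) : ‖invMul hΩ hK f‖ ≤ km⁻¹ * ‖f‖ := by
  refine Lp.norm_le_mul_norm_of_ae_le_mul ?_
  filter_upwards [invMul_ae hΩ hK f, ae_restrict_mem hΩ.measurableSet] with x hf hx
  have h1 := hK.le_K x hx
  rw [hf, norm_mul, norm_inv, Real.norm_eq_abs, abs_of_pos (hK.pos.trans_le h1)]
  gcongr
  exact hK.pos

theorem inner_invMul_self_ge (f : L2 Ω) : kM⁻¹ * ‖f‖ ^ 2 ≤ inner ℝ (invMul hΩ hK f) f := by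
  rw [← pair_inv_mul, norm_sq_eq_integral, ← integral_const_mul]
  refine integral_mono_ae ((Lp.memLp f).integrable_sq.const_mul _)
    (integrable_mul (hK.memLp hΩ f) (Lp.memLp f)) ?_
  filter_upwards [ae_restrict_mem hΩ.measurableSet] with x hx
  have h1 := hK.pos.trans_le (hK.le_K x hx)
  have h2 := hK.K_le x hx
  have h3 : kM⁻¹ ≤ (K x)⁻¹ := inv_anti₀ h1 h2
  have := mul_le_mul_of_nonneg_right h3 (sq_nonneg (f x))
  rw [sq] at this ⊢
  linarith

/-- The form `⟨K⁻¹ q, v⟩` on `L²(Ω)^d`. -/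
def invForm (q v : L2Vec Ω) : ℝ := ∑ i, inner ℝ (invMul hΩ hK (q i)) (v i)

theorem invForm_self_ge (q : L2Vec Ω) : kM⁻¹ * ‖q‖ ^ 2 ≤ invForm hΩ hK q q := by
  rw [PiLp.norm_sq_eq_of_L2, Finset.mul_sum]
  exact Finset.sum_le_sum fun i _ => inner_invMul_self_ge hΩ hK (q i)

theorem invForm_le (q v : L2Vec Ω) : invForm hΩ hK q v ≤ km⁻¹ * ‖q‖ * ‖v‖ := by
  have hkm := hK.pos
  set q' : L2Vec Ω := WithLp.toLp 2 fun i => invMul hΩ hK (q i)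
  have h1 : invForm hΩ hK q v = inner ℝ q' v := by
    rw [PiLp.inner_apply]; rfl
  have h2 : ‖q'‖ ≤ km⁻¹ * ‖q‖ := by
    refine le_of_sq_le_sq ?_ (by positivity)
    rw [mul_pow, PiLp.norm_sq_eq_of_L2, PiLp.norm_sq_eq_of_L2, Finset.mul_sum]
    refine Finset.sum_le_sum fun i _ => ?_
    rw [← mul_pow]
    exact pow_le_pow_left₀ (norm_nonneg _) (norm_invMul_le hΩ hK (q i)) 2
  rw [h1]
  exact (real_inner_le_norm _ _).trans (mul_le_mul_of_nonneg_right h2 (norm_nonneg _))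

end Permeability

end Operators

/-! ### One step as a linear variational problem on the discrete state space -/

namespace Mesh

variable {d : ℕ} {Ω : Set (Space d)} (T : Mesh Ω) (hΩ : IsOpen Ω)
  [IsFiniteMeasure (volume.restrict Ω)]

/-- `W_h × V_h × Z_h` as a vector space. -/
def StateSpace := T.WSub × T.VSub × T.ZSub hΩ

instance : NormedAddCommGroup (T.StateSpace hΩ) :=
  inferInstanceAs (NormedAddCommGroup (T.WSub × T.VSub × T.ZSub hΩ))

instance : NormedSpace ℝ (T.StateSpace hΩ) :=
  inferInstanceAs (NormedSpace ℝ (T.WSub × T.VSub × T.ZSub hΩ))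

theorem finiteDimensional_stateSpace (hΩr : interior (closure Ω) = Ω) :
    FiniteDimensional ℝ (T.StateSpace hΩ) := by
  have := T.finiteDimensional_WSub hΩr
  have := T.finiteDimensional_VSub hΩr
  have := T.finiteDimensional_ZSub hΩ hΩr
  exact inferInstanceAs (FiniteDimensional ℝ (T.WSub × T.VSub × T.ZSub hΩ))

variable {T hΩ}

/-- An element of `W_h × V_h × Z_h` as a state. -/
def toState (x : T.StateSpace hΩ) : State Ω := ⟨x.1, x.2.1, x.2.2⟩

theorem toState_mem (x : T.StateSpace hΩ) : toState x ∈ T.states := ⟨x.1.2, x.2.1.2, x.2.2.2⟩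

variable (hΩ) in
theorem exists_toState {x : State Ω} (hx : x ∈ T.states) :
    ∃ y : T.StateSpace hΩ, toState y = x :=
  ⟨(⟨x.p, hx.1⟩, ⟨x.q, hx.2.1⟩, ⟨x.u, hx.2.2⟩), rfl⟩

variable (T hΩ)

/-- The pressure. -/
def pMap : T.StateSpace hΩ →ₗ[ℝ] L2 Ω := T.WSub.subtype ∘ₗ LinearMap.fst ℝ _ _

/-- The flux. -/
def qMap : T.StateSpace hΩ →ₗ[ℝ] L2Vec Ω :=
  T.VSub.subtype ∘ₗ LinearMap.fst ℝ _ _ ∘ₗ LinearMap.snd ℝ _ _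

/-- The displacement. -/
def uMap : T.StateSpace hΩ →ₗ[ℝ] L2Vec Ω :=
  (T.ZSub hΩ).subtype ∘ₗ LinearMap.snd ℝ _ _ ∘ₗ LinearMap.snd ℝ _ _

/-- The components of the flux. -/
def qComp (i : Fin d) : T.StateSpace hΩ →ₗ[ℝ] L2 Ω where
  toFun x := T.qMap hΩ x i
  map_add' x y := by rw [map_add]; rfl
  map_smul' c x := by rw [map_smul]; rfl

/-- The components of the displacement. -/
def uComp (i : Fin d) : T.StateSpace hΩ →ₗ[ℝ] L2 Ω where
  toFun x := T.uMap hΩ x i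
  map_add' x y := by rw [map_add]; rfl
  map_smul' c x := by rw [map_smul]; rfl

variable {T hΩ}

theorem uMap_mem_H10 (x : T.StateSpace hΩ) (i : Fin d) : T.uMap hΩ x i ∈ H10 Ω := x.2.2.2.1 i

theorem uMap_mem_Hdiv (x : T.StateSpace hΩ) : T.uMap hΩ x ∈ Hdiv Ω :=
  ⟨_, hasWeakDiv_of_H1 fun i => (uMap_mem_H10 x i).1⟩

theorem qMap_mem_Hdiv (x : T.StateSpace hΩ) : T.qMap hΩ x ∈ Hdiv Ω := x.2.1.2.1

variable (T hΩ)

/-- The divergence of the flux. -/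
def divQ : T.StateSpace hΩ →ₗ[ℝ] L2 Ω where
  toFun x := weakDiv Ω (T.qMap hΩ x)
  map_add' x y := by rw [map_add, weakDiv_add hΩ (qMap_mem_Hdiv x) (qMap_mem_Hdiv y)]
  map_smul' c x := by rw [map_smul, weakDiv_smul hΩ c (qMap_mem_Hdiv x), RingHom.id_apply]

/-- The divergence of the displacement. -/
def divU : T.StateSpace hΩ →ₗ[ℝ] L2 Ω where
  toFun x := weakDiv Ω (T.uMap hΩ x)
  map_add' x y := by rw [map_add, weakDiv_add hΩ (uMap_mem_Hdiv x) (uMap_mem_Hdiv y)]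
  map_smul' c x := by rw [map_smul, weakDiv_smul hΩ c (uMap_mem_Hdiv x), RingHom.id_apply]

/-- The partial derivatives of the displacement. -/
def gradU (j k : Fin d) : T.StateSpace hΩ →ₗ[ℝ] L2 Ω where
  toFun x := weakPartial Ω j (T.uMap hΩ x k)
  map_add' x y := by
    rw [map_add, PiLp.add_apply, weakPartial_add hΩ j (uMap_mem_H10 x k).1 (uMap_mem_H10 y k).1]
  map_smul' c x := by
    rw [map_smul, PiLp.smul_apply, weakPartial_smul hΩ j c (uMap_mem_H10 x k).1, RingHom.id_apply]

/-- The strain of the displacement. -/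
def strainU (i j : Fin d) : T.StateSpace hΩ →ₗ[ℝ] L2 Ω :=
  (2⁻¹ : ℝ) • (T.gradU hΩ i j + T.gradU hΩ j i)

/-- The `L²(Ω)` inner product of the images under two linear maps. -/
def innerForm (A B : T.StateSpace hΩ →ₗ[ℝ] L2 Ω) :
    T.StateSpace hΩ →ₗ[ℝ] T.StateSpace hΩ →ₗ[ℝ] ℝ := (innerₗ (L2 Ω)).compl₁₂ A B

/-- The linear functional `y ↦ ⟨g, A y⟩`. -/
def innerFun (g : L2 Ω) (A : T.StateSpace hΩ →ₗ[ℝ] L2 Ω) : T.StateSpace hΩ →ₗ[ℝ] ℝ :=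
  innerₗ (L2 Ω) g ∘ₗ A

variable {T hΩ}

theorem innerForm_apply (A B : T.StateSpace hΩ →ₗ[ℝ] L2 Ω) (x y : T.StateSpace hΩ) :
    T.innerForm hΩ A B x y = inner ℝ (A x) (B y) := rfl

theorem innerFun_apply (g : L2 Ω) (A : T.StateSpace hΩ →ₗ[ℝ] L2 Ω) (y : T.StateSpace hΩ) :
    T.innerFun hΩ g A y = inner ℝ g (A y) := rfl

theorem strainPair_eq (x y : T.StateSpace hΩ) :
    strainPair Ω (T.uMap hΩ x) (T.uMap hΩ y)
      = ∑ i, ∑ j, inner ℝ (T.strainU hΩ i j x) (T.strainU hΩ i j y) := by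
  simp only [strainPair, pair_eq_inner]
  rfl

section Step

variable (T) (P : Coeffs d) (L₁ L₂ : ℝ) {bm Lb hm Lh km kM : ℝ} (hΩ)
  (hb : IncreasingLipschitz P.b bm Lb) (hh : IncreasingLipschitz P.h hm Lh)
  (hK : BoundedPermeability Ω P.K km kM) (f : L2Vec Ω) (S : L2 Ω) (old : State Ω)

/-- The bilinear form of the linear system of one step of the L-scheme. -/
def stepForm : T.StateSpace hΩ →ₗ[ℝ] T.StateSpace hΩ →ₗ[ℝ] ℝ :=
  (2 * P.μ) • ∑ i, ∑ j, T.innerForm hΩ (T.strainU hΩ i j) (T.strainU hΩ i j)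
    + L₂ • T.innerForm hΩ (T.divU hΩ) (T.divU hΩ) - P.α • T.innerForm hΩ (T.pMap hΩ) (T.divU hΩ)
    + (P.ν • ∑ i, T.innerForm hΩ (invMul hΩ hK ∘ₗ T.qComp hΩ i) (T.qComp hΩ i)
      - T.innerForm hΩ (T.pMap hΩ) (T.divQ hΩ))
    + (L₁ • T.innerForm hΩ (T.pMap hΩ) (T.pMap hΩ) + P.α • T.innerForm hΩ (T.divU hΩ) (T.pMap hΩ)
      + P.τ • T.innerForm hΩ (T.divQ hΩ) (T.pMap hΩ))

/-- The constant function `c`. -/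
def constLp (Ω : Set (Space d)) [IsFiniteMeasure (volume.restrict Ω)] (c : ℝ) : L2 Ω :=
  (memLp_const c : MemLp (fun _ : Space d => c) 2 (volume.restrict Ω)).toLp

/-- The right-hand side of the linear system of one step of the L-scheme. -/
def stepLoad (x : T.StateSpace hΩ) : T.StateSpace hΩ →ₗ[ℝ] ℝ :=
  (∑ i, T.innerFun hΩ (f i) (T.uComp hΩ i)
      + T.innerFun hΩ (L₂ • T.divU hΩ x - superpose hh (T.divU hΩ x)) (T.divU hΩ))
    + ∑ i, T.innerFun hΩ (constLp Ω (P.ρ * P.gravity i)) (T.qComp hΩ i)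
    + T.innerFun hΩ (P.τ • S + superpose hb old.p + P.α • weakDiv Ω old.u
      + (L₁ • T.pMap hΩ x - superpose hb (T.pMap hΩ x))) (T.pMap hΩ)

variable {T}

theorem stepForm_apply (x y : T.StateSpace hΩ) :
    T.stepForm hΩ P L₁ L₂ hK x y
      = (2 * P.μ * strainPair Ω (T.uMap hΩ x) (T.uMap hΩ y)
        + L₂ * inner ℝ (T.divU hΩ x) (T.divU hΩ y) - P.α * inner ℝ (T.pMap hΩ x) (T.divU hΩ y))
      + (P.ν * invForm hΩ hK (T.qMap hΩ x) (T.qMap hΩ y)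
        - inner ℝ (T.pMap hΩ x) (T.divQ hΩ y))
      + (L₁ * inner ℝ (T.pMap hΩ x) (T.pMap hΩ y) + P.α * inner ℝ (T.divU hΩ x) (T.pMap hΩ y)
        + P.τ * inner ℝ (T.divQ hΩ x) (T.pMap hΩ y)) := by
  rw [strainPair_eq]
  simp only [stepForm, LinearMap.add_apply, LinearMap.sub_apply, LinearMap.smul_apply,
    LinearMap.sum_apply, innerForm_apply, smul_eq_mul, LinearMap.comp_apply]
  rfl

theorem stepLoad_apply (x y : T.StateSpace hΩ) :
    T.stepLoad hΩ P L₁ L₂ hb hh f S old x y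
      = (∑ i, inner ℝ (f i) (T.uMap hΩ y i)
        + (L₂ * inner ℝ (T.divU hΩ x) (T.divU hΩ y)
          - inner ℝ (superpose hh (T.divU hΩ x)) (T.divU hΩ y)))
      + ∑ i, inner ℝ (constLp Ω (P.ρ * P.gravity i)) (T.qMap hΩ y i)
      + (P.τ * inner ℝ S (T.pMap hΩ y) + inner ℝ (superpose hb old.p) (T.pMap hΩ y)
        + P.α * inner ℝ (weakDiv Ω old.u) (T.pMap hΩ y)
        + (L₁ * inner ℝ (T.pMap hΩ x) (T.pMap hΩ y)
          - inner ℝ (superpose hb (T.pMap hΩ x)) (T.pMap hΩ y))) := by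
  simp only [stepLoad, LinearMap.add_apply, LinearMap.sum_apply, innerFun_apply, inner_add_left,
    inner_sub_left, real_inner_smul_left]
  rfl

omit [IsFiniteMeasure (volume.restrict Ω)] in
theorem pair_sub_left (f g k : L2 Ω) :
    pair Ω (fun y => f y - g y) k = inner ℝ f k - inner ℝ g k := by
  rw [← inner_sub_left, ← pair_eq_inner]
  exact pair_congr (Lp.coeFn_sub f g).symm (ae_eq_refl _)

theorem pair_const (c : ℝ) (k : L2 Ω) : pair Ω (fun _ => c) k = inner ℝ (constLp Ω c) k := by
  rw [← pair_eq_inner]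
  exact pair_congr (MemLp.coeFn_toLp _).symm (ae_eq_refl _)

theorem momentum_iff (D D' p g : L2 Ω) (A F : ℝ) :
    A + L₂ * pair Ω (fun y => D' y - D y) g + pair Ω (fun y => P.h (D y)) g
        - P.α * pair Ω p g = F ↔
      A + L₂ * inner ℝ D' g - P.α * inner ℝ p g
        = F + (L₂ * inner ℝ D g - inner ℝ (superpose hh D) g) := by
  rw [pair_sub_left, pair_comp hh, pair_eq_inner p]
  constructor <;> intro h <;> linarith

theorem darcy_iff (p g : L2 Ω) (q v : L2Vec Ω) :
    P.ν * ∑ i, pair Ω (fun x => (P.K x)⁻¹ * q i x) (v i) - pair Ω p g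
        = ∑ i, pair Ω (fun _ => P.ρ * P.gravity i) (v i) ↔
      P.ν * invForm hΩ hK q v - inner ℝ p g
        = ∑ i, inner ℝ (constLp Ω (P.ρ * P.gravity i)) (v i) := by
  have h1 : ∑ i, pair Ω (fun x => (P.K x)⁻¹ * q i x) (v i) = invForm hΩ hK q v :=
    Finset.sum_congr rfl fun i _ => pair_inv_mul hΩ hK (q i) (v i)
  have h2 : ∑ i, pair Ω (fun _ => P.ρ * P.gravity i) (v i)
      = ∑ i, inner ℝ (constLp Ω (P.ρ * P.gravity i)) (v i) :=
    Finset.sum_congr rfl fun i _ => pair_const _ (v i)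
  rw [h1, h2, pair_eq_inner]

theorem mass_iff (p p' p₀ D D₀ dq w : L2 Ω) :
    pair Ω (fun y => P.b (p y)) w + L₁ * pair Ω (fun y => p' y - p y) w + P.α * pair Ω D w
        + P.τ * pair Ω dq w
        = P.τ * pair Ω S w + pair Ω (fun y => P.b (p₀ y)) w + P.α * pair Ω D₀ w ↔
      L₁ * inner ℝ p' w + P.α * inner ℝ D w + P.τ * inner ℝ dq w
        = P.τ * inner ℝ S w + inner ℝ (superpose hb p₀) w + P.α * inner ℝ D₀ w
          + (L₁ * inner ℝ p w - inner ℝ (superpose hb p) w) := by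
  rw [pair_sub_left, pair_comp hb, pair_comp hb, pair_eq_inner D, pair_eq_inner dq,
    pair_eq_inner S, pair_eq_inner D₀]
  constructor <;> intro h <;> linarith

/-- The state with displacement `z` and no pressure or flux. -/
theorem exists_displacement {z : L2Vec Ω} (hz : z ∈ T.Z) : ∃ y : T.StateSpace hΩ,
    T.pMap hΩ y = 0 ∧ T.qMap hΩ y = 0 ∧ T.divQ hΩ y = 0 ∧ T.uMap hΩ y = z
      ∧ T.divU hΩ y = weakDiv Ω z :=
  ⟨(0, 0, ⟨z, hz⟩), rfl, rfl, (T.divQ hΩ).map_zero, rfl, rfl⟩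

/-- The state with flux `v` and no pressure or displacement. -/
theorem exists_flux {v : L2Vec Ω} (hv : v ∈ T.V) : ∃ y : T.StateSpace hΩ,
    T.pMap hΩ y = 0 ∧ T.qMap hΩ y = v ∧ T.divQ hΩ y = weakDiv Ω v ∧ T.uMap hΩ y = 0
      ∧ T.divU hΩ y = 0 :=
  ⟨(0, ⟨v, hv⟩, 0), rfl, rfl, rfl, rfl, (T.divU hΩ).map_zero⟩

/-- The state with pressure `w` and no flux or displacement. -/
theorem exists_pressure {w : L2 Ω} (hw : w ∈ T.W) : ∃ y : T.StateSpace hΩ,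
    T.pMap hΩ y = w ∧ T.qMap hΩ y = 0 ∧ T.divQ hΩ y = 0 ∧ T.uMap hΩ y = 0 ∧ T.divU hΩ y = 0 :=
  ⟨(⟨w, hw⟩, 0, 0), rfl, rfl, (T.divQ hΩ).map_zero, rfl, (T.divU hΩ).map_zero⟩

theorem strainPair_zero_right (x : T.StateSpace hΩ) :
    strainPair Ω (T.uMap hΩ x) 0 = 0 := by
  rw [← map_zero (T.uMap hΩ), strainPair_eq]
  exact Finset.sum_eq_zero fun i _ => Finset.sum_eq_zero fun j _ => by
    rw [map_zero, inner_zero_right]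

theorem stepForm_eq_stepLoad_iff (x x' y : T.StateSpace hΩ) {p dq D : L2 Ω} {q u : L2Vec Ω}
    (h : T.pMap hΩ y = p ∧ T.qMap hΩ y = q ∧ T.divQ hΩ y = dq ∧ T.uMap hΩ y = u
      ∧ T.divU hΩ y = D) :
    T.stepForm hΩ P L₁ L₂ hK x' y = T.stepLoad hΩ P L₁ L₂ hb hh f S old x y ↔
      (2 * P.μ * strainPair Ω (T.uMap hΩ x') u + L₂ * inner ℝ (T.divU hΩ x') D
          - P.α * inner ℝ (T.pMap hΩ x') D)
        + (P.ν * invForm hΩ hK (T.qMap hΩ x') q - inner ℝ (T.pMap hΩ x') dq)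
        + (L₁ * inner ℝ (T.pMap hΩ x') p + P.α * inner ℝ (T.divU hΩ x') p
          + P.τ * inner ℝ (T.divQ hΩ x') p)
      = (∑ i, inner ℝ (f i) (u i) + (L₂ * inner ℝ (T.divU hΩ x) D
          - inner ℝ (superpose hh (T.divU hΩ x)) D))
        + ∑ i, inner ℝ (constLp Ω (P.ρ * P.gravity i)) (q i)
        + (P.τ * inner ℝ S p + inner ℝ (superpose hb old.p) p
          + P.α * inner ℝ (weakDiv Ω old.u) p
          + (L₁ * inner ℝ (T.pMap hΩ x) p - inner ℝ (superpose hb (T.pMap hΩ x)) p)) := by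
  obtain ⟨rfl, rfl, rfl, rfl, rfl⟩ := h
  rw [stepForm_apply, stepLoad_apply]

/-- The linear system of one step of the L-scheme, tested separately in each component. -/
theorem forall_stepForm_eq_iff (x x' : T.StateSpace hΩ) :
    (∀ y, T.stepForm hΩ P L₁ L₂ hK x' y = T.stepLoad hΩ P L₁ L₂ hb hh f S old x y) ↔
      (∀ z ∈ T.Z, 2 * P.μ * strainPair Ω (T.uMap hΩ x') z + L₂ * inner ℝ (T.divU hΩ x') (weakDiv Ω z)
          - P.α * inner ℝ (T.pMap hΩ x') (weakDiv Ω z)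
        = ∑ i, inner ℝ (f i) (z i) + (L₂ * inner ℝ (T.divU hΩ x) (weakDiv Ω z)
          - inner ℝ (superpose hh (T.divU hΩ x)) (weakDiv Ω z))) ∧
      (∀ v ∈ T.V, P.ν * invForm hΩ hK (T.qMap hΩ x') v - inner ℝ (T.pMap hΩ x') (weakDiv Ω v)
        = ∑ i, inner ℝ (constLp Ω (P.ρ * P.gravity i)) (v i)) ∧
      (∀ w ∈ T.W, L₁ * inner ℝ (T.pMap hΩ x') w + P.α * inner ℝ (T.divU hΩ x') w
          + P.τ * inner ℝ (T.divQ hΩ x') w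
        = P.τ * inner ℝ S w + inner ℝ (superpose hb old.p) w + P.α * inner ℝ (weakDiv Ω old.u) w
          + (L₁ * inner ℝ (T.pMap hΩ x) w - inner ℝ (superpose hb (T.pMap hΩ x)) w)) := by
  constructor
  · intro h
    refine ⟨fun z hz => ?_, fun v hv => ?_, fun w hw => ?_⟩
    -- Test states with a single non-zero component isolate the three equations.
    · obtain ⟨y, hy⟩ := exists_displacement hΩ hz
      have h6 := (stepForm_eq_stepLoad_iff hΩ P L₁ L₂ hb hh hK f S old x x' y hy).1 (h y)
      simpa only [invForm, PiLp.zero_apply, inner_zero_right, Finset.sum_const_zero, mul_zero,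
        sub_zero, add_zero] using h6
    · obtain ⟨y, hy⟩ := exists_flux hΩ hv
      have h6 := (stepForm_eq_stepLoad_iff hΩ P L₁ L₂ hb hh hK f S old x x' y hy).1 (h y)
      rw [strainPair_zero_right] at h6
      simpa only [PiLp.zero_apply, inner_zero_right, Finset.sum_const_zero, mul_zero,
        sub_zero, add_zero, zero_add] using h6
    · obtain ⟨y, hy⟩ := exists_pressure hΩ hw
      have h6 := (stepForm_eq_stepLoad_iff hΩ P L₁ L₂ hb hh hK f S old x x' y hy).1 (h y)
      rw [strainPair_zero_right] at h6
      simpa only [invForm, PiLp.zero_apply, inner_zero_right, Finset.sum_const_zero, mul_zero,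
        sub_zero, add_zero, zero_add] using h6
  · rintro ⟨h1, h2, h3⟩ y
    refine (stepForm_eq_stepLoad_iff hΩ P L₁ L₂ hb hh hK f S old x x' y
      ⟨rfl, rfl, rfl, rfl, rfl⟩).2 ?_
    exact congrArg₂ (· + ·) (congrArg₂ (· + ·) (h1 _ y.2.2.2) (h2 _ y.2.1.2)) (h3 _ y.1.2)

/-- One step of the L-scheme amounts to a linear variational problem. -/
theorem isStep_iff (x x' : T.StateSpace hΩ) :
    IsStep T P L₁ L₂ f S old (toState x) (toState x') ↔
      ∀ y, T.stepForm hΩ P L₁ L₂ hK x' y = T.stepLoad hΩ P L₁ L₂ hb hh f S old x y := by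
  have hmom := fun z : L2Vec Ω => momentum_iff P L₂ hh (T.divU hΩ x) (T.divU hΩ x')
    (T.pMap hΩ x') (weakDiv Ω z) (2 * P.μ * strainPair Ω (T.uMap hΩ x') z) (∑ i, inner ℝ (f i) (z i))
  have hdar := fun v : L2Vec Ω => darcy_iff hΩ P hK (T.pMap hΩ x') (weakDiv Ω v) (T.qMap hΩ x') v
  have hmass := mass_iff P L₁ hb S (T.pMap hΩ x) (T.pMap hΩ x') old.p (T.divU hΩ x')
    (weakDiv Ω old.u) (T.divQ hΩ x')
  have hF : ∀ z : L2Vec Ω, ∑ i, pair Ω (f i) (z i) = ∑ i, inner ℝ (f i) (z i) := fun z =>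
    Finset.sum_congr rfl fun i _ => pair_eq_inner _ _
  rw [forall_stepForm_eq_iff]
  constructor
  · intro h
    exact ⟨fun z hz => (hmom z).1 ((h.momentum z hz).trans (hF z)),
      fun v hv => (hdar v).1 (h.darcy v hv), fun w hw => (hmass w).1 (h.mass w hw)⟩
  · rintro ⟨h1, h2, h3⟩
    exact ⟨toState_mem x', fun z hz => ((hmom z).2 (h1 z hz)).trans (hF z).symm,
      fun v hv => (hdar v).2 (h2 v hv), fun w hw => (hmass w).2 (h3 w hw)⟩

end Step

end Mesh

/-- At a fixed point the stabilisation terms vanish, for all values of `L₁` and `L₂`. -/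
theorem isSolution_iff_isStep {d : ℕ} {Ω : Set (Space d)} {T : Mesh Ω} {P : Coeffs d}
    (L₁ L₂ : ℝ) {f : L2Vec Ω} {S : L2 Ω} {old x : State Ω} :
    IsSolution T P f S old x ↔ IsStep T P L₁ L₂ f S old x x := by
  constructor
  · intro h
    refine ⟨h.mem, fun z hz => ?_, h.darcy, fun w hw => ?_⟩
    · rw [← h.momentum z hz]; simp [pair]
    · rw [← h.mass w hw]; simp [pair]
  · intro h
    refine ⟨h.mem, fun z hz => ?_, h.darcy, fun w hw => ?_⟩
    · rw [← h.momentum z hz]; simp [pair]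
    · rw [← h.mass w hw]; simp [pair]


/-! ### The energy estimate for differences -/

namespace Mesh

variable {d : ℕ} {Ω : Set (Space d)} {T : Mesh Ω} {hΩ : IsOpen Ω}
  [IsFiniteMeasure (volume.restrict Ω)] {P : Coeffs d} {L₁ L₂ bm Lb hm Lh km kM : ℝ}
  {hb : IncreasingLipschitz P.b bm Lb} {hh : IncreasingLipschitz P.h hm Lh}
  {hK : BoundedPermeability Ω P.K km kM}

theorem exists_weighted (x : T.StateSpace hΩ) (c : ℝ) : ∃ y : T.StateSpace hΩ,
    T.pMap hΩ y = T.pMap hΩ x ∧ T.qMap hΩ y = c • T.qMap hΩ x ∧ T.divQ hΩ y = c • T.divQ hΩ x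
      ∧ T.uMap hΩ y = T.uMap hΩ x ∧ T.divU hΩ y = T.divU hΩ x := by
  refine ⟨(x.1, c • x.2.1, x.2.2), rfl, rfl, ?_, rfl, rfl⟩
  rw [← map_smul]
  rfl

omit [IsFiniteMeasure (volume.restrict Ω)] in
theorem invForm_smul_right (q v : L2Vec Ω) (c : ℝ) :
    invForm hΩ hK q (c • v) = c * invForm hΩ hK q v := by
  simp only [invForm, PiLp.smul_apply, real_inner_smul_right, Finset.mul_sum]

/-- With the flux of the test state multiplied by `τ`, the pressure–flux terms of Darcy's law and of
the mass balance cancel; the two terms with `α` cancel as they are. -/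
theorem stepForm_energy {x : T.StateSpace hΩ} {rD rp : L2 Ω}
    (h : ∀ y, T.stepForm hΩ P L₁ L₂ hK x y = inner ℝ rD (T.divU hΩ y) + inner ℝ rp (T.pMap hΩ y)) :
    2 * P.μ * strainPair Ω (T.uMap hΩ x) (T.uMap hΩ x) + L₂ * ‖T.divU hΩ x‖ ^ 2
        + L₁ * ‖T.pMap hΩ x‖ ^ 2 + P.τ * P.ν * invForm hΩ hK (T.qMap hΩ x) (T.qMap hΩ x)
      = inner ℝ rD (T.divU hΩ x) + inner ℝ rp (T.pMap hΩ x) := by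
  obtain ⟨y, h1, h2, h3, h4, h5⟩ := exists_weighted x P.τ
  have h6 := h y
  rw [stepForm_apply, h1, h2, h3, h4, h5, invForm_smul_right, real_inner_smul_right,
    real_inner_self_eq_norm_sq, real_inner_self_eq_norm_sq,
    real_inner_comm (T.pMap hΩ x) (T.divU hΩ x), real_inner_comm (T.pMap hΩ x) (T.divQ hΩ x)] at h6
  rw [← h6]
  ring

theorem stepForm_darcy {x : T.StateSpace hΩ} {rD rp : L2 Ω}
    (h : ∀ y, T.stepForm hΩ P L₁ L₂ hK x y = inner ℝ rD (T.divU hΩ y) + inner ℝ rp (T.pMap hΩ y))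
    {v : L2Vec Ω} (hv : v ∈ T.V) :
    P.ν * invForm hΩ hK (T.qMap hΩ x) v = inner ℝ (T.pMap hΩ x) (weakDiv Ω v) := by
  obtain ⟨y, h1, h2, h3, h4, h5⟩ := exists_flux hΩ hv
  have h6 := h y
  rw [stepForm_apply, h1, h2, h3, h4, h5, strainPair_zero_right] at h6
  simp only [inner_zero_right, mul_zero, sub_zero, add_zero, zero_add] at h6
  linarith

/-- The pressure is controlled by the flux, by the divergence stability. -/
theorem norm_pMap_le {C : ℝ} (hC : 0 < C) (hν : 0 < P.ν) (hT : T.DivStable C)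
    {x : T.StateSpace hΩ} {rD rp : L2 Ω}
    (h : ∀ y, T.stepForm hΩ P L₁ L₂ hK x y
      = inner ℝ rD (T.divU hΩ y) + inner ℝ rp (T.pMap hΩ y)) :
    ‖T.pMap hΩ x‖ ≤ P.ν * km⁻¹ * C * ‖T.qMap hΩ x‖ := by
  have hkm := hK.pos
  -- Darcy's law for the difference is tested with a field whose divergence is the pressure itself.
  obtain ⟨v, hv, hdiv, hle⟩ := hT (T.pMap hΩ x) x.1.2
  have h1 := stepForm_darcy h hv
  rw [hdiv, real_inner_self_eq_norm_sq] at h1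
  have h2 := mul_le_mul_of_nonneg_left (invForm_le hΩ hK (T.qMap hΩ x) v) hν.le
  have h3 : P.ν * (km⁻¹ * ‖T.qMap hΩ x‖ * ‖v‖)
      ≤ P.ν * (km⁻¹ * ‖T.qMap hΩ x‖ * (C * ‖T.pMap hΩ x‖)) := by gcongr
  rcases (norm_nonneg (T.pMap hΩ x)).eq_or_lt with h0 | h0
  · rw [← h0]; positivity
  · refine le_of_mul_le_mul_right ?_ h0
    rw [h1, sq] at h2
    linarith

theorem energySq_toState (C : ℝ) (x : T.StateSpace hΩ) :
    energySq P L₁ L₂ km kM C (toState x)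
      = (L₁ + P.τ * km ^ 2 / (P.ν * kM * C ^ 2)) * ‖T.pMap hΩ x‖ ^ 2
        + P.τ * P.ν / kM * ‖T.qMap hΩ x‖ ^ 2
        + 4 * P.μ * strainPair Ω (T.uMap hΩ x) (T.uMap hΩ x) + L₂ * ‖T.divU hΩ x‖ ^ 2 := rfl

/-- Twice the energy identity, with Young's inequality on the right. Of the doubled flux term one
copy stays in the energy and the other bounds the additional pressure term; `m ≤ L₂` leaves the
weight `L₂` on the divergence. -/
theorem energySq_le_of_stepForm {C : ℝ} (hC : 0 < C) (hν : 0 < P.ν) (hτ : 0 < P.τ)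
    (hkM : 0 < kM) (hT : T.DivStable C) {x : T.StateSpace hΩ} {rD rp : L2 Ω}
    (h : ∀ y, T.stepForm hΩ P L₁ L₂ hK x y
      = inner ℝ rD (T.divU hΩ y) + inner ℝ rp (T.pMap hΩ y))
    {a m δ : ℝ} (hL₁ : 0 ≤ L₁) (hm : 0 ≤ m) (hmL : m ≤ L₂) (hrp : ‖rp‖ ≤ L₁ * a)
    (hrD : ‖rD‖ ≤ m * δ) :
    energySq P L₁ L₂ km kM C (toState x) ≤ L₁ * a ^ 2 + m * δ ^ 2 := by
  have hkm := hK.pos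
  have h1 := stepForm_energy h
  have h2 := norm_pMap_le hC hν hT h
  have h3 := mul_le_mul_of_nonneg_left (invForm_self_ge hΩ hK (T.qMap hΩ x)) (mul_pos hτ hν).le
  have h4 : P.τ * km ^ 2 / (P.ν * kM * C ^ 2) * ‖T.pMap hΩ x‖ ^ 2
      ≤ P.τ * P.ν * (kM⁻¹ * ‖T.qMap hΩ x‖ ^ 2) := by
    have := pow_le_pow_left₀ (norm_nonneg _) h2 2
    calc _ ≤ P.τ * km ^ 2 / (P.ν * kM * C ^ 2) * (P.ν * km⁻¹ * C * ‖T.qMap hΩ x‖) ^ 2 := by gcongr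
      _ = _ := by field_simp
  have h5 : inner ℝ rD (T.divU hΩ x) ≤ m * δ * ‖T.divU hΩ x‖ :=
    (real_inner_le_norm _ _).trans (by gcongr)
  have h6 : inner ℝ rp (T.pMap hΩ x) ≤ L₁ * a * ‖T.pMap hΩ x‖ :=
    (real_inner_le_norm _ _).trans (by gcongr)
  have h7 := mul_nonneg hL₁ (sq_nonneg (a - ‖T.pMap hΩ x‖))
  have h8 := mul_nonneg hm (sq_nonneg (δ - ‖T.divU hΩ x‖))
  have h9 := mul_nonneg (sub_nonneg.2 hmL) (sq_nonneg ‖T.divU hΩ x‖)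
  have h10 : P.τ * P.ν / kM * ‖T.qMap hΩ x‖ ^ 2 = P.τ * P.ν * (kM⁻¹ * ‖T.qMap hΩ x‖ ^ 2) := by
    field_simp
  rw [energySq_toState, h10, add_mul]
  linarith

theorem stepForm_sub {f : L2Vec Ω} {S : L2 Ω} {old : State Ω} {x x' z z' : T.StateSpace hΩ}
    (hx : ∀ y, T.stepForm hΩ P L₁ L₂ hK x' y = T.stepLoad hΩ P L₁ L₂ hb hh f S old x y)
    (hz : ∀ y, T.stepForm hΩ P L₁ L₂ hK z' y = T.stepLoad hΩ P L₁ L₂ hb hh f S old z y)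
    (y : T.StateSpace hΩ) :
    T.stepForm hΩ P L₁ L₂ hK (x' - z') y
      = inner ℝ (L₂ • (T.divU hΩ x - T.divU hΩ z)
          - (superpose hh (T.divU hΩ x) - superpose hh (T.divU hΩ z))) (T.divU hΩ y)
        + inner ℝ (L₁ • (T.pMap hΩ x - T.pMap hΩ z)
          - (superpose hb (T.pMap hΩ x) - superpose hb (T.pMap hΩ z))) (T.pMap hΩ y) := by
  rw [map_sub, LinearMap.sub_apply, hx, hz, stepLoad_apply, stepLoad_apply]
  simp only [inner_sub_left, real_inner_smul_left]
  ring

-- The bounds on `K` determine the sign of `kM` only if `Ω` has a point; the empty domain is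
-- therefore treated separately below.
omit [IsFiniteMeasure (volume.restrict Ω)] in
theorem permeability_upper_pos (hne : Ω.Nonempty)
    (hK : BoundedPermeability Ω P.K km kM) : 0 < kM := by
  obtain ⟨x, hx⟩ := hne
  exact hK.pos.trans_le ((hK.le_K x hx).trans (hK.K_le x hx))

omit [IsFiniteMeasure (volume.restrict Ω)] in
theorem norm_eq_zero_of_empty (h : Ω = ∅) (f : L2 Ω) : ‖f‖ = 0 := by
  subst h
  rw [norm_eq_zero]
  exact Lp.ext ((ae_restrict_iff' MeasurableSet.empty).2 (Eventually.of_forall fun x hx => hx.elim))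

omit [IsFiniteMeasure (volume.restrict Ω)] in
theorem energySq_of_empty (h : Ω = ∅) (C : ℝ) (e : State Ω) :
    energySq P L₁ L₂ km kM C e = 0 := by
  have h0 : ∀ f : L2 Ω, f = 0 := fun f => norm_eq_zero.1 (norm_eq_zero_of_empty h f)
  have hq : e.q = 0 := PiLp.ext fun i => h0 _
  have hs : strainPair Ω e.u e.u = 0 := by
    refine Finset.sum_eq_zero fun i _ => Finset.sum_eq_zero fun j _ => ?_
    rw [pair_eq_inner, h0 (strain Ω e.u i j), inner_zero_left]
  rw [energySq, hs, hq, norm_eq_zero_of_empty h, norm_eq_zero_of_empty h, norm_zero]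
  ring

variable (hb hh) in
/-- One step of the L-scheme reduces the energy of differences. -/
theorem energySq_step_le {C : ℝ} (hC : 0 < C) (hν : 0 < P.ν) (hτ : 0 < P.τ)
    (hT : T.DivStable C) (hL₁ : Lb / 2 ≤ L₁) (hL₂ : Lh ≤ L₂)
    {f : L2Vec Ω} {S : L2 Ω} {old : State Ω} {x x' z z' : T.StateSpace hΩ}
    (hx : ∀ y, T.stepForm hΩ P L₁ L₂ hK x' y = T.stepLoad hΩ P L₁ L₂ hb hh f S old x y)
    (hz : ∀ y, T.stepForm hΩ P L₁ L₂ hK z' y = T.stepLoad hΩ P L₁ L₂ hb hh f S old z y) :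
    energySq P L₁ L₂ km kM C (toState (x' - z'))
      ≤ L₁ * ‖T.pMap hΩ (x - z)‖ ^ 2 + (L₂ - hm) * ‖T.divU hΩ (x - z)‖ ^ 2 := by
  rcases Ω.eq_empty_or_nonempty with he | hne
  · rw [energySq_of_empty he, norm_eq_zero_of_empty he, norm_eq_zero_of_empty he]
    simp
  have h1 : bm ≤ Lb := (hb.le_deriv 0).trans (hb.deriv_le 0)
  have h2 : hm ≤ Lh := (hh.le_deriv 0).trans (hh.deriv_le 0)
  have h3 := hb.pos
  have h4 := hh.pos
  rw [map_sub, map_sub]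
  refine energySq_le_of_stepForm hC hν hτ (permeability_upper_pos hne hK) hT
    (stepForm_sub hx hz) (by linarith) (by linarith) (by linarith)
    (norm_smul_sub_superpose_le hb (fun t ht ht' => ?_) _ _)
    (norm_smul_sub_superpose_le hh (fun t ht ht' => ?_) _ _)
  -- For the pressure, `0 < t ≤ Lb ≤ 2 L₁` gives `|L₁ - t| ≤ L₁`. For the divergence, `hm ≤ t ≤ Lh ≤
  -- L₂` gives `0 ≤ L₂ - t ≤ L₂ - hm`.
  · rw [abs_le]; constructor <;> linarith
  · rw [abs_le]; constructor <;> linarith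

-- The energy weighs the pressure by `L₁ + k` against `L₁`, with `k` the gain from divergence
-- stability, and the divergence by `L₂` against `L₂ - hm`. The larger of the two quotients is the
-- rate; no mesh enters.
omit [IsFiniteMeasure (volume.restrict Ω)] in
theorem exists_rate (hb : IncreasingLipschitz P.b bm Lb) (hh : IncreasingLipschitz P.h hm Lh)
    (hK : BoundedPermeability Ω P.K km kM) {C : ℝ} (hC : 0 < C) (hμ : 0 < P.μ) (hν : 0 < P.ν)
    (hτ : 0 < P.τ) (hL₁ : Lb / 2 ≤ L₁) (hL₂ : Lh ≤ L₂) :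
    ∃ θ : ℝ, 0 ≤ θ ∧ θ < 1 ∧ ∀ e : State Ω,
      L₁ * ‖e.p‖ ^ 2 + (L₂ - hm) * ‖weakDiv Ω e.u‖ ^ 2 ≤ θ * energySq P L₁ L₂ km kM C e := by
  rcases Ω.eq_empty_or_nonempty with he | hne
  · refine ⟨0, le_rfl, one_pos, fun e => ?_⟩
    rw [norm_eq_zero_of_empty he, norm_eq_zero_of_empty he]
    simp
  have h1 : bm ≤ Lb := (hb.le_deriv 0).trans (hb.deriv_le 0)
  have h2 : hm ≤ Lh := (hh.le_deriv 0).trans (hh.deriv_le 0)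
  have h3 := hb.pos
  have h4 := hh.pos
  have hkM := permeability_upper_pos hne hK
  have hkm := hK.pos
  have hL₁' : 0 < L₁ := by linarith
  have hL₂' : 0 < L₂ := by linarith
  set k := P.τ * km ^ 2 / (P.ν * kM * C ^ 2) with hk
  have hk0 : 0 < k := by positivity
  refine ⟨max (L₁ / (L₁ + k)) ((L₂ - hm) / L₂), le_max_of_le_left (by positivity),
    max_lt ?_ ?_, fun e => ?_⟩
  · rw [div_lt_one (by positivity)]; linarith
  · rw [div_lt_one hL₂']; linarith
  set θ := max (L₁ / (L₁ + k)) ((L₂ - hm) / L₂)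
  have hθ : 0 ≤ θ := le_max_of_le_left (by positivity)
  have h5 : L₁ ≤ θ * (L₁ + k) := (div_le_iff₀ (by positivity)).1 (le_max_left _ _)
  have h6 : L₂ - hm ≤ θ * L₂ := (div_le_iff₀ hL₂').1 (le_max_right _ _)
  have h7 := mul_le_mul_of_nonneg_right h5 (sq_nonneg ‖e.p‖)
  have h8 := mul_le_mul_of_nonneg_right h6 (sq_nonneg ‖weakDiv Ω e.u‖)
  have h9 : 0 ≤ θ * (P.τ * P.ν / kM * ‖e.q‖ ^ 2) := by positivity
  have h10 : 0 ≤ θ * (4 * P.μ * strainPair Ω e.u e.u) :=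
    mul_nonneg hθ (mul_nonneg (by positivity) (strainPair_self_nonneg e.u))
  rw [energySq, ← hk]
  linarith

end Mesh


/-! ### Fixed points of energy contractions -/

/-- Contraction principle for a map that contracts a continuous functional `E` of differences,
where `E` dominates the square of the norm. -/
theorem exists_fixedPoint_of_energy {X : Type*} [NormedAddCommGroup X] [CompleteSpace X]
    {Φ : X → X} {E : X → ℝ} (hE : Continuous E) (hE0 : E 0 = 0) {κ θ : ℝ} (hκ : 0 < κ)
    (hκE : ∀ x, ‖x‖ ^ 2 ≤ κ * E x) (hθ : 0 ≤ θ) (hθ1 : θ < 1)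
    (hΦ : ∀ x y, E (Φ x - Φ y) ≤ θ * E (x - y)) :
    ∃ x, Φ x = x ∧ ∀ Y : ℕ → X, (∀ n, Y (n + 1) = Φ (Y n)) → Tendsto Y atTop (𝓝 x) := by
  have hlim : ∀ {Z : ℕ → X} {z : X}, Tendsto (fun n => E (Z n - z)) atTop (𝓝 0) →
      Tendsto Z atTop (𝓝 z) := by
    intro Z z h
    rw [tendsto_iff_norm_sub_tendsto_zero]
    have h1 : Tendsto (fun n => Real.sqrt (κ * E (Z n - z))) atTop (𝓝 0) := by
      have := (Real.continuous_sqrt.tendsto (κ * 0)).comp (h.const_mul κ)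
      simpa [Function.comp_def] using this
    exact squeeze_zero (fun n => norm_nonneg _)
      (fun n => Real.le_sqrt_of_sq_le (hκE _)) h1
  set y : ℕ → X := fun n => Φ^[n] 0 with hy
  have hys : ∀ n, y (n + 1) = Φ (y n) := fun n => Function.iterate_succ_apply' Φ n 0
  have hgeo : ∀ {W Z : ℕ → X}, (∀ n, W (n + 1) = Φ (W n)) → (∀ n, Z (n + 1) = Φ (Z n)) →
      ∀ n, E (W n - Z n) ≤ E (W 0 - Z 0) * θ ^ n := by
    intro W Z hW hZ n
    induction n with
    | zero => simp
    | succ n ih =>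
      rw [hW, hZ, pow_succ, ← mul_assoc, mul_comm]
      exact (hΦ _ _).trans (mul_le_mul_of_nonneg_left ih hθ)
  -- `E` of successive differences decays like `θ ^ n`, so their norms decay like `√θ ^ n`.
  have hcau : CauchySeq y := by
    refine cauchySeq_of_le_geometric (Real.sqrt θ) (Real.sqrt (κ * E (y 1 - y 0)))
      ((Real.sqrt_lt' one_pos).2 (by simpa using hθ1)) fun n => ?_
    have h1 := hgeo (W := fun n => y (n + 1)) (Z := y) (fun n => hys (n + 1)) hys n
    rw [dist_comm, dist_eq_norm]
    refine (Real.le_sqrt_of_sq_le ((hκE _).trans (mul_le_mul_of_nonneg_left h1 hκ.le))).trans ?_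
    rw [← mul_assoc, Real.sqrt_mul' _ (pow_nonneg hθ n)]
    refine mul_le_mul_of_nonneg_left (le_of_eq ?_) (Real.sqrt_nonneg _)
    rw [Real.sqrt_eq_iff_mul_self_eq (pow_nonneg hθ n) (by positivity), ← mul_pow,
      Real.mul_self_sqrt hθ]
  obtain ⟨x, hx⟩ := cauchySeq_tendsto_of_complete hcau
  have hE0' : ∀ z, 0 ≤ E z := fun z =>
    nonneg_of_mul_nonneg_right ((sq_nonneg _).trans (hκE z)) hκ
  have h1 : Tendsto (fun n => θ * E (y n - x)) atTop (𝓝 0) := by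
    have := ((hE.tendsto 0).comp (show Tendsto (fun n => y n - x) atTop (𝓝 0) by
      simpa using hx.sub_const x)).const_mul θ
    simpa [hE0, Function.comp_def] using this
  -- The limit passes through `Φ` because `E (Φ yₙ - Φ x) ≤ θ E (yₙ - x)`, which tends to zero by
  -- continuity of `E`.
  have h2 : Tendsto (fun n => y (n + 1)) atTop (𝓝 (Φ x)) :=
    hlim (squeeze_zero (fun n => hE0' _) (fun n => by rw [hys]; exact hΦ _ _) h1)
  have hfix : Φ x = x := tendsto_nhds_unique h2 ((tendsto_add_atTop_iff_nat 1).2 hx)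
  refine ⟨x, hfix, fun Y hY => hlim ?_⟩
  refine squeeze_zero (fun n => hE0' _)
    (fun n => hgeo hY (Z := fun _ => x) (fun _ => hfix.symm) n) ?_
  simpa using (tendsto_pow_atTop_nhds_zero_of_lt_one hθ hθ1).const_mul (E (Y 0 - x))

/-! ### Solvability of a step and coercivity of the energy -/

namespace Mesh

variable {d : ℕ} {Ω : Set (Space d)} {T : Mesh Ω} {hΩ : IsOpen Ω}
  [IsFiniteMeasure (volume.restrict Ω)] {P : Coeffs d} {L₁ L₂ bm Lb hm Lh km kM : ℝ}

/-- A state without pressure, flux and strain vanishes. -/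
theorem eq_zero_of_strain (hd : 1 ≤ d) (hΩb : Bornology.IsBounded Ω) {x : T.StateSpace hΩ}
    (hp : T.pMap hΩ x = 0) (hq : T.qMap hΩ x = 0)
    (hu : strainPair Ω (T.uMap hΩ x) (T.uMap hΩ x) = 0) : x = 0 := by
  have h := eq_zero_of_strainPair_eq_zero hd hΩ hΩb (uMap_mem_H10 x) hu
  exact Prod.ext (Subtype.ext hp) (Prod.ext (Subtype.ext hq) (Subtype.ext h))

/-- With zero load the energy identity is a vanishing sum of non-negative terms, so pressure, flux
and strain vanish, and the displacement by Korn's identity. -/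
theorem stepForm_injective (hK : BoundedPermeability Ω P.K km kM) (hd : 1 ≤ d)
    (hΩb : Bornology.IsBounded Ω) (hμ : 0 < P.μ) (hν : 0 < P.ν) (hτ : 0 < P.τ) (hL₁ : 0 < L₁)
    (hL₂ : 0 < L₂) : Function.Injective (T.stepForm hΩ P L₁ L₂ hK) := by
  rcases Ω.eq_empty_or_nonempty with he | hne
  · have h0 : ∀ f : L2 Ω, f = 0 := fun f => norm_eq_zero.1 (norm_eq_zero_of_empty he f)
    intro x y _
    rw [← sub_eq_zero]
    refine eq_zero_of_strain hd hΩb (h0 _) (PiLp.ext fun i => h0 _) ?_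
    refine Finset.sum_eq_zero fun i _ => Finset.sum_eq_zero fun j _ => ?_
    rw [pair_eq_inner, h0 (strain Ω _ i j), inner_zero_left]
  refine (injective_iff_map_eq_zero _).2 fun x hx => ?_
  have h1 := stepForm_energy (T := T) (hΩ := hΩ) (P := P) (L₁ := L₁) (L₂ := L₂) (hK := hK)
    (x := x) (rD := 0) (rp := 0) (fun y => by
      rw [hx, LinearMap.zero_apply, inner_zero_left, inner_zero_left, add_zero])
  rw [inner_zero_left, inner_zero_left, add_zero] at h1
  have hkM := permeability_upper_pos hne hK
  have h2 := mul_le_mul_of_nonneg_left (invForm_self_ge hΩ hK (T.qMap hΩ x)) (mul_pos hτ hν).le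
  have h3 : 0 ≤ P.τ * P.ν * (kM⁻¹ * ‖T.qMap hΩ x‖ ^ 2) := by positivity
  have h4 : 0 ≤ L₂ * ‖T.divU hΩ x‖ ^ 2 := by positivity
  have h5 : 0 ≤ L₁ * ‖T.pMap hΩ x‖ ^ 2 := by positivity
  have h6 := mul_nonneg (mul_nonneg two_pos.le hμ.le) (strainPair_self_nonneg (T.uMap hΩ x))
  have h7 : L₁ * ‖T.pMap hΩ x‖ ^ 2 = 0 := by linarith
  have h8 : P.τ * P.ν * (kM⁻¹ * ‖T.qMap hΩ x‖ ^ 2) = 0 := by linarith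
  have h9 : 2 * P.μ * strainPair Ω (T.uMap hΩ x) (T.uMap hΩ x) = 0 := by linarith
  refine eq_zero_of_strain hd hΩb ?_ ?_ ?_
  · simpa [hL₁.ne'] using h7
  · simpa [hτ.ne', hν.ne', hkM.ne'] using h8
  · simpa [hμ.ne'] using h9

theorem existsUnique_stepForm (hΩr : interior (closure Ω) = Ω)
    (hK : BoundedPermeability Ω P.K km kM) (hd : 1 ≤ d) (hΩb : Bornology.IsBounded Ω)
    (hμ : 0 < P.μ) (hν : 0 < P.ν) (hτ : 0 < P.τ) (hL₁ : 0 < L₁) (hL₂ : 0 < L₂)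
    (ℓ : T.StateSpace hΩ →ₗ[ℝ] ℝ) :
    ∃! x, ∀ y, T.stepForm hΩ P L₁ L₂ hK x y = ℓ y := by
  have := T.finiteDimensional_stateSpace hΩ hΩr
  have hinj := stepForm_injective (T := T) (hΩ := hΩ) hK hd hΩb hμ hν hτ hL₁ hL₂
  have hsurj := (LinearMap.injective_iff_surjective_of_finrank_eq_finrank
    (Subspace.dual_finrank_eq (K := ℝ) (V := T.StateSpace hΩ)).symm).1 hinj
  obtain ⟨x, hx⟩ := hsurj ℓ
  exact ⟨x, fun y => by rw [hx], fun z hz => hinj (LinearMap.ext fun y => by rw [hz, hx])⟩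

theorem continuous_energySq (hΩr : interior (closure Ω) = Ω) (C : ℝ) :
    Continuous fun x : T.StateSpace hΩ => energySq P L₁ L₂ km kM C (toState x) := by
  have := T.finiteDimensional_stateSpace hΩ hΩr
  have h1 := (T.pMap hΩ).continuous_of_finiteDimensional
  have h2 := (T.qMap hΩ).continuous_of_finiteDimensional
  have h3 := (T.divU hΩ).continuous_of_finiteDimensional
  have h4 := fun i j => (T.strainU hΩ i j).continuous_of_finiteDimensional
  simp only [energySq_toState, strainPair_eq]
  have h5 : Continuous fun x : T.StateSpace hΩ =>
      ∑ i, ∑ j, inner ℝ (T.strainU hΩ i j x) (T.strainU hΩ i j x) :=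
    continuous_finsetSum _ fun i _ => continuous_finsetSum _ fun j _ => (h4 i j).inner (h4 i j)
  exact (((h1.norm.pow 2).const_mul _).add ((h2.norm.pow 2).const_mul _)).add
    (h5.const_mul _) |>.add ((h3.norm.pow 2).const_mul _)

/-- On the finite-dimensional discrete space the energy dominates the norm. -/
theorem exists_norm_sq_le_energySq (hΩr : interior (closure Ω) = Ω) (hd : 1 ≤ d)
    (hΩb : Bornology.IsBounded Ω) (hK : BoundedPermeability Ω P.K km kM) {C : ℝ}
    (hμ : 0 < P.μ) (hν : 0 < P.ν) (hτ : 0 < P.τ) (hL₁ : 0 < L₁) (hL₂ : 0 < L₂) :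
    ∃ κ : ℝ, 0 < κ ∧ ∀ x : T.StateSpace hΩ,
      ‖x‖ ^ 2 ≤ κ * energySq P L₁ L₂ km kM C (toState x) := by
  have := T.finiteDimensional_stateSpace hΩ hΩr
  rcases Ω.eq_empty_or_nonempty with he | hne
  · refine ⟨1, one_pos, fun x => ?_⟩
    have h0 : ∀ f : L2 Ω, f = 0 := fun f => norm_eq_zero.1 (norm_eq_zero_of_empty he f)
    have : x = 0 := by
      refine eq_zero_of_strain hd hΩb (h0 _) (PiLp.ext fun i => h0 _) ?_
      refine Finset.sum_eq_zero fun i _ => Finset.sum_eq_zero fun j _ => ?_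
      rw [pair_eq_inner, h0 (strain Ω _ i j), inner_zero_left]
    rw [energySq_of_empty he, this, norm_zero]
    simp
  have hkM := permeability_upper_pos hne hK
  -- The map to pressure, flux and strain is injective, hence bounded below in finite dimension, and
  -- its squared norm is dominated by the energy. The resulting constant may depend on the mesh; it
  -- serves only for convergence on a fixed mesh.
  let N : T.StateSpace hΩ →ₗ[ℝ] WithLp 2 (L2 Ω × WithLp 2 (L2Vec Ω ×
      PiLp 2 fun _ : Fin d => PiLp 2 fun _ : Fin d => L2 Ω)) :=
    (WithLp.linearEquiv 2 ℝ _).symm.toLinearMap ∘ₗ (T.pMap hΩ).prod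
      ((WithLp.linearEquiv 2 ℝ _).symm.toLinearMap ∘ₗ (T.qMap hΩ).prod
        ((WithLp.linearEquiv 2 ℝ _).symm.toLinearMap ∘ₗ LinearMap.pi fun i =>
          (WithLp.linearEquiv 2 ℝ _).symm.toLinearMap ∘ₗ LinearMap.pi fun j => T.strainU hΩ i j))
  have hN : ∀ x, ‖N x‖ ^ 2 = ‖T.pMap hΩ x‖ ^ 2 + (‖T.qMap hΩ x‖ ^ 2
      + strainPair Ω (T.uMap hΩ x) (T.uMap hΩ x)) := fun x => by
    rw [WithLp.prod_norm_sq_eq_of_L2, WithLp.prod_norm_sq_eq_of_L2, PiLp.norm_sq_eq_of_L2,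
      strainPair_eq]
    simp only [PiLp.norm_sq_eq_of_L2, real_inner_self_eq_norm_sq]
    rfl
  have hker : LinearMap.ker N = ⊥ := by
    refine LinearMap.ker_eq_bot'.2 fun x hx => ?_
    have h1 := hN x
    rw [hx, norm_zero] at h1
    have h2 := strainPair_self_nonneg (T.uMap hΩ x)
    have h3 := sq_nonneg ‖T.pMap hΩ x‖
    have h4 := sq_nonneg ‖T.qMap hΩ x‖
    have h5 : ‖T.pMap hΩ x‖ ^ 2 = 0 := by linarith
    have h6 : ‖T.qMap hΩ x‖ ^ 2 = 0 := by linarith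
    exact eq_zero_of_strain hd hΩb (by simpa using h5) (by simpa using h6) (by linarith)
  obtain ⟨K, hK0, hKN⟩ := N.exists_antilipschitzWith hker
  obtain ⟨c, hc, hc1, hc2, hc3⟩ : ∃ c : ℝ, 0 < c ∧ c ≤ L₁ ∧ c ≤ P.τ * P.ν / kM ∧ c ≤ 4 * P.μ :=
    ⟨min L₁ (min (P.τ * P.ν / kM) (4 * P.μ)), by positivity, min_le_left _ _,
      (min_le_right _ _).trans (min_le_left _ _), (min_le_right _ _).trans (min_le_right _ _)⟩
  have hK0' : (0 : ℝ) < K := hK0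
  refine ⟨K ^ 2 / c, by positivity, fun x => ?_⟩
  have h1 : ‖x‖ ≤ K * ‖N x‖ := by
    have := hKN.le_mul_dist x 0
    rwa [map_zero, dist_zero_right, dist_zero_right] at this
  have h2 := pow_le_pow_left₀ (norm_nonneg x) h1 2
  have h3 : c * ‖N x‖ ^ 2 ≤ energySq P L₁ L₂ km kM C (toState x) := by
    rw [hN, energySq_toState]
    have e1 := mul_le_mul_of_nonneg_right hc1 (sq_nonneg ‖T.pMap hΩ x‖)
    have e2 := mul_le_mul_of_nonneg_right hc2 (sq_nonneg ‖T.qMap hΩ x‖)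
    have e3 := mul_le_mul_of_nonneg_right hc3 (strainPair_self_nonneg (T.uMap hΩ x))
    have e4 : 0 ≤ P.τ * km ^ 2 / (P.ν * kM * C ^ 2) * ‖T.pMap hΩ x‖ ^ 2 := by positivity
    have e5 : 0 ≤ L₂ * ‖T.divU hΩ x‖ ^ 2 := by positivity
    rw [add_mul]
    linarith
  calc ‖x‖ ^ 2 ≤ (K * ‖N x‖) ^ 2 := h2
    _ = K ^ 2 / c * (c * ‖N x‖ ^ 2) := by field_simp
    _ ≤ _ := by gcongr

/-- Convergence in the discrete space implies convergence in the norms of the problem. -/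
theorem stateTendsto_of_tendsto (hΩr : interior (closure Ω) = Ω) {X : ℕ → T.StateSpace hΩ}
    {x : T.StateSpace hΩ} (h : Tendsto X atTop (𝓝 x)) :
    StateTendsto (fun n => toState (X n)) (toState x) := by
  have := T.finiteDimensional_stateSpace hΩ hΩr
  exact ⟨((T.pMap hΩ).continuous_of_finiteDimensional.tendsto x).comp h,
    ((T.qMap hΩ).continuous_of_finiteDimensional.tendsto x).comp h,
    ((T.divQ hΩ).continuous_of_finiteDimensional.tendsto x).comp h,
    ((T.uMap hΩ).continuous_of_finiteDimensional.tendsto x).comp h,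
    fun j k => ((T.gradU hΩ j k).continuous_of_finiteDimensional.tendsto x).comp h⟩

end Mesh


/-! ### The uniform stability constant -/

namespace Mesh

variable {d : ℕ} {Ω : Set (Space d)}

theorem DivStable.mono {T : Mesh Ω} {C C' : ℝ} (h : T.DivStable C) (hC : C ≤ C') :
    T.DivStable C' := fun w hw => by
  obtain ⟨v, hv, hdiv, hle⟩ := h w hw
  exact ⟨v, hv, hdiv, hle.trans (mul_le_mul_of_nonneg_right hC (norm_nonneg w))⟩

/-- The divergence stability constant depends only on the domain and the shape regularity. -/
theorem exists_divStable (hd : 1 ≤ d) (hΩ : IsOpen Ω) (hΩb : Bornology.IsBounded Ω)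
    (hΩr : interior (closure Ω) = Ω) [IsFiniteMeasure (volume.restrict Ω)] (σ : ℝ) :
    ∃ C : ℝ, 0 < C ∧ ∀ T : Mesh Ω, T.ShapeRegular σ → T.DivStable C := by
  rcases hd.eq_or_lt with rfl | hd
  -- The summand one keeps the constant positive when the volume is zero, and below when `σ = 0`.
  · exact ⟨volume.real Ω + 1, by positivity, fun T _ =>
      (T.divStable_one hΩ hΩr).mono (by linarith)⟩
  · obtain ⟨R, hR0, hR⟩ : ∃ R : ℝ, 0 < R ∧ ∀ x ∈ closure Ω, ‖x‖ ≤ R :=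
      hΩb.closure.exists_pos_norm_le
    exact ⟨4 * (d + 1) * σ ^ 2 * R + 1, by positivity, fun T hσ =>
      (T.divStable_of_two_le hd hΩ hΩr hR0.le hR hσ).mono (by linarith)⟩

end Mesh

end
end NonlinearBiot

/-! ### The main theorem -/

theorem mainTheorem2 (d : ℕ) (hd1 : 1 ≤ d) (hd3 : d ≤ 3) (Ω : Set (Space d))
    (hΩ_open : IsOpen Ω) (hΩ_bdd : Bornology.IsBounded Ω) (hΩ_reg : interior (closure Ω) = Ω)
    (σ : ℝ) :
    ∃ C : ℝ, 0 < C ∧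
      (∀ T : Mesh Ω, T.ShapeRegular σ → T.DivStable C) ∧
      ∀ (P : Coeffs d) (bm Lb hm Lh km kM L₁ L₂ : ℝ),
        0 < P.μ → 0 < P.ν → 0 < P.τ →
        IncreasingLipschitz P.b bm Lb → IncreasingLipschitz P.h hm Lh →
        BoundedPermeability Ω P.K km kM →
        Lb / 2 ≤ L₁ → Lh ≤ L₂ →
        ∃ θ : ℝ, 0 ≤ θ ∧ θ < 1 ∧
          ∀ T : Mesh Ω, T.ShapeRegular σ →
          ∀ (f : L2Vec Ω) (S : L2 Ω) (old : State Ω), old ∈ T.states →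
            -- the iteration map is well defined
            (∀ x ∈ T.states, ∃! x', IsStep T P L₁ L₂ f S old x x') ∧
            -- the iteration map is a contraction in the weighted energy norm
            (∀ x ∈ T.states, ∀ y ∈ T.states, ∀ x' y' : State Ω,
              IsStep T P L₁ L₂ f S old x x' → IsStep T P L₁ L₂ f S old y y' →
              energySq P L₁ L₂ km kM C (x'.diff y')
                  ≤ L₁ * ‖x.p - y.p‖ ^ 2 + (L₂ - hm) * ‖weakDiv Ω (x.u - y.u)‖ ^ 2 ∧
              energySq P L₁ L₂ km kM C (x'.diff y')
                  ≤ θ * energySq P L₁ L₂ km kM C (x.diff y)) ∧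
            -- the inequality for differences of successive iterates
            (∀ X : ℕ → State Ω, IsLScheme T P L₁ L₂ f S old X → ∀ i : ℕ,
              energySq P L₁ L₂ km kM C ((X (i + 2)).diff (X (i + 1)))
                ≤ L₁ * ‖(X (i + 1)).p - (X i).p‖ ^ 2
                  + (L₂ - hm) * ‖weakDiv Ω ((X (i + 1)).u - (X i).u)‖ ^ 2) ∧
            -- convergence to the unique solution of the non-linear problem
            (∃ x : State Ω, IsSolution T P f S old x ∧
              (∀ y : State Ω, IsSolution T P f S old y → y = x) ∧
              ∀ X : ℕ → State Ω, IsLScheme T P L₁ L₂ f S old X → StateTendsto X x) := by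
  have hfin : IsFiniteMeasure (volume.restrict Ω) :=
    ⟨by rw [Measure.restrict_apply_univ]; exact hΩ_bdd.measure_lt_top⟩
  obtain ⟨C, hC, hdiv⟩ := Mesh.exists_divStable hd1 hΩ_open hΩ_bdd hΩ_reg σ
  refine ⟨C, hC, hdiv, fun P bm Lb hm Lh km kM L₁ L₂ hμ hν hτ hb hh hK hL₁ hL₂ => ?_⟩
  -- The rate is fixed before any mesh or data are introduced, since it depends on the mesh only
  -- through the uniform `C`.
  obtain ⟨θ, hθ0, hθ1, hθ⟩ := Mesh.exists_rate hb hh hK hC hμ hν hτ hL₁ hL₂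
  have hL₁0 : 0 < L₁ := by
    have := hb.pos.trans_le ((hb.le_deriv 0).trans (hb.deriv_le 0))
    linarith
  have hL₂0 : 0 < L₂ := by
    have := hh.pos.trans_le ((hh.le_deriv 0).trans (hh.deriv_le 0))
    linarith
  refine ⟨θ, hθ0, hθ1, fun T hσ f S old _ => ?_⟩
  have hstep : ∀ x : T.StateSpace hΩ_open, ∃! x' : T.StateSpace hΩ_open,
      IsStep T P L₁ L₂ f S old (Mesh.toState x) (Mesh.toState x') := fun x => by
    simp only [Mesh.isStep_iff hΩ_open P L₁ L₂ hb hh hK]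
    exact Mesh.existsUnique_stepForm hΩ_reg hK hd1 hΩ_bdd hμ hν hτ hL₁0 hL₂0 _
  have hcon : ∀ x x' z z' : T.StateSpace hΩ_open,
      IsStep T P L₁ L₂ f S old (Mesh.toState x) (Mesh.toState x') →
      IsStep T P L₁ L₂ f S old (Mesh.toState z) (Mesh.toState z') →
      energySq P L₁ L₂ km kM C (Mesh.toState (x' - z'))
        ≤ L₁ * ‖T.pMap hΩ_open (x - z)‖ ^ 2
          + (L₂ - hm) * ‖T.divU hΩ_open (x - z)‖ ^ 2 := fun x x' z z' hx hz =>
    Mesh.energySq_step_le hb hh hC hν hτ (hdiv T hσ) hL₁ hL₂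
      ((Mesh.isStep_iff hΩ_open P L₁ L₂ hb hh hK f S old x x').1 hx)
      ((Mesh.isStep_iff hΩ_open P L₁ L₂ hb hh hK f S old z z').1 hz)
  have hcontr : ∀ x ∈ T.states, ∀ y ∈ T.states, ∀ x' y' : State Ω,
      IsStep T P L₁ L₂ f S old x x' → IsStep T P L₁ L₂ f S old y y' →
      energySq P L₁ L₂ km kM C (x'.diff y')
        ≤ L₁ * ‖x.p - y.p‖ ^ 2 + (L₂ - hm) * ‖weakDiv Ω (x.u - y.u)‖ ^ 2 := by
    intro x hx y hy x' y' hxx hyy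
    obtain ⟨x, rfl⟩ := Mesh.exists_toState hΩ_open hx
    obtain ⟨y, rfl⟩ := Mesh.exists_toState hΩ_open hy
    obtain ⟨x', rfl⟩ := Mesh.exists_toState hΩ_open hxx.mem
    obtain ⟨y', rfl⟩ := Mesh.exists_toState hΩ_open hyy.mem
    exact hcon x x' y y' hxx hyy
  have hmem : ∀ X : ℕ → State Ω, IsLScheme T P L₁ L₂ f S old X → ∀ i, X i ∈ T.states := by
    rintro X ⟨h0, hX⟩ (_ | i)
    exacts [h0, (hX i).mem]
  refine ⟨fun x hx => ?_, fun x hx y hy x' y' hxx hyy => ?_, fun X hX i => ?_, ?_⟩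
  · obtain ⟨x, rfl⟩ := Mesh.exists_toState hΩ_open hx
    obtain ⟨x', hx', huniq⟩ := hstep x
    refine ⟨Mesh.toState x', hx', fun z hz => ?_⟩
    obtain ⟨z, rfl⟩ := Mesh.exists_toState hΩ_open hz.mem
    rw [huniq z hz]
  · have h := hcontr x hx y hy x' y' hxx hyy
    exact ⟨h, h.trans (hθ (x.diff y))⟩
  · exact hcontr _ (hmem X hX _) _ (hmem X hX _) _ _ (hX.2 _) (hX.2 _)
  · choose Φ hΦ hΦu using hstep
    have hfd := T.finiteDimensional_stateSpace hΩ_open hΩ_reg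
    have hcomplete : CompleteSpace (T.StateSpace hΩ_open) := FiniteDimensional.complete ℝ _
    obtain ⟨κ, hκ, hκE⟩ := Mesh.exists_norm_sq_le_energySq (T := T) (hΩ := hΩ_open) (C := C)
      hΩ_reg hd1 hΩ_bdd hK hμ hν hτ hL₁0 hL₂0
    have hE0 : energySq P L₁ L₂ km kM C (Mesh.toState (0 : T.StateSpace hΩ_open)) = 0 := by
      rw [Mesh.energySq_toState, Mesh.strainPair_eq]
      simp
    obtain ⟨x, hx, hconv⟩ := exists_fixedPoint_of_energy (Φ := Φ)
      (Mesh.continuous_energySq hΩ_reg C) hE0 hκ hκE hθ0 hθ1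
      (fun y z => (hcon y _ z _ (hΦ y) (hΦ z)).trans (hθ (Mesh.toState (y - z))))
    refine ⟨Mesh.toState x, (isSolution_iff_isStep L₁ L₂).2 ?_, fun y hy => ?_, fun X hX => ?_⟩
    · have := hΦ x
      rwa [hx] at this
    · rw [isSolution_iff_isStep L₁ L₂] at hy
      obtain ⟨y, rfl⟩ := Mesh.exists_toState hΩ_open hy.mem
      -- A solution is a constant sequence of iterates, which converges to `x` like every other.
      have h1 : Tendsto (fun _ : ℕ => y) atTop (𝓝 x) :=
        hconv (fun _ => y) fun _ => hΦu y y hy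
      rw [tendsto_nhds_unique tendsto_const_nhds h1]
    · choose Y hY using fun i => Mesh.exists_toState hΩ_open (hmem X hX i)
      obtain rfl : (fun i => Mesh.toState (Y i)) = X := funext hY
      exact Mesh.stateTendsto_of_tendsto hΩ_reg
        (hconv Y fun i => hΦu _ _ (hX.2 i))
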